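/- Let $\mathfrak g$ be a finite-dimensional simple Lie algebra over $\mathbf C$ with a nondegenerate symmetric invariant bilinear form $(\cdot\mid\cdot)$, let $G$ be a connected algebraic group with Lie algebra $\mathfrak g$, and let $\Phi:\mathfrak g\to\mathfrak g^*$, $x\mapsto(x\mid\cdot)$. The symmetric algebra $\mathcal S(\mathfrak g)=\mathbf C[\mathfrak g^*]$ carries the Kirillov–Kostant Poisson bracket, which extends the Lie bracket of $\mathfrak g$. For $i=1,2$ let $f_i\in\mathfrak g$ be nilpotent, $\chi_i=\Phi(f_i)$, and let $\mathfrak g=\bigoplus_{j\in\mathbf Z}\mathfrak g^{(i)}_j$ be a Lie algebra grading that is good for $f_i$: $f_i\in\mathfrak g^{(i)}_{-2}$, and $\operatorname{ad}(f_i):\mathfrak g^{(i)}_j\to\mathfrak g^{(i)}_{j-2}$ is injective for $j\ge1$ and surjective for $j\le1$. Let $q_i$ be the semisimple element with $\mathfrak g^{(i)}_j=\{x:[q_i,x]=jx\}$, and assume that $q_1,q_2$ lie in a common Cartan subalgebra $\mathfrak h$. Let $\mathfrak m_i=\mathfrak l_i\oplus\bigoplus_{j\ge2}\mathfrak g^{(i)}_j$,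 where $\mathfrak l_i\subseteq\mathfrak g^{(i)}_1$ is Lagrangian for the form $\chi_i([\cdot,\cdot])$; let $M_i\subseteq G$ be the connected unipotent subgroup with Lie algebra $\mathfrak m_i$, acting on $\mathfrak g^*$ by the coadjoint action, and $\mu_i:\mathfrak g^*\to\mathfrak m_i^*$, $\xi\mapsto(\xi-\chi_i)|_{\mathfrak m_i}$. Let $I_i$ be the ideal of $\mathcal S(\mathfrak g)$ spanned by $y-\chi_i(y)$, $y\in\mathfrak m_i$, and let $\mathcal P(\mathfrak g,f_i)=(\mathcal S(\mathfrak g)/I_i)^{\operatorname{ad}\mathfrak m_i}$ be the classical finite W-algebra, with the Poisson bracket $\{X\bmod I_i,Y\bmod I_i\}=\{X,Y\}\bmod I_i$. Let $(e_2,h_2,f_2)$ be an $\mathfrak{sl}_2$-triple with $h_2\in\mathfrak g^{(2)}_0$, $e_2\in\mathfrak g^{(2)}_2$ (the zero triple if $f_2=0$), and let $S_{f_2}=\Phi(f_2+\operatorname{Ker}\operatorname{ad}e_2)$ be the Slodowy slice. Assume that: 1. $\mathfrak m_2=\mathfrak m_1\oplus\mathfrak m_0$, where $\mathfrak m_0$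 is an $\mathfrak h$-stable Lie subalgebra and $\mathfrak m_1$ is an ideal of $\mathfrak m_2$; 2. $f_2-f_1$ and $\mathfrak m_0$ are contained in $\mathfrak g^{(1)}_0$; 3. $q_2-q_1$ commutes with $f_1$. Let $M_0\subseteq G$ be the unipotent subgroup with Lie algebra $\mathfrak m_0$. Then $S_{f_2}\subseteq\mu_2^{-1}(0)\subseteq\mu_1^{-1}(0)$. For $i=1,2$ the geometric quotient $\mu_i^{-1}(0)/M_i$ exists as an affine variety, with coordinate ring $\mathcal P(\mathfrak g,f_i)$ (the class $X\bmod I_i$ being the function $[\xi]\mapsto X(\xi)$), and restriction of functions to $S_{f_2}$ is an isomorphism $\mathcal P(\mathfrak g,f_2)\cong\mathbf C[S_{f_2}]$; these varieties are given the corresponding Poisson structures. The group $M_0$ acts on $\mu_1^{-1}(0)/M_1$ by $g\cdot[\xi]=[\operatorname{Ad}^*(g)\xi]$, and the map $\mu_0:\mu_1^{-1}(0)/M_1\to\mathfrak m_0^*$, $[\xi]\mapsto(\xi-\chi_2)|_{\mathfrak m_0}$, is well defined. The elements $(y-\chi_2(y))\bmod I_1$, $y\in\mathfrak m_0$, lie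 in $\mathcal P(\mathfrak g,f_1)$; let $I_0$ be the ideal of $\mathcal P(\mathfrak g,f_1)$ that they span. Moreover: (a) $\mu_0^{-1}(0)$ is $M_0$-stable, the geometric quotient $\mu_0^{-1}(0)/M_0$ exists as an affine variety, its coordinate ring is $(\mathcal P(\mathfrak g,f_1)/I_0)^{\operatorname{ad}\mathfrak m_0}$, so that it is a Poisson variety for the bracket induced from $\mathcal P(\mathfrak g,f_1)$, and it is isomorphic to $S_{f_2}$ as a Poisson variety. (b) The inclusion $\mu_2^{-1}(0)\subseteq\mu_1^{-1}(0)$ induces an isomorphism of Poisson varieties $\mu_2^{-1}(0)/M_2\cong\mu_0^{-1}(0)/M_0$. (c) The comorphism of the isomorphism in (b) is $$\Psi:(\mathcal P(\mathfrak g,f_1)/I_0)^{\operatorname{ad}\mathfrak m_0}\to\mathcal P(\mathfrak g,f_2),\qquad (X\bmod I_1)\bmod I_0\mapsto X\bmod I_2,$$ and it is an isomorphism of Poisson algebras. -/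

import Mathlib

open Module

noncomputable section

/-! ### Poisson algebras and their Hamiltonian reductions -/

/-- A Poisson bracket on a commutative `ℂ`-algebra. -/
structure PoissonStructure (A : Type*) [CommRing A] [Algebra ℂ A] where
  bracket : A →ₗ[ℂ] A →ₗ[ℂ] A
  bracket_self : ∀ a, bracket a a = 0
  jacobi : ∀ a b c,
    bracket a (bracket b c) = bracket (bracket a b) c + bracket b (bracket a c)
  leibniz : ∀ a b c, bracket a (b * c) = b * bracket a c + c * bracket a b

namespace PoissonStructure

variable {A : Type*} [CommRing A] [Algebra ℂ A] (P : PoissonStructure A)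

theorem bracket_swap (a b : A) : P.bracket a b = -P.bracket b a := by
  have h := P.bracket_self (a + b)
  simp only [map_add, LinearMap.add_apply, P.bracket_self, zero_add, add_zero] at h
  exact eq_neg_of_add_eq_zero_right h

theorem bracket_one (a : A) : P.bracket a 1 = 0 := by
  have h := P.leibniz a 1 1
  simpa using h

/-- Transport of a Poisson bracket along an algebra isomorphism. -/
def transport {A' : Type*} [CommRing A'] [Algebra ℂ A'] (e : A ≃ₐ[ℂ] A') :
    PoissonStructure A' where
  bracket := (P.bracket.compl₁₂ e.symm.toLinearMap e.symm.toLinearMap).compr₂ e.toLinearMap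
  bracket_self a := by simp [P.bracket_self]
  jacobi a b c := by
    simp [P.jacobi (e.symm a) (e.symm b) (e.symm c)]
  leibniz a b c := by
    simp [P.leibniz]

variable (T : Set A)

/-- The elements `X` of `A` such that `{t, X}` lies in the ideal spanned by `T`,
for all `t ∈ T`. -/
def normalizer : Subalgebra ℂ A where
  carrier := {X | ∀ t ∈ T, P.bracket t X ∈ Ideal.span T}
  mul_mem' {X Y} hX hY t ht := by
    rw [P.leibniz]
    exact Ideal.add_mem _ (Ideal.mul_mem_left _ _ (hY t ht)) (Ideal.mul_mem_left _ _ (hX t ht))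
  add_mem' {X Y} hX hY t ht := by
    rw [map_add]
    exact Ideal.add_mem _ (hX t ht) (hY t ht)
  algebraMap_mem' r t ht := by
    rw [Algebra.algebraMap_eq_smul_one, map_smul, P.bracket_one, smul_zero]
    exact Ideal.zero_mem _

/-- The algebra `(A / I)^{ad T}`, where `I` is the ideal of `A` spanned by `T`: it consists of
all classes `X mod I` such that `{t, X} ∈ I` for all `t ∈ T`. -/
def reduction : Subalgebra ℂ (A ⧸ Ideal.span T) :=
  (P.normalizer T).map (Ideal.Quotient.mkₐ ℂ (Ideal.span T))

variable {P T}

theorem bracket_mem_of_mem_span {i X : A} (hi : i ∈ Ideal.span T) (hX : X ∈ P.normalizer T) :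
    P.bracket i X ∈ Ideal.span T := by
  induction hi using Submodule.span_induction with
  | mem t ht => exact hX t ht
  | zero => simp
  | add a b _ _ ha hb =>
    rw [map_add, LinearMap.add_apply]
    exact Ideal.add_mem _ ha hb
  | smul a b hb' hb =>
    rw [P.bracket_swap, smul_eq_mul, P.leibniz, neg_add]
    refine Ideal.add_mem _ ?_ ?_
    · rw [P.bracket_swap X b, mul_neg, neg_neg]
      exact Ideal.mul_mem_left _ _ hb
    · exact neg_mem (Ideal.mul_mem_right _ _ hb')

theorem bracket_mem_normalizer {X Y : A} (hX : X ∈ P.normalizer T) (hY : Y ∈ P.normalizer T) :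
    P.bracket X Y ∈ P.normalizer T := by
  intro t ht
  rw [P.jacobi]
  refine Ideal.add_mem _ (bracket_mem_of_mem_span (hX t ht) hY) ?_
  rw [P.bracket_swap]
  exact neg_mem (bracket_mem_of_mem_span (hY t ht) hX)

variable (P T)

/-- A representative in the normalizer of an element of the reduction. -/
def rep (p : P.reduction T) : A := p.2.choose

theorem rep_mem (p : P.reduction T) : P.rep T p ∈ P.normalizer T := p.2.choose_spec.1

theorem mk_rep (p : P.reduction T) :
    Ideal.Quotient.mk (Ideal.span T) (P.rep T p) = p.1 := p.2.choose_spec.2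

/-- The reduced bracket as a function. -/
def redBr (p q : P.reduction T) : P.reduction T :=
  ⟨Ideal.Quotient.mk _ (P.bracket (P.rep T p) (P.rep T q)),
    ⟨_, bracket_mem_normalizer (P.rep_mem T p) (P.rep_mem T q), rfl⟩⟩

theorem redBr_eq {X Y : A} (hX : X ∈ P.normalizer T)
    {p q : P.reduction T} (hp : Ideal.Quotient.mk (Ideal.span T) X = p.1)
    (hq : Ideal.Quotient.mk (Ideal.span T) Y = q.1) :
    (P.redBr T p q).1 = Ideal.Quotient.mk _ (P.bracket X Y) := by
  change Ideal.Quotient.mk _ (P.bracket (P.rep T p) (P.rep T q)) = _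
  rw [Ideal.Quotient.eq]
  have h1 : P.rep T p - X ∈ Ideal.span T := by
    rw [← Ideal.Quotient.eq, mk_rep, hp]
  have h2 : P.rep T q - Y ∈ Ideal.span T := by
    rw [← Ideal.Quotient.eq, mk_rep, hq]
  have h3 : P.bracket (P.rep T p) (P.rep T q) - P.bracket X Y =
      P.bracket (P.rep T p - X) (P.rep T q) + -P.bracket (P.rep T q - Y) X := by
    rw [← P.bracket_swap X]
    simp
  rw [h3]
  exact Ideal.add_mem _ (bracket_mem_of_mem_span h1 (P.rep_mem T q))
    (neg_mem (bracket_mem_of_mem_span h2 hX))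

/-- The Poisson bracket on `(A / I)^{ad T}`:
`{X mod I, Y mod I} = {X, Y} mod I`. -/
def reduced : PoissonStructure (P.reduction T) where
  bracket := LinearMap.mk₂ ℂ (P.redBr T)
    (fun p p' q => by
      apply Subtype.ext
      rw [P.redBr_eq T (add_mem (P.rep_mem T p) (P.rep_mem T p'))
        (by simp [mk_rep]) (P.mk_rep T q)]
      simp [redBr])
    (fun c p q => by
      apply Subtype.ext
      rw [P.redBr_eq T (Subalgebra.smul_mem _ (P.rep_mem T p) c)
        (by rw [← Ideal.Quotient.mkₐ_eq_mk ℂ, map_smul, Ideal.Quotient.mkₐ_eq_mk, mk_rep]; rfl)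
        (P.mk_rep T q)]
      rw [map_smul, LinearMap.smul_apply, ← Ideal.Quotient.mkₐ_eq_mk ℂ, map_smul]
      rfl)
    (fun p q q' => by
      apply Subtype.ext
      rw [P.redBr_eq T (Y := P.rep T q + P.rep T q') (P.rep_mem T p)
        (P.mk_rep T p) (by simp [mk_rep])]
      simp [redBr])
    (fun c p q => by
      apply Subtype.ext
      rw [P.redBr_eq T (Y := c • P.rep T q) (P.rep_mem T p)
        (P.mk_rep T p)
        (by rw [← Ideal.Quotient.mkₐ_eq_mk ℂ, map_smul, Ideal.Quotient.mkₐ_eq_mk, mk_rep]; rfl)]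
      rw [map_smul, ← Ideal.Quotient.mkₐ_eq_mk ℂ, map_smul]
      rfl)
  bracket_self p := by
    apply Subtype.ext
    simp [redBr, P.bracket_self]
  jacobi p q r := by
    apply Subtype.ext
    have hp := P.rep_mem T p
    have hq := P.rep_mem T q
    simp only [LinearMap.mk₂_apply, AddMemClass.coe_add]
    rw [P.redBr_eq T hp (P.mk_rep T p) rfl,
      P.redBr_eq T (bracket_mem_normalizer hp hq) rfl (P.mk_rep T r),
      P.redBr_eq T hq (P.mk_rep T q) rfl, P.jacobi, map_add]
  leibniz p q r := by
    apply Subtype.ext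
    have hp := P.rep_mem T p
    simp only [LinearMap.mk₂_apply, AddMemClass.coe_add, MulMemClass.coe_mul]
    rw [P.redBr_eq T (Y := P.rep T q * P.rep T r) hp (P.mk_rep T p) (by simp [mk_rep]), P.leibniz,
      map_add, map_mul, map_mul, mk_rep, mk_rep]
    rfl

theorem reduced_bracket_mk {X Y : A} (hX : X ∈ P.normalizer T)
    {p q : P.reduction T} (hp : Ideal.Quotient.mk (Ideal.span T) X = p.1)
    (hq : Ideal.Quotient.mk (Ideal.span T) Y = q.1) :
    ((P.reduced T).bracket p q).1 = Ideal.Quotient.mk _ (P.bracket X Y) :=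
  P.redBr_eq T hX hp hq

end PoissonStructure

/-! ### The Kirillov-Kostant Poisson bracket on the symmetric algebra of a Lie algebra -/

namespace KirillovKostant

open SymmetricAlgebra

section Der

variable {V : Type*} [AddCommGroup V] [Module ℂ V]

/-- Auxiliary algebra map `F ↦ F + δ(F) ε`. -/
def symDerAux (δ : V →ₗ[ℂ] SymmetricAlgebra ℂ V) :
    SymmetricAlgebra ℂ V →ₐ[ℂ]
      TrivSqZeroExt (SymmetricAlgebra ℂ V) (SymmetricAlgebra ℂ V) :=
  SymmetricAlgebra.lift
    ((TrivSqZeroExt.inlAlgHom ℂ (SymmetricAlgebra ℂ V) (SymmetricAlgebra ℂ V)).toLinearMap ∘ₗ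
        SymmetricAlgebra.ι ℂ V +
      (TrivSqZeroExt.inrHom (SymmetricAlgebra ℂ V) (SymmetricAlgebra ℂ V)).restrictScalars ℂ ∘ₗ δ)

theorem fst_symDerAux (δ : V →ₗ[ℂ] SymmetricAlgebra ℂ V) (a : SymmetricAlgebra ℂ V) :
    (symDerAux δ a).fst = a := by
  have h : (TrivSqZeroExt.fstHom ℂ (SymmetricAlgebra ℂ V) (SymmetricAlgebra ℂ V)).comp
      (symDerAux δ) = AlgHom.id ℂ _ := by
    apply SymmetricAlgebra.algHom_ext
    ext x
    simp [symDerAux]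
  exact DFunLike.congr_fun h a

/-- The derivation of the symmetric algebra extending a linear map on `V`. -/
def symDer (δ : V →ₗ[ℂ] SymmetricAlgebra ℂ V) :
    Derivation ℂ (SymmetricAlgebra ℂ V) (SymmetricAlgebra ℂ V) :=
  Derivation.mk'
    ((TrivSqZeroExt.sndHom (SymmetricAlgebra ℂ V) (SymmetricAlgebra ℂ V)).restrictScalars ℂ ∘ₗ
      (symDerAux δ).toLinearMap)
    (fun a b => by
      simp [fst_symDerAux, mul_comm])

theorem symDer_ι (δ : V →ₗ[ℂ] SymmetricAlgebra ℂ V) (x : V) :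
    symDer δ (SymmetricAlgebra.ι ℂ V x) = δ x := by
  simp [symDer, symDerAux]

theorem der_ext {D E : Derivation ℂ (SymmetricAlgebra ℂ V) (SymmetricAlgebra ℂ V)}
    (h : ∀ x, D (SymmetricAlgebra.ι ℂ V x) = E (SymmetricAlgebra.ι ℂ V x)) : D = E := by
  ext a
  induction a using SymmetricAlgebra.induction with
  | algebraMap r => simp
  | ι x => exact h x
  | mul a b ha hb => simp [ha, hb]
  | add a b ha hb => simp [ha, hb]

end Der

variable {L : Type*} [LieRing L] [LieAlgebra ℂ L]

/-- `{x, ·}` for `x` in the Lie algebra. -/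
def hamVec (x : L) : Derivation ℂ (SymmetricAlgebra ℂ L) (SymmetricAlgebra ℂ L) :=
  symDer (SymmetricAlgebra.ι ℂ L ∘ₗ (LieAlgebra.ad ℂ L x : L →ₗ[ℂ] L))

theorem hamVec_ι (x y : L) :
    hamVec x (SymmetricAlgebra.ι ℂ L y) = SymmetricAlgebra.ι ℂ L ⁅x, y⁆ := by
  simp [hamVec, symDer_ι]

theorem hamVec_add (x y : L) : hamVec (x + y) = hamVec x + hamVec y :=
  der_ext fun z => by simp [hamVec_ι]

theorem hamVec_smul (c : ℂ) (x : L) : hamVec (c • x) = c • hamVec x :=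
  der_ext fun z => by simp [hamVec_ι]

/-- `{·, b}`. -/
def rightBr (b : SymmetricAlgebra ℂ L) :
    Derivation ℂ (SymmetricAlgebra ℂ L) (SymmetricAlgebra ℂ L) :=
  symDer
    { toFun := fun x => hamVec x b
      map_add' := fun x y => by simp [hamVec_add]
      map_smul' := fun c x => by simp [hamVec_smul] }

theorem rightBr_ι (b : SymmetricAlgebra ℂ L) (x : L) :
    rightBr b (SymmetricAlgebra.ι ℂ L x) = hamVec x b := by
  simp [rightBr, symDer_ι]

theorem rightBr_add (a b : SymmetricAlgebra ℂ L) : rightBr (a + b) = rightBr a + rightBr b :=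
  der_ext fun z => by simp [rightBr_ι]

theorem rightBr_smul (c : ℂ) (b : SymmetricAlgebra ℂ L) : rightBr (c • b) = c • rightBr b :=
  der_ext fun z => by simp [rightBr_ι]

theorem rightBr_mul (a b : SymmetricAlgebra ℂ L) :
    rightBr (a * b) = a • rightBr b + b • rightBr a :=
  der_ext fun z => by simp [rightBr_ι]

/-- The bracket as a bilinear map. -/
def br : SymmetricAlgebra ℂ L →ₗ[ℂ] SymmetricAlgebra ℂ L →ₗ[ℂ] SymmetricAlgebra ℂ L :=
  LinearMap.mk₂ ℂ (fun a b => rightBr b a)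
    (fun a b c => by simp) (fun c a b => by simp)
    (fun a b c => by simp [rightBr_add]) (fun c a b => by simp [rightBr_smul])

theorem br_apply (a b : SymmetricAlgebra ℂ L) : br a b = rightBr b a := rfl

theorem br_ι_ι (x y : L) : br (SymmetricAlgebra.ι ℂ L x) (SymmetricAlgebra.ι ℂ L y) =
    SymmetricAlgebra.ι ℂ L ⁅x, y⁆ := by
  rw [br_apply, rightBr_ι, hamVec_ι]

theorem br_mul (a b c : SymmetricAlgebra ℂ L) : br a (b * c) = b * br a c + c * br a b := by
  simp [br_apply, rightBr_mul]

theorem br_swap (a b : SymmetricAlgebra ℂ L) : br a b = -br b a := by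
  have h2 : ∀ x : L, rightBr (SymmetricAlgebra.ι ℂ L x) = -hamVec x := fun x =>
    der_ext fun z => by
      rw [rightBr_ι, hamVec_ι, Derivation.neg_apply, hamVec_ι, ← map_neg, lie_skew]
  -- `{b, ·}` is a derivation
  let D : Derivation ℂ (SymmetricAlgebra ℂ L) (SymmetricAlgebra ℂ L) :=
    Derivation.mk' (br b) (fun a c => by simp [br_mul])
  have h3 : rightBr b = -D := der_ext fun z => by
    rw [rightBr_ι, Derivation.neg_apply]
    change _ = -rightBr (SymmetricAlgebra.ι ℂ L z) b
    rw [h2]; simp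
  rw [br_apply, h3]
  rfl

theorem br_jacobi (a b c : SymmetricAlgebra ℂ L) :
    br a (br b c) = br (br a b) c + br b (br a c) := by
  have hmul : ∀ a b c : SymmetricAlgebra ℂ L, br (a * b) c = a * br b c + b * br a c := by
    intro a b c
    rw [br_swap, br_mul, br_swap b c, br_swap a c]; ring
  have hC : ∀ (r : ℂ) (c : SymmetricAlgebra ℂ L), br (algebraMap ℂ _ r) c = 0 := fun r c => by
    simp [br_apply]
  have hC' : ∀ (r : ℂ) (c : SymmetricAlgebra ℂ L), br c (algebraMap ℂ _ r) = 0 := fun r c => by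
    rw [br_swap, hC, neg_zero]
  induction a using SymmetricAlgebra.induction with
  | algebraMap r => simp [hC]
  | add a a' ha ha' => simp only [map_add, LinearMap.add_apply, ha, ha']; ring
  | mul a a' ha ha' =>
    simp only [hmul, br_mul, map_add, LinearMap.add_apply, ha, ha', br_swap b a, br_swap b a']
    ring
  | ι x =>
    induction b using SymmetricAlgebra.induction with
    | algebraMap r => simp [hC, hC']
    | add b b' hb hb' => simp only [map_add, LinearMap.add_apply, hb, hb']; ring
    | mul b b' hb hb' => simp only [hmul, br_mul, map_add, LinearMap.add_apply, hb, hb']; ring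
    | ι y =>
      induction c using SymmetricAlgebra.induction with
      | algebraMap r => simp [hC']
      | add c c' hc hc' => simp only [map_add, hc, hc']; ring
      | mul c c' hc hc' => simp only [br_mul, map_add, hc, hc']; ring
      | ι z => simp only [br_ι_ι, ← map_add, leibniz_lie x y z]

end KirillovKostant

/-- The Kirillov-Kostant Poisson structure on `S(𝔤) = ℂ[𝔤*]`, the Poisson bracket that extends
the Lie bracket of `𝔤`. -/
def kirillovKostant (𝔤 : Type*) [LieRing 𝔤] [LieAlgebra ℂ 𝔤] :
    PoissonStructure (SymmetricAlgebra ℂ 𝔤) where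
  bracket := KirillovKostant.br
  bracket_self a := by
    have h := KirillovKostant.br_swap a a
    have h2 : (2 : ℂ) • KirillovKostant.br a a = 0 := by
      rw [two_smul]
      exact eq_neg_iff_add_eq_zero.mp h
    exact (smul_eq_zero.mp h2).resolve_left two_ne_zero
  jacobi := KirillovKostant.br_jacobi
  leibniz := KirillovKostant.br_mul

theorem kirillovKostant_ι_ι {𝔤 : Type*} [LieRing 𝔤] [LieAlgebra ℂ 𝔤] (x y : 𝔤) :
    (kirillovKostant 𝔤).bracket (SymmetricAlgebra.ι ℂ 𝔤 x) (SymmetricAlgebra.ι ℂ 𝔤 y) =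
      SymmetricAlgebra.ι ℂ 𝔤 ⁅x, y⁆ :=
  KirillovKostant.br_ι_ι x y

/-! ### Affine varieties as spaces with functions

An affine variety over `ℂ` is given by its set of points `X` and by its algebra
`R : Subalgebra ℂ (X → ℂ)` of regular functions. -/

/-- `X`, with the algebra `R` of functions, is an affine variety: `R` is finitely generated and
the points of `X` are exactly the `ℂ`-points of `R`. -/
def IsAffineVariety {X : Type*} (R : Subalgebra ℂ (X → ℂ)) : Prop :=
  R.FG ∧ Function.Bijective (fun x : X => (Pi.evalAlgHom ℂ (fun _ : X => ℂ) x).comp R.val)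

/-- Zariski open subsets. -/
def ZariskiOpen {X : Type*} (R : Subalgebra ℂ (X → ℂ)) (U : Set X) : Prop :=
  ∀ x ∈ U, ∃ b ∈ R, b x ≠ 0 ∧ ∀ y, b y ≠ 0 → y ∈ U

/-- `φ` is a regular function on the Zariski open subset `U`: locally a fraction of elements of
`R`. The values of `φ` outside `U` play no role. -/
def RegularOn {X : Type*} (R : Subalgebra ℂ (X → ℂ)) (U : Set X) (φ : X → ℂ) : Prop :=
  ∀ x ∈ U, ∃ a ∈ R, ∃ b ∈ R, b x ≠ 0 ∧ ∀ y ∈ U, b y ≠ 0 → φ y = a y / b y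

/-- Composition of functions with a map. -/
def pullback {X Y : Type*} (π : X → Y) : (Y → ℂ) →ₐ[ℂ] (X → ℂ) where
  toFun φ := φ ∘ π
  map_one' := rfl
  map_mul' _ _ := rfl
  map_zero' := rfl
  map_add' _ _ := rfl
  commutes' _ := rfl

/-- Regular functions on a closed subset `Z` of an affine variety: restrictions of regular
functions. -/
def restrictFunctions {X : Type*} (R : Subalgebra ℂ (X → ℂ)) (Z : Set X) :
    Subalgebra ℂ (Z → ℂ) :=
  R.map (pullback Subtype.val)

/-- The set `Z / G` of `G`-orbits in a subset `Z` of a `G`-set. -/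
def OrbitSpace (G : Type*) [Group G] {X : Type*} [MulAction G X] (Z : Set X) : Type _ :=
  Quotient (Setoid.comap (Subtype.val : Z → X) (MulAction.orbitRel G X))

/-- The class in `Z / G` of a point of `Z`. -/
def OrbitSpace.mk (G : Type*) [Group G] {X : Type*} [MulAction G X] {Z : Set X} (z : Z) :
    OrbitSpace G Z :=
  Quotient.mk _ z

/-- The functions on `Z / G` whose pull-back to `Z` is regular; equivalently, the `G`-invariant
regular functions on `Z`. -/
def quotientFunctions (G : Type*) [Group G] {X : Type*} [MulAction G X] {Z : Set X}
    (R : Subalgebra ℂ (Z → ℂ)) : Subalgebra ℂ (OrbitSpace G Z → ℂ) :=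
  R.comap (pullback (OrbitSpace.mk G))

/-- `Z` is `G`-stable and the orbit set `Z / G` is a well-defined affine variety, namely the
geometric quotient of `Z` by `G`: it carries the quotient topology, and its regular functions
on open subsets are the `G`-invariant regular functions on the preimages. -/
structure HasGeometricQuotient (G : Type*) [Group G] {X : Type*} [MulAction G X] (Z : Set X)
    (R : Subalgebra ℂ (Z → ℂ)) : Prop where
  stable : ∀ (g : G), ∀ z ∈ Z, g • z ∈ Z
  affine : IsAffineVariety (quotientFunctions G R)
  zariskiOpen_iff : ∀ U : Set (OrbitSpace G Z),
    ZariskiOpen (quotientFunctions G R) U ↔ ZariskiOpen R (OrbitSpace.mk G ⁻¹' U)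
  regularOn_iff : ∀ U : Set (OrbitSpace G Z), ZariskiOpen (quotientFunctions G R) U →
    ∀ φ : OrbitSpace G Z → ℂ,
      RegularOn (quotientFunctions G R) U φ ↔
        RegularOn R (OrbitSpace.mk G ⁻¹' U) (φ ∘ OrbitSpace.mk G)

/-- A bijection between two affine Poisson varieties is an isomorphism of Poisson varieties. -/
structure IsPoissonIso {X Y : Type*} {RX : Subalgebra ℂ (X → ℂ)} {RY : Subalgebra ℂ (Y → ℂ)}
    (PX : PoissonStructure RX) (PY : PoissonStructure RY) (σ : X ≃ Y) : Prop where
  regular_iff : ∀ φ : Y → ℂ, φ ∈ RY ↔ φ ∘ σ ∈ RX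
  bracket : ∀ (φ ψ : RY) (x : X),
    (PY.bracket φ ψ : Y → ℂ) (σ x) =
      (PX.bracket ⟨φ ∘ σ, (regular_iff φ).1 φ.2⟩ ⟨ψ ∘ σ, (regular_iff ψ).1 ψ.2⟩ : X → ℂ) x

/-! ### Good gradings, good algebras, Slodowy slices -/

section Lie

variable {𝔤 : Type*} [LieRing 𝔤] [LieAlgebra ℂ 𝔤]

/-- A `ℤ`-grading of the Lie algebra `𝔤` that is good for `f`. -/
structure IsGoodGrading (Γ : ℤ → Submodule ℂ 𝔤) (f : 𝔤) : Prop where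
  isInternal : DirectSum.IsInternal Γ
  lie_mem : ∀ i j : ℤ, ∀ x ∈ Γ i, ∀ y ∈ Γ j, ⁅x, y⁆ ∈ Γ (i + j)
  mem : f ∈ Γ (-2)
  injective : ∀ j : ℤ, 1 ≤ j → ∀ x ∈ Γ j, ⁅f, x⁆ = 0 → x = 0
  surjective : ∀ j : ℤ, j ≤ 1 → ∀ y ∈ Γ (j - 2), ∃ x ∈ Γ j, ⁅f, x⁆ = y

/-- The grading `Γ` is given by the eigenspaces of `ad q`, that is `q = q_Γ`. -/
def IsGradingElement (Γ : ℤ → Submodule ℂ 𝔤) (q : 𝔤) : Prop :=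
  ∀ (j : ℤ) (x : 𝔤), x ∈ Γ j ↔ ⁅q, x⁆ = (j : ℂ) • x

/-- `𝔪` is a good algebra for the linear form `χ` and the grading `Γ`:
`𝔪 = 𝔩 ⊕ ⨁_{i ≥ 2} 𝔤_i` for a Lagrangian subspace `𝔩` of `𝔤_1`, with respect to the
form `χ([·, ·])`. -/
def IsGoodAlgebra (χ : Dual ℂ 𝔤) (Γ : ℤ → Submodule ℂ 𝔤) (𝔪 : LieSubalgebra ℂ 𝔤) : Prop :=
  ∃ 𝔩 : Submodule ℂ 𝔤, 𝔩 ≤ Γ 1 ∧ (∀ x ∈ Γ 1, x ∈ 𝔩 ↔ ∀ y ∈ 𝔩, χ ⁅x, y⁆ = 0) ∧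
    𝔪.toSubmodule = 𝔩 ⊔ ⨆ i : ℤ, ⨆ _ : 2 ≤ i, Γ i

/-- `(e, h, f)` is an `sl₂`-triple with `h ∈ 𝔤_0` and `e ∈ 𝔤_2`; for `f = 0` it is
`(0, 0, 0)`. -/
structure IsGradedTriple (Γ : ℤ → Submodule ℂ 𝔤) (e h f : 𝔤) : Prop where
  lie_h_e : ⁅h, e⁆ = (2 : ℂ) • e
  lie_h_f : ⁅h, f⁆ = -((2 : ℂ) • f)
  lie_e_f : ⁅e, f⁆ = h
  h_mem : h ∈ Γ 0
  e_mem : e ∈ Γ 2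

/-- The Slodowy slice `Φ(f + Ker ad e)`, where `Φ(x) = (x | ·)`. -/
def slodowySlice (B : LinearMap.BilinForm ℂ 𝔤) (e f : 𝔤) : Set (Dual ℂ 𝔤) :=
  {ξ | ∃ x : 𝔤, ⁅e, x⁆ = 0 ∧ ξ = B (f + x)}

/-- The connected unipotent group with the `ad`-nilpotent Lie algebra `𝔪`, realized in the
adjoint group: it is generated by the `exp (ad y)`, `y ∈ 𝔪`. -/
def unipotentGroup (𝔪 : LieSubalgebra ℂ 𝔤) : Subgroup (𝔤 ≃ₗ[ℂ] 𝔤) :=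
  Subgroup.closure {g | ∃ y ∈ 𝔪, ∃ N : ℕ, (LieAlgebra.ad ℂ 𝔤 y) ^ N = 0 ∧
    (g : 𝔤 →ₗ[ℂ] 𝔤) =
      ∑ k ∈ Finset.range N, ((k.factorial : ℂ)⁻¹) • (LieAlgebra.ad ℂ 𝔤 y) ^ k}

/-- The coadjoint action `Ad*(g) ξ = ξ ∘ Ad(g)⁻¹`. -/
instance coadjointAction : MulAction (𝔤 ≃ₗ[ℂ] 𝔤) (Dual ℂ 𝔤) where
  smul g ξ := ξ ∘ₗ (g⁻¹ : 𝔤 ≃ₗ[ℂ] 𝔤).toLinearMap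
  one_smul ξ := by
    change ξ ∘ₗ ((1 : 𝔤 ≃ₗ[ℂ] 𝔤)⁻¹).toLinearMap = ξ
    rw [inv_one]; rfl
  mul_smul g g' ξ := by
    change ξ ∘ₗ ((g * g')⁻¹).toLinearMap =
      (ξ ∘ₗ (g'⁻¹).toLinearMap) ∘ₗ (g⁻¹).toLinearMap
    rw [mul_inv_rev]; rfl

/-- The moment map `𝔤* → 𝔪*`, `ξ ↦ (ξ - χ)|_𝔪`. -/
def momentMap (χ : Dual ℂ 𝔤) (𝔪 : LieSubalgebra ℂ 𝔤) (ξ : Dual ℂ 𝔤) : Dual ℂ 𝔪 :=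
  (ξ - χ) ∘ₗ 𝔪.toSubmodule.subtype

/-- The fibre `μ⁻¹(0)`. -/
def zeroFibre (χ : Dual ℂ 𝔤) (𝔪 : LieSubalgebra ℂ 𝔤) : Set (Dual ℂ 𝔤) :=
  momentMap χ 𝔪 ⁻¹' {0}

/-- The value at `ξ` of `X ∈ S(𝔤) = ℂ[𝔤*]`. -/
def evalAt (ξ : Dual ℂ 𝔤) : SymmetricAlgebra ℂ 𝔤 →ₐ[ℂ] ℂ :=
  SymmetricAlgebra.lift ξ

/-- Regular functions on a closed subvariety `Z` of `𝔤*`. -/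
def polyFunctions (Z : Set (Dual ℂ 𝔤)) : Subalgebra ℂ (Z → ℂ) :=
  (AlgHom.pi (fun ξ : Z => evalAt (ξ : Dual ℂ 𝔤))).range

/-- The quotient `μ⁻¹(0) / M`. -/
abbrev HamRed (χ : Dual ℂ 𝔤) (𝔪 : LieSubalgebra ℂ 𝔤) : Type _ :=
  OrbitSpace (unipotentGroup 𝔪) (zeroFibre χ 𝔪)

/-- The regular functions on `μ⁻¹(0) / M`. -/
abbrev hamRedFunctions (χ : Dual ℂ 𝔤) (𝔪 : LieSubalgebra ℂ 𝔤) :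
    Subalgebra ℂ (HamRed χ 𝔪 → ℂ) :=
  quotientFunctions (unipotentGroup 𝔪) (polyFunctions (zeroFibre χ 𝔪))

/-! ### Classical finite W-algebras -/

/-- The elements `y - χ(y)` of `S(𝔤)`, for `y ∈ 𝔪`. -/
def shiftedElements (χ : Dual ℂ 𝔤) (𝔪 : LieSubalgebra ℂ 𝔤) : Set (SymmetricAlgebra ℂ 𝔤) :=
  {X | ∃ y ∈ 𝔪, X = SymmetricAlgebra.ι ℂ 𝔤 y - algebraMap ℂ _ (χ y)}

/-- `X mod I`, where `I` is the ideal of `S(𝔤)` spanned by the `y - χ(y)`, `y ∈ 𝔪`. -/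
abbrev modI (χ : Dual ℂ 𝔤) (𝔪 : LieSubalgebra ℂ 𝔤) (X : SymmetricAlgebra ℂ 𝔤) :
    SymmetricAlgebra ℂ 𝔤 ⧸ Ideal.span (shiftedElements χ 𝔪) :=
  Ideal.Quotient.mk _ X

/-- The classical finite W-algebra `(S(𝔤) / I)^{ad 𝔪}`. -/
def classicalW (χ : Dual ℂ 𝔤) (𝔪 : LieSubalgebra ℂ 𝔤) :
    Subalgebra ℂ (SymmetricAlgebra ℂ 𝔤 ⧸ Ideal.span (shiftedElements χ 𝔪)) :=
  (kirillovKostant 𝔤).reduction (shiftedElements χ 𝔪)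

instance classicalW.instCommRing (χ : Dual ℂ 𝔤) (𝔪 : LieSubalgebra ℂ 𝔤) :
    CommRing (classicalW χ 𝔪) := Subalgebra.toCommRing _

instance classicalW.instAlgebra (χ : Dual ℂ 𝔤) (𝔪 : LieSubalgebra ℂ 𝔤) :
    Algebra ℂ (classicalW χ 𝔪) := Subalgebra.algebra _

/-- The Poisson bracket of the classical finite W-algebra. -/
def classicalWPoisson (χ : Dual ℂ 𝔤) (𝔪 : LieSubalgebra ℂ 𝔤) :
    PoissonStructure (classicalW χ 𝔪) :=
  (kirillovKostant 𝔤).reduced (shiftedElements χ 𝔪)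

/-- The elements `(y - χ₂(y)) mod I₁` of the W-algebra attached to `χ₁` and `𝔪₁`,
for `y ∈ 𝔪₀`. -/
def stageElements (χ₁ χ₂ : Dual ℂ 𝔤) (𝔪₁ 𝔪₀ : LieSubalgebra ℂ 𝔤) : Set (classicalW χ₁ 𝔪₁) :=
  {w | ∃ y ∈ 𝔪₀, (w : _ ⧸ Ideal.span (shiftedElements χ₁ 𝔪₁)) =
    modI χ₁ 𝔪₁ (SymmetricAlgebra.ι ℂ 𝔤 y - algebraMap ℂ _ (χ₂ y))}

/-- `w mod I₀`, where `I₀` is the ideal spanned by the `(y - χ₂(y)) mod I₁`, `y ∈ 𝔪₀`. -/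
abbrev modI₀ (χ₁ χ₂ : Dual ℂ 𝔤) (𝔪₁ 𝔪₀ : LieSubalgebra ℂ 𝔤) (w : classicalW χ₁ 𝔪₁) :
    classicalW χ₁ 𝔪₁ ⧸ Ideal.span (stageElements χ₁ χ₂ 𝔪₁ 𝔪₀) :=
  Ideal.Quotient.mk _ w

/-- The second stage `(P(𝔤, f₁) / I₀)^{ad 𝔪₀}` of the reduction. -/
def stageW (χ₁ χ₂ : Dual ℂ 𝔤) (𝔪₁ 𝔪₀ : LieSubalgebra ℂ 𝔤) :
    Subalgebra ℂ (classicalW χ₁ 𝔪₁ ⧸ Ideal.span (stageElements χ₁ χ₂ 𝔪₁ 𝔪₀)) :=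
  (classicalWPoisson χ₁ 𝔪₁).reduction (stageElements χ₁ χ₂ 𝔪₁ 𝔪₀)

instance stageW.instCommRing (χ₁ χ₂ : Dual ℂ 𝔤) (𝔪₁ 𝔪₀ : LieSubalgebra ℂ 𝔤) :
    CommRing (stageW χ₁ χ₂ 𝔪₁ 𝔪₀) := Subalgebra.toCommRing _

instance stageW.instAlgebra (χ₁ χ₂ : Dual ℂ 𝔤) (𝔪₁ 𝔪₀ : LieSubalgebra ℂ 𝔤) :
    Algebra ℂ (stageW χ₁ χ₂ 𝔪₁ 𝔪₀) := Subalgebra.algebra _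

/-- The Poisson bracket of the second stage. -/
def stageWPoisson (χ₁ χ₂ : Dual ℂ 𝔤) (𝔪₁ 𝔪₀ : LieSubalgebra ℂ 𝔤) :
    PoissonStructure (stageW χ₁ χ₂ 𝔪₁ 𝔪₀) :=
  (classicalWPoisson χ₁ 𝔪₁).reduced (stageElements χ₁ χ₂ 𝔪₁ 𝔪₀)

end Lie

end

/-! ### Vanishing ideals of affine subspaces of the dual space -/

section AffineSubspaces

variable {𝔤 : Type*} [LieRing 𝔤] [LieAlgebra ℂ 𝔤]

/-! Let `I` be the ideal generated by the `y - χ(y)`, `y ∈ 𝔪`. Both reductions rest on a coordinate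
slice of `μ⁻¹(0)`. Take a homogeneous basis `y_i` of `𝔪`, ordered by increasing degree, and elements
`x_j` of degree `2 - deg y_j` with `χ([y_i, x_j]) = δ_ij`. For `j ≤ i` the bracket `[y_i, x_j]` has
degree at least 2, so it lies in `𝔪` and is the constant `δ_ij` on the fibre. The flow of `y_i` thus
moves `x_i` at unit speed and leaves `x_j`, `j < i`, fixed (`SliceFamily`).

There are two consequences. Killing `x_0, x_1, …` in turn brings every point of the fibre into the
slice `x = 0` (`SliceFamily.exists_smul_mem_sliceSet`). Applying the series `∑ (-x_i)^n / n! {y_i,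
·}^n` from the last index down turns any polynomial into one that is invariant modulo `I` and has
the same restriction to the slice (`SliceFamily.exists_projection`). Hence invariants separate the
points of the slice, every orbit meets it exactly once, the slice is a geometric quotient, and the
W-algebra is its coordinate ring. Since the fibre is an affine subspace, membership in `I` is tested
at points (`mem_span_shiftedElements`).

The `x_j` exist by duality, because `ad f` is injective in positive degrees. With a graded triple,
`ad e ∘ ad f` is injective there too, and the choice `x_j = -[e, w_j]`, with `w_j` dual to `[e, [f,
y_i]]`, makes the slice equal to the Slodowy slice.

For the two stages, `f₂ - f₁` has degree 0 and is orthogonal to `𝔪₁`, so `χ₁ = χ₂` on `𝔪₁` and the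
fibres are nested. On functions, `Ψ` is restriction from `μ₁⁻¹(0)` to `μ₂⁻¹(0)`. Its kernel on the
first W-algebra is `I₀` (`TwoStage.cls_mem_span`), and every function invariant under the second
group lifts (`TwoStage.exists_lift`); both follow from invariant projection for the first slice. On
points, the basis of `𝔪₂` is chosen inside `𝔪₁ ∪ 𝔪₀`, so the flows into the second slice lie in the
group generated by `M₁` and `M₀`. Two points of one `M₂`-orbit reach the same point of the slice, so
they have the same class in the two-stage quotient (`TwoStage.secondMk_eq_iff`). -/

@[simp]
theorem evalAt_ι (ξ : Dual ℂ 𝔤) (x : 𝔤) : evalAt ξ (SymmetricAlgebra.ι ℂ 𝔤 x) = ξ x := by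
  simp [evalAt]

/-- In coordinates: a polynomial over an infinite field that vanishes at all points is zero. -/
theorem evalAt_injective_of_forall [FiniteDimensional ℂ 𝔤] {X : SymmetricAlgebra ℂ 𝔤}
    (h : ∀ ξ : Dual ℂ 𝔤, evalAt ξ X = 0) : X = 0 := by
  let b := Module.finBasis ℂ 𝔤
  let E := SymmetricAlgebra.equivMvPolynomial b
  have key : ∀ ξ : Dual ℂ 𝔤,
      (MvPolynomial.aeval (fun i => ξ (b i))).comp E.toAlgHom = evalAt ξ := by
    intro ξ
    apply SymmetricAlgebra.algHom_ext
    apply b.ext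
    intro i
    simp [E]
  have hE : E X = 0 := by
    apply MvPolynomial.funext
    intro v
    have h1 := DFunLike.congr_fun (key (b.constr ℂ v)) X
    rw [h] at h1
    simpa [MvPolynomial.aeval_eq_eval] using h1
  simpa using hE

/-- The ideal of functions generated by `w - ξ₀(w)`, `w ∈ W`. -/
def affineIdeal (W : Submodule ℂ 𝔤) (ξ₀ : Dual ℂ 𝔤) : Ideal (SymmetricAlgebra ℂ 𝔤) :=
  Ideal.span {X | ∃ w ∈ W, X = SymmetricAlgebra.ι ℂ 𝔤 w - algebraMap ℂ _ (ξ₀ w)}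

theorem mem_affineIdeal (W : Submodule ℂ 𝔤) (ξ₀ : Dual ℂ 𝔤) {w : 𝔤} (hw : w ∈ W) :
    SymmetricAlgebra.ι ℂ 𝔤 w - algebraMap ℂ _ (ξ₀ w) ∈ affineIdeal W ξ₀ :=
  Ideal.subset_span ⟨w, hw, rfl⟩

theorem evalAt_eq_zero_of_mem_affineIdeal {W : Submodule ℂ 𝔤} {ξ₀ ξ : Dual ℂ 𝔤}
    (hξ : ∀ w ∈ W, ξ w = ξ₀ w) {X : SymmetricAlgebra ℂ 𝔤} (hX : X ∈ affineIdeal W ξ₀) :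
    evalAt ξ X = 0 := by
  have : affineIdeal W ξ₀ ≤ RingHom.ker (evalAt ξ) := by
    refine Ideal.span_le.2 ?_
    rintro _ ⟨w, hw, rfl⟩
    simp [RingHom.mem_ker, hξ w hw]
  exact this hX

/-- The dual space retracts onto the affine subspace. The pull-back of `X` along the retraction
vanishes everywhere, hence is zero, yet it is congruent to `X` modulo the ideal. -/
theorem mem_affineIdeal_of_evalAt_eq_zero [FiniteDimensional ℂ 𝔤] {W : Submodule ℂ 𝔤}
    {ξ₀ : Dual ℂ 𝔤} {X : SymmetricAlgebra ℂ 𝔤}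
    (hX : ∀ ξ : Dual ℂ 𝔤, (∀ w ∈ W, ξ w = ξ₀ w) → evalAt ξ X = 0) : X ∈ affineIdeal W ξ₀ := by
  obtain ⟨π, hπ⟩ := W.exists_isCompl
  let p : 𝔤 →ₗ[ℂ] 𝔤 := W.subtype ∘ₗ W.projectionOnto π hπ
  have hpW : ∀ v, p v ∈ W := fun v => (W.projectionOnto π hπ v).2
  have hp : ∀ w ∈ W, p w = w := fun w hw =>
    congrArg Subtype.val (Submodule.projectionOnto_apply_left hπ ⟨w, hw⟩)
  -- The comorphism of the retraction `ξ ↦ ξ ∘ (1 - p) + ξ₀ ∘ p`.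
  let P : SymmetricAlgebra ℂ 𝔤 →ₐ[ℂ] SymmetricAlgebra ℂ 𝔤 :=
    SymmetricAlgebra.lift (SymmetricAlgebra.ι ℂ 𝔤 ∘ₗ (LinearMap.id - p) +
      Algebra.linearMap ℂ (SymmetricAlgebra ℂ 𝔤) ∘ₗ ξ₀ ∘ₗ p)
  have hP : (Ideal.Quotient.mkₐ ℂ (affineIdeal W ξ₀)).comp P =
      Ideal.Quotient.mkₐ ℂ (affineIdeal W ξ₀) := by
    apply SymmetricAlgebra.algHom_ext
    ext v
    change Ideal.Quotient.mk _ (P (SymmetricAlgebra.ι ℂ 𝔤 v)) = Ideal.Quotient.mk _ _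
    rw [Ideal.Quotient.eq]
    have h2 := neg_mem (mem_affineIdeal W ξ₀ (hpW v))
    convert h2 using 1
    simp [P]
    ring
  have hE : ∀ ξ : Dual ℂ 𝔤, evalAt ξ (P X) = 0 := by
    intro ξ
    have h1 : (evalAt ξ).comp P = evalAt (ξ ∘ₗ (LinearMap.id - p) + ξ₀ ∘ₗ p) := by
      apply SymmetricAlgebra.algHom_ext
      ext v
      simp [P]
    have h2 := DFunLike.congr_fun h1 X
    rw [AlgHom.comp_apply] at h2
    rw [h2]
    apply hX
    intro w hw
    simp [hp w hw]
  have h0 := evalAt_injective_of_forall hE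
  have h1 := DFunLike.congr_fun hP X
  rw [AlgHom.comp_apply, h0, map_zero] at h1
  exact Ideal.Quotient.eq_zero_iff_mem.1 h1.symm

theorem fg_symmetricAlgebra [FiniteDimensional ℂ 𝔤] :
    Algebra.FiniteType ℂ (SymmetricAlgebra ℂ 𝔤) :=
  Algebra.FiniteType.equiv inferInstance
    (SymmetricAlgebra.equivMvPolynomial (Module.finBasis ℂ 𝔤)).symm

theorem mem_polyFunctions {Z : Set (Dual ℂ 𝔤)} {φ : Z → ℂ} :
    φ ∈ polyFunctions Z ↔ ∃ X, ∀ ξ : Z, φ ξ = evalAt (ξ : Dual ℂ 𝔤) X := by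
  constructor
  · rintro ⟨X, rfl⟩
    exact ⟨X, fun ξ => rfl⟩
  · rintro ⟨X, hX⟩
    exact ⟨X, funext fun ξ => (hX ξ).symm⟩

/-- A character of the function algebra, restricted to linear functions, is a form `ξ`; it satisfies
the equations of `Z` because these vanish in the algebra. -/
theorem isAffineVariety_polyFunctions [FiniteDimensional ℂ 𝔤] {Z : Set (Dual ℂ 𝔤)}
    (W : Submodule ℂ 𝔤) (ξ₀ : Dual ℂ 𝔤) (hZ : ∀ ξ, ξ ∈ Z ↔ ∀ w ∈ W, ξ w = ξ₀ w) :
    IsAffineVariety (polyFunctions Z) := by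
  have hmem : ∀ X, (fun ξ : Z => evalAt (ξ : Dual ℂ 𝔤) X) ∈ polyFunctions Z :=
    fun X => mem_polyFunctions.2 ⟨X, fun _ => rfl⟩
  refine ⟨?_, ?_, ?_⟩
  · have := fg_symmetricAlgebra (𝔤 := 𝔤)
    have h1 : (⊤ : Subalgebra ℂ (SymmetricAlgebra ℂ 𝔤)).FG := this.out
    have h2 := h1.map (AlgHom.pi (fun ξ : Z => evalAt (ξ : Dual ℂ 𝔤)))
    rwa [Algebra.map_top] at h2
  · intro ξ ξ' h
    apply Subtype.ext
    ext v
    have := DFunLike.congr_fun h ⟨_, hmem (SymmetricAlgebra.ι ℂ 𝔤 v)⟩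
    simpa using this
  · intro θ
    let R : SymmetricAlgebra ℂ 𝔤 →ₐ[ℂ] polyFunctions Z :=
      (AlgHom.pi (fun ξ : Z => evalAt (ξ : Dual ℂ 𝔤))).rangeRestrict
    let ξ : Dual ℂ 𝔤 := (θ.comp R).toLinearMap ∘ₗ SymmetricAlgebra.ι ℂ 𝔤
    have hξ : evalAt ξ = θ.comp R := by
      apply SymmetricAlgebra.algHom_ext
      ext v
      simp [ξ]
    have hξZ : ξ ∈ Z := by
      rw [hZ]
      intro w hw
      have h0 : R (SymmetricAlgebra.ι ℂ 𝔤 w - algebraMap ℂ _ (ξ₀ w)) = 0 := by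
        apply Subtype.ext
        funext η
        change evalAt (η : Dual ℂ 𝔤)
          (SymmetricAlgebra.ι ℂ 𝔤 w - algebraMap ℂ _ (ξ₀ w)) = 0
        simp [(hZ η).1 η.2 w hw]
      have h1 := DFunLike.congr_fun hξ (SymmetricAlgebra.ι ℂ 𝔤 w - algebraMap ℂ _ (ξ₀ w))
      rw [AlgHom.comp_apply, h0, map_zero] at h1
      simpa [sub_eq_zero] using h1
    refine ⟨⟨ξ, hξZ⟩, ?_⟩
    ext ⟨φ, X, rfl⟩
    exact DFunLike.congr_fun hξ X

end AffineSubspaces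

/-! ### Geometric quotients with a slice -/

section GeometricQuotient

variable {G : Type*} [Group G] {X : Type*} [MulAction G X] {Z : Set X}

theorem OrbitSpace.mk_eq_mk {z z' : Z} :
    OrbitSpace.mk G z = OrbitSpace.mk G z' ↔ ∃ g : G, g • (z' : X) = z :=
  Quotient.eq (r := Setoid.comap (Subtype.val : Z → X) (MulAction.orbitRel G X))

theorem OrbitSpace.mk_surjective : Function.Surjective (OrbitSpace.mk G : Z → OrbitSpace G Z) :=
  Quotient.mk_surjective

theorem IsAffineVariety.of_equiv {Y Y' : Type*} {R : Subalgebra ℂ (Y → ℂ)}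
    {R' : Subalgebra ℂ (Y' → ℂ)} (hR : IsAffineVariety R) (e : Y ≃ Y')
    (he : ∀ φ : Y' → ℂ, φ ∈ R' ↔ φ ∘ e ∈ R) : IsAffineVariety R' := by
  have hmap : R.map (pullback e.symm) = R' := by
    ext φ
    constructor
    · rintro ⟨ψ, hψ, rfl⟩
      rw [he]
      have h : pullback e.symm ψ ∘ e = ψ := funext fun y => congrArg ψ (e.symm_apply_apply y)
      rw [show ((pullback e.symm : (Y → ℂ) →+* (Y' → ℂ)) ψ ∘ e : Y → ℂ) = ψ from h]
      exact hψ
    · intro hφ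
      exact ⟨φ ∘ e, (he φ).1 hφ, funext fun y => congrArg φ (e.apply_symm_apply y)⟩
  refine ⟨hmap ▸ hR.1.map _, ?_, ?_⟩
  · intro y y' h
    apply e.symm.injective
    apply hR.2.1
    ext ⟨φ, hφ⟩
    have h1 : φ ∘ e.symm ∈ R' := by
      rw [he]
      convert hφ using 1
      funext y
      simp
    exact DFunLike.congr_fun h ⟨_, h1⟩
  · intro θ
    let F : R →ₐ[ℂ] R' :=
      ((pullback e.symm).comp R.val).codRestrict R' (fun φ => hmap ▸ ⟨φ, φ.2, rfl⟩)
    obtain ⟨y, hy⟩ := hR.2.2 (θ.comp F)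
    refine ⟨e y, ?_⟩
    ext ⟨φ, hφ⟩
    have h1 := DFunLike.congr_fun hy ⟨φ ∘ e, (he φ).1 hφ⟩
    have h2 : F ⟨φ ∘ e, (he φ).1 hφ⟩ = ⟨φ, hφ⟩ :=
      Subtype.ext (funext fun y => congrArg φ (e.apply_symm_apply y))
    rw [AlgHom.comp_apply θ F, h2] at h1
    exact h1

/-- A family of representatives of the orbits, parametrized by an affine variety `Y`, such that
all regular functions on `Y` extend to invariant regular functions, gives a geometric quotient. -/
theorem hasGeometricQuotient_of_slice {Y : Type*} {RY : Subalgebra ℂ (Y → ℂ)}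
    (hY : IsAffineVariety RY) {R : Subalgebra ℂ (Z → ℂ)}
    (hstable : ∀ (g : G), ∀ z ∈ Z, g • z ∈ Z) (s : Y → Z)
    (hs : Function.Bijective (fun y => OrbitSpace.mk G (s y)))
    (hres : ∀ a ∈ R, a ∘ s ∈ RY)
    (hext : ∀ b ∈ RY, ∃ φ ∈ quotientFunctions G R, ∀ y, φ (OrbitSpace.mk G (s y)) = b y) :
    HasGeometricQuotient G Z R := by
  let e : Y ≃ OrbitSpace G Z := Equiv.ofBijective _ hs
  have he : ∀ y, e y = OrbitSpace.mk G (s y) := fun _ => rfl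
  have hmem : ∀ φ : OrbitSpace G Z → ℂ, φ ∈ quotientFunctions G R ↔ φ ∘ e ∈ RY := by
    intro φ
    constructor
    · intro h
      exact hres _ h
    · intro h
      obtain ⟨ψ, hψ, hψ'⟩ := hext _ h
      convert hψ using 1
      funext p
      obtain ⟨y, rfl⟩ := e.surjective p
      exact (hψ' y).symm
  -- Any regular function on `Z`, invariant or not, has an invariant substitute with the same values
  -- on the slice. Numerators and denominators descend to the quotient in this way.
  have hlift : ∀ a ∈ R, (a ∘ s) ∘ e.symm ∈ quotientFunctions G R := by
    intro a ha
    rw [hmem]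
    convert hres a ha using 1
    funext y
    simp
  refine ⟨hstable, hY.of_equiv e hmem, ?_, ?_⟩
  · intro U
    constructor
    · intro hU z hz
      obtain ⟨b, hb, hbz, hbU⟩ := hU _ hz
      exact ⟨_, hb, hbz, fun y hy => hbU _ hy⟩
    · intro hU p hp
      obtain ⟨y, rfl⟩ := e.surjective p
      obtain ⟨b, hb, hbz, hbU⟩ := hU (s y) hp
      refine ⟨_, hlift b hb, by simpa using hbz, ?_⟩
      intro p' hp'
      obtain ⟨y', rfl⟩ := e.surjective p'
      exact hbU (s y') (by simpa using hp')
  · intro U _ φ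
    constructor
    · intro hφ z hz
      obtain ⟨a, ha, b, hb, hbz, h⟩ := hφ _ hz
      exact ⟨_, ha, _, hb, hbz, fun y hy hy' => h _ hy hy'⟩
    · intro hφ p hp
      obtain ⟨y, rfl⟩ := e.surjective p
      obtain ⟨a, ha, b, hb, hbz, h⟩ := hφ (s y) hp
      refine ⟨_, hlift a ha, _, hlift b hb, by simpa using hbz, ?_⟩
      intro p' hp' hp''
      obtain ⟨y', rfl⟩ := e.surjective p'
      have h1 := h (s y') hp' (by simpa using hp'')
      simp only [Function.comp_apply, Equiv.symm_apply_apply]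
      exact h1

end GeometricQuotient

/-! ### Locally nilpotent derivations and slices -/

section Derivations

variable {S : Type*} [CommRing S] [Algebra ℂ S]

/-- By Leibniz, each term of `D^s (a b)` has at least `n` derivatives on `a` or at least `m` on `b`.
-/
theorem Derivation.iterate_mul_eq_zero (D : Derivation ℂ S S) (s : ℕ) :
    ∀ (n m : ℕ) (a b : S), n + m ≤ s → D^[n] a = 0 → D^[m] b = 0 → D^[s] (a * b) = 0 := by
  have hz : ∀ k, D^[k] 0 = 0 := fun k => iterate_map_zero D k
  induction s with
  | zero =>
    intro n m a b h ha hb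
    obtain rfl : n = 0 := by omega
    simp only [Function.iterate_zero, id] at ha
    simp [ha]
  | succ s ih =>
    intro n m a b h ha hb
    rw [Function.iterate_succ_apply, D.leibniz, smul_eq_mul, smul_eq_mul, iterate_map_add]
    rcases n with _ | n
    · simp only [Function.iterate_zero, id] at ha
      simp [ha, hz]
    rcases m with _ | m
    · simp only [Function.iterate_zero, id] at hb
      simp [hb, hz]
    rw [ih (n + 1) m a (D b) (by omega) ha (by rwa [← Function.iterate_succ_apply]),
      ih (m + 1) n b (D a) (by omega) hb (by rwa [← Function.iterate_succ_apply]), add_zero]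

/-- Projection to the invariants of one derivation along a function `φ` with `D φ = 1`,
modulo an ideal. -/
theorem Derivation.exists_invariant (D : Derivation ℂ S S) (I : Ideal S) (φ : S)
    (hφ : D φ - 1 ∈ I) {X : S} {N : ℕ} (hN : D^[N] X = 0) :
    D (∑ n ∈ Finset.range N, ((n.factorial : ℂ)⁻¹ • (-φ) ^ n) * D^[n] X) ∈ I := by
  -- Modulo `I` the sum telescopes: `D` of a nonempty partial sum is its last term with one more `D`
  -- applied to `X`.
  have hterm : ∀ M, D (∑ n ∈ Finset.range M, ((n.factorial : ℂ)⁻¹ • (-φ) ^ n) * D^[n] X) -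
      (if M = 0 then 0 else (((M - 1).factorial : ℂ)⁻¹ • (-φ) ^ (M - 1)) * D^[M] X) ∈ I := by
    intro M
    induction M with
    | zero => simp
    | succ M ih =>
      rw [Finset.sum_range_succ, map_add, D.leibniz, ← Function.iterate_succ_apply' D]
      rcases M with _ | M
      · simp
      · have h1 : D (((M + 1).factorial : ℂ)⁻¹ • (-φ) ^ (M + 1)) +
            ((M.factorial : ℂ)⁻¹ • (-φ) ^ M) =
            -((M.factorial : ℂ)⁻¹ • (-φ) ^ M) * (D φ - 1) := by
          have h2 : (((M + 1).factorial : ℂ)⁻¹) * ((M : ℂ) + 1) = (M.factorial : ℂ)⁻¹ := by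
            rw [Nat.factorial_succ]
            push_cast
            have : (M : ℂ) + 1 ≠ 0 := by exact_mod_cast Nat.succ_ne_zero M
            field_simp
          have h5 : algebraMap ℂ S (M : ℂ) = (M : S) := by
            simp
          rw [D.map_smul, D.leibniz_pow, map_neg, ← h2, nsmul_eq_mul]
          simp only [Nat.add_sub_cancel, smul_eq_mul, Algebra.smul_def, map_mul,
            map_add, h5, map_one, Nat.cast_add, Nat.cast_one]
          ring
        have h3 := I.add_mem ih (I.mul_mem_right (D^[M + 1] X)
          (h1 ▸ I.mul_mem_left (-((M.factorial : ℂ)⁻¹ • (-φ) ^ M)) hφ))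
        convert h3 using 1
        simp only [Nat.add_sub_cancel, smul_eq_mul, if_neg (Nat.succ_ne_zero _)]
        ring
  have h := hterm N
  rw [hN] at h
  simpa using h

/-- Projection to the common invariants of a triangular family of derivations. -/
theorem exists_forall_invariant {d : ℕ} (D : Fin d → Derivation ℂ S S) (φ : Fin d → S)
    (I : Ideal S) (hself : ∀ i, D i (φ i) - 1 ∈ I)
    (hlt : ∀ i j, j < i → D i (φ j) ∈ I)
    (hcomm : ∀ i j, i < j → ∀ X, (∀ l, i < l → D l X ∈ I) → D j (D i X) ∈ I)
    (hnil : ∀ i X, ∃ N, (D i)^[N] X = 0) (X : S) :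
    ∃ Y, (∀ i, D i Y ∈ I) ∧ X - Y ∈ Ideal.span (Set.range φ) := by
  -- The derivations are treated from the last to the first: after `k` steps the last `k` of them
  -- kill the element modulo `I`.
  suffices H : ∀ k : ℕ, k ≤ d → ∃ Y, (∀ i : Fin d, d - k ≤ i → D i Y ∈ I) ∧
      X - Y ∈ Ideal.span (Set.range φ) by
    obtain ⟨Y, hY, hXY⟩ := H d le_rfl
    exact ⟨Y, fun i => hY i (by omega), hXY⟩
  intro k
  induction k with
  | zero => exact fun _ => ⟨X, fun i hi => absurd i.2 (by omega), by simp⟩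
  | succ k ih =>
    intro hk
    obtain ⟨Y, hY, hXY⟩ := ih (by omega)
    let i : Fin d := ⟨d - (k + 1), by omega⟩
    obtain ⟨N, hN⟩ := hnil i Y
    -- One power more than needed, so that the sum always contains its term `n = 0`, which is `Y`;
    -- all other terms have a factor `φ i`.
    have hN' : (D i)^[N + 1] Y = 0 := by
      rw [Function.iterate_succ_apply', hN, map_zero]
    -- Iterates of `D i` keep the invariance already obtained under the later derivations.
    have hiter : ∀ n, ∀ l, i < l → D l ((D i)^[n] Y) ∈ I := by
      intro n
      induction n with
      | zero =>
        intro l hl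
        refine hY l ?_
        have : (i : ℕ) < l := hl
        simp only [i] at this
        omega
      | succ n ihn =>
        intro l hl
        rw [Function.iterate_succ_apply']
        exact hcomm i l hl _ ihn
    refine ⟨∑ n ∈ Finset.range (N + 1), ((n.factorial : ℂ)⁻¹ • (-φ i) ^ n) * (D i)^[n] Y,
      ?_, ?_⟩
    · intro l hl
      rcases (show i ≤ l from hl).eq_or_lt with rfl | hil
      · exact (D i).exists_invariant I (φ i) (hself i) hN'
      · rw [map_sum]
        refine Ideal.sum_mem _ fun n _ => ?_
        rw [(D l).leibniz, (D l).map_smul, (D l).leibniz_pow, map_neg]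
        refine I.add_mem (I.mul_mem_left _ (hiter n l hil)) (I.mul_mem_left _ ?_)
        rw [Algebra.smul_def]
        refine I.mul_mem_left _ ?_
        rw [nsmul_eq_mul]
        exact I.mul_mem_left _ (I.mul_mem_left _ (neg_mem (hlt l i hil)))
    · rw [Finset.sum_range_succ']
      simp only [Nat.factorial_zero, Nat.cast_one, inv_one, pow_zero, one_smul, one_mul,
        Function.iterate_zero, id]
      rw [sub_add_eq_sub_sub_swap]
      refine Ideal.sub_mem _ hXY (Ideal.sum_mem _ fun n _ => ?_)
      refine Ideal.mul_mem_right _ _ ?_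
      rw [Algebra.smul_def, pow_succ]
      exact Ideal.mul_mem_left _ _ (Ideal.mul_mem_left _ _
        (neg_mem (Ideal.subset_span ⟨i, rfl⟩)))

end Derivations

/-! ### Exponentials of nilpotent adjoint maps -/

section Exponentials

variable {𝔤 : Type*} [LieRing 𝔤] [LieAlgebra ℂ 𝔤]

/-- The truncated exponential series of `ad y`. -/
noncomputable def expAdSum (y : 𝔤) (N : ℕ) : 𝔤 →ₗ[ℂ] 𝔤 :=
  ∑ k ∈ Finset.range N, ((k.factorial : ℂ)⁻¹) • (LieAlgebra.ad ℂ 𝔤 y) ^ k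

theorem ad_smul_pow (c : ℂ) (y : 𝔤) (k : ℕ) :
    (LieAlgebra.ad ℂ 𝔤 (c • y)) ^ k = c ^ k • (LieAlgebra.ad ℂ 𝔤 y) ^ k := by
  rw [map_smul, smul_pow]

/-- The exponential of a nilpotent derivation is an automorphism of the Lie algebra. -/
theorem exists_expAd {y : 𝔤} {N : ℕ} (h : (LieAlgebra.ad ℂ 𝔤 y) ^ N = 0) :
    ∃ E : 𝔤 ≃ₗ⁅ℂ⁆ 𝔤, (∀ x, E x = expAdSum y N x) ∧ ∀ x, E.symm x = expAdSum (-y) N x := by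
  -- The exponential of a nilpotent endomorphism uses rational scalars, so these are restricted from
  -- `ℂ`.
  let _i : Module ℚ 𝔤 := Module.compHom 𝔤 (algebraMap ℚ ℂ)
  let _i' : LieAlgebra ℚ 𝔤 :=
    { lie_smul := fun q x y => lie_smul (algebraMap ℚ ℂ q) x y }
  have hsmul : ∀ (n : ℕ) (x : 𝔤), ((n.factorial : ℚ)⁻¹) • x = ((n.factorial : ℂ)⁻¹) • x := by
    intro n x
    change (algebraMap ℚ ℂ ((n.factorial : ℚ)⁻¹)) • x = _
    congr 1
    simp
  -- This inner derivation is `x ↦ [x, y]`, that is `-ad y`; hence the inverse of its exponential is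
  -- taken below.
  let D : LieDerivation ℂ 𝔤 𝔤 := LieDerivation.inner ℂ 𝔤 𝔤 y
  have hD : -D.toLinearMap = LieAlgebra.ad ℂ 𝔤 y := by
    ext x
    simp [D]
  have hD' : D.toLinearMap = LieAlgebra.ad ℂ 𝔤 (-y) := by
    rw [map_neg, ← hD, neg_neg]
  have hN' : (LieAlgebra.ad ℂ 𝔤 (-y)) ^ N = 0 := by
    rw [map_neg, neg_pow, h, mul_zero]
  have hnil : IsNilpotent D.toLinearMap := ⟨N, by rw [hD', hN']⟩
  refine ⟨(LieDerivation.exp D hnil).symm, fun x => ?_, fun x => ?_⟩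
  · change IsNilpotent.exp (-D.toLinearMap) x = _
    rw [hD, IsNilpotent.exp_eq_sum h]
    simp [expAdSum, hsmul]
  · change IsNilpotent.exp D.toLinearMap x = _
    rw [hD', IsNilpotent.exp_eq_sum hN']
    simp only [expAdSum, LinearMap.sum_apply, LinearMap.smul_apply, hsmul]

theorem ad_neg_pow_eq_zero {y : 𝔤} {N : ℕ} (h : (LieAlgebra.ad ℂ 𝔤 y) ^ N = 0) :
    (LieAlgebra.ad ℂ 𝔤 (-y)) ^ N = 0 := by
  rw [map_neg, neg_pow, h, mul_zero]

theorem inv_coe_eq_expAdSum {y : 𝔤} {N : ℕ} (h : (LieAlgebra.ad ℂ 𝔤 y) ^ N = 0)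
    {g : 𝔤 ≃ₗ[ℂ] 𝔤} (hg : (g : 𝔤 →ₗ[ℂ] 𝔤) = expAdSum y N) :
    ((g⁻¹ : 𝔤 ≃ₗ[ℂ] 𝔤) : 𝔤 →ₗ[ℂ] 𝔤) = expAdSum (-y) N := by
  obtain ⟨E, hE, hE'⟩ := exists_expAd h
  have hgE : ∀ x, g x = E x := fun x => by
    rw [hE, ← hg]; rfl
  ext x
  rw [← hE']
  change g.symm x = E.symm x
  rw [LinearEquiv.symm_apply_eq, hgE, LieEquiv.apply_symm_apply]

/-- Induction over the unipotent group: it is generated as a monoid by exponentials. -/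
theorem unipotentGroup_induction {𝔪 : LieSubalgebra ℂ 𝔤} {p : (𝔤 ≃ₗ[ℂ] 𝔤) → Prop}
    (hgen : ∀ y ∈ 𝔪, ∀ N, (LieAlgebra.ad ℂ 𝔤 y) ^ N = 0 → ∀ g : 𝔤 ≃ₗ[ℂ] 𝔤,
      (g : 𝔤 →ₗ[ℂ] 𝔤) = expAdSum y N → p g)
    (hone : p 1) (hmul : ∀ g g', p g → p g' → p (g * g')) {g : 𝔤 ≃ₗ[ℂ] 𝔤}
    (hg : g ∈ unipotentGroup 𝔪) : p g := by
  refine Subgroup.closure_induction'' (p := fun g _ => p g) ?_ ?_ hone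
    (fun g g' _ _ h h' => hmul g g' h h') hg
  · rintro g ⟨y, hy, N, hN, h⟩
    exact hgen y hy N hN g h
  · rintro g ⟨y, hy, N, hN, h⟩
    exact hgen (-y) (neg_mem hy) N (ad_neg_pow_eq_zero hN) _ (inv_coe_eq_expAdSum hN h)

theorem unipotentGroup_map_lie {𝔪 : LieSubalgebra ℂ 𝔤} {g : 𝔤 ≃ₗ[ℂ] 𝔤}
    (hg : g ∈ unipotentGroup 𝔪) (a b : 𝔤) : g ⁅a, b⁆ = ⁅g a, g b⁆ := by
  revert a b
  refine unipotentGroup_induction (p := fun g => ∀ a b, g ⁅a, b⁆ = ⁅g a, g b⁆) ?_ ?_ ?_ hg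
  · intro y _ N hN g hg a b
    obtain ⟨E, hE, -⟩ := exists_expAd hN
    have hgE : ∀ x, g x = E x := fun x => by
      rw [hE, ← hg]; rfl
    rw [hgE, hgE, hgE, LieEquiv.map_lie]
  · intro a b
    rfl
  · intro g g' h h' a b
    simp only [LinearEquiv.mul_apply, h', h]

theorem unipotentGroup_mono {𝔪 𝔪' : LieSubalgebra ℂ 𝔤}
    (h : 𝔪.toSubmodule ≤ 𝔪'.toSubmodule) : unipotentGroup 𝔪 ≤ unipotentGroup 𝔪' :=
  Subgroup.closure_mono fun _ ⟨y, hy, hN⟩ => ⟨y, h hy, hN⟩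

theorem ad_pow_mem {W : Submodule ℂ 𝔤} {y : 𝔤} (hW : ∀ w ∈ W, ⁅y, w⁆ ∈ W) (k : ℕ) {w : 𝔤}
    (hw : w ∈ W) : ((LieAlgebra.ad ℂ 𝔤 y) ^ k) w ∈ W := by
  induction k with
  | zero => simpa using hw
  | succ k ih =>
    rw [pow_succ', Module.End.mul_apply]
    exact hW _ ih

/-- If `𝔪` acts on a subspace `W` and `ξ` vanishes on `[𝔪, W]`, then the unipotent group acts
on `W` and preserves the restriction of `ξ`. -/
theorem unipotentGroup_apply_mem {𝔪 : LieSubalgebra ℂ 𝔤} {W : Submodule ℂ 𝔤}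
    (hW : ∀ y ∈ 𝔪, ∀ w ∈ W, ⁅y, w⁆ ∈ W) {ξ : Dual ℂ 𝔤} (hξ : ∀ y ∈ 𝔪, ∀ w ∈ W, ξ ⁅y, w⁆ = 0)
    {g : 𝔤 ≃ₗ[ℂ] 𝔤} (hg : g ∈ unipotentGroup 𝔪) :
    ∀ w ∈ W, g w ∈ W ∧ ξ (g w) = ξ w := by
  refine unipotentGroup_induction (p := fun g => ∀ w ∈ W, g w ∈ W ∧ ξ (g w) = ξ w) ?_ ?_ ?_ hg
  · intro y hy N hN g hg w hw
    have hgw : g w = expAdSum y N w := by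
      rw [← hg]; rfl
    have hmem : ∀ k, ((LieAlgebra.ad ℂ 𝔤 y) ^ k) w ∈ W := fun k => ad_pow_mem (hW y hy) k hw
    rw [hgw]
    simp only [expAdSum, LinearMap.sum_apply, LinearMap.smul_apply]
    refine ⟨Submodule.sum_mem _ fun k _ => W.smul_mem _ (hmem k), ?_⟩
    -- For `N = 0` the hypothesis forces `𝔤 = 0`. Otherwise `ξ` kills all terms of the series except
    -- `k = 0`.
    rcases N with _ | N
    · have hw0 : w = 0 := by
        simpa using LinearMap.congr_fun hN w
      simp [hw0]
    · rw [map_sum, Finset.sum_range_succ', Finset.sum_eq_zero]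
      · simp
      · intro k _
        rw [map_smul, pow_succ', Module.End.mul_apply, LieAlgebra.ad_apply, hξ y hy _ (hmem k),
          smul_zero]
  · intro w hw
    exact ⟨hw, rfl⟩
  · intro g g' h h' w hw
    obtain ⟨h1, h2⟩ := h' w hw
    obtain ⟨h3, h4⟩ := h _ h1
    exact ⟨h3, h4.trans h2⟩

/-- An automorphism satisfies `g exp(ad y) g⁻¹ = exp(ad (g y))`, and `g` preserves `𝔪₁`. -/
theorem unipotentGroup_conj_mem {𝔪₀ 𝔪₁ : LieSubalgebra ℂ 𝔤}
    (h : ∀ y ∈ 𝔪₀, ∀ w ∈ 𝔪₁, ⁅y, w⁆ ∈ 𝔪₁) {g u : 𝔤 ≃ₗ[ℂ] 𝔤}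
    (hg : g ∈ unipotentGroup 𝔪₀) (hu : u ∈ unipotentGroup 𝔪₁) :
    g * u * g⁻¹ ∈ unipotentGroup 𝔪₁ := by
  refine unipotentGroup_induction (p := fun u => g * u * g⁻¹ ∈ unipotentGroup 𝔪₁) ?_ ?_ ?_ hu
  · intro y hy N hN u hu
    have hgy : g y ∈ 𝔪₁ := (unipotentGroup_apply_mem (W := 𝔪₁.toSubmodule) (ξ := 0) h
      (fun _ _ _ _ => rfl) hg y hy).1
    have hginv : ∀ x, g (g⁻¹ x) = x := fun x => g.apply_symm_apply x
    have hpow : ∀ k x, ((LieAlgebra.ad ℂ 𝔤 (g y)) ^ k) x =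
        g (((LieAlgebra.ad ℂ 𝔤 y) ^ k) (g⁻¹ x)) := by
      intro k
      induction k with
      | zero => intro x; simp
      | succ k ih =>
        intro x
        rw [pow_succ', Module.End.mul_apply, ih, pow_succ', Module.End.mul_apply,
          LieAlgebra.ad_apply, LieAlgebra.ad_apply, unipotentGroup_map_lie hg]
    refine Subgroup.subset_closure ⟨g y, hgy, N, ?_, ?_⟩
    · ext x
      rw [hpow, hN]
      simp
    · ext x
      change g (u (g⁻¹ x)) = _
      have : ∀ z, u z = expAdSum y N z := fun z => by rw [← hu]; rfl
      rw [this]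
      simp [expAdSum, hpow]
  · simp
  · intro u u' h h'
    have := mul_mem h h'
    simpa [mul_assoc] using this

/-! ### Coadjoint flows and their derivatives -/

theorem coadjoint_smul_apply (g : 𝔤 ≃ₗ[ℂ] 𝔤) (ξ : Dual ℂ 𝔤) (x : 𝔤) :
    (g • ξ) x = ξ (g⁻¹ x) := rfl

/-- The flow of `y` on the dual space is given by elements of any subgroup containing the
exponentials of the multiples of `y`. -/
theorem exists_smul_eq_comp_expAdSum {y : 𝔤} {N : ℕ} (hN : (LieAlgebra.ad ℂ 𝔤 y) ^ N = 0) :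
    ∃ g : 𝔤 ≃ₗ[ℂ] 𝔤, (∀ 𝔪 : LieSubalgebra ℂ 𝔤, y ∈ 𝔪 → g ∈ unipotentGroup 𝔪) ∧
      ∀ ξ : Dual ℂ 𝔤, g • ξ = ξ ∘ₗ expAdSum y N := by
  obtain ⟨E, hE, hE'⟩ := exists_expAd hN
  -- The coadjoint action composes with the inverse, so the group element is `exp(-ad y)`.
  refine ⟨E.symm.toLinearEquiv, fun 𝔪 hy => Subgroup.subset_closure
    ⟨-y, neg_mem hy, N, ad_neg_pow_eq_zero hN, ?_⟩, fun ξ => ?_⟩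
  · ext x
    exact hE' x
  · ext x
    rw [LinearMap.comp_apply, ← hE]
    rfl

/-- Differentiation shifts the coefficients, and `c N = 0` supplies the top term lost by truncation.
-/
theorem hasDerivAt_sum_factorial (c : ℕ → ℂ) {N : ℕ} (hc : c N = 0) (t : ℂ) :
    HasDerivAt (fun t : ℂ => ∑ k ∈ Finset.range N, (k.factorial : ℂ)⁻¹ * (t ^ k * c k))
      (∑ k ∈ Finset.range N, (k.factorial : ℂ)⁻¹ * (t ^ k * c (k + 1))) t := by
  have key : ∀ N, HasDerivAt
      (fun t : ℂ => ∑ k ∈ Finset.range (N + 1), (k.factorial : ℂ)⁻¹ * (t ^ k * c k))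
      (∑ k ∈ Finset.range N, (k.factorial : ℂ)⁻¹ * (t ^ k * c (k + 1))) t := by
    intro N
    induction N with
    | zero => simpa using hasDerivAt_const t _
    | succ N ih =>
      simp only [Finset.sum_range_succ _ (N + 1), Finset.sum_range_succ _ N] at ih ⊢
      refine ih.add ?_
      have h1 := (((hasDerivAt_pow (N + 1) t).mul_const (c (N + 1))).const_mul
        (((N + 1).factorial : ℂ)⁻¹))
      refine h1.congr_deriv ?_
      rw [Nat.factorial_succ]
      push_cast
      have : (N : ℂ) + 1 ≠ 0 := by exact_mod_cast Nat.succ_ne_zero N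
      have h3 : (N.factorial : ℂ) ≠ 0 := by exact_mod_cast Nat.factorial_ne_zero N
      field_simp
  rcases N with _ | N
  · simpa using hasDerivAt_const t _
  · rw [Finset.sum_range_succ _ N, hc]
    simpa using key N

/-- The Hamiltonian derivation `{y, ·}` generates the coadjoint flow. Both sides obey the Leibniz
rule in `X`, so linear functions decide. -/
theorem hasDerivAt_evalAt_expAdSum {y : 𝔤} {N : ℕ} (hN : (LieAlgebra.ad ℂ 𝔤 y) ^ N = 0)
    (ξ : Dual ℂ 𝔤) (X : SymmetricAlgebra ℂ 𝔤) (t : ℂ) :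
    HasDerivAt (fun t : ℂ => evalAt (ξ ∘ₗ expAdSum (t • y) N) X)
      (evalAt (ξ ∘ₗ expAdSum (t • y) N) (KirillovKostant.hamVec y X)) t := by
  induction X using SymmetricAlgebra.induction with
  | algebraMap r => simpa using hasDerivAt_const t r
  | ι x =>
    have h : ∀ (x : 𝔤) (t : ℂ), ξ (expAdSum (t • y) N x) = ∑ k ∈ Finset.range N,
        (k.factorial : ℂ)⁻¹ * (t ^ k * ξ (((LieAlgebra.ad ℂ 𝔤 y) ^ k) x)) := by
      intro x t
      simp only [expAdSum, ad_smul_pow, LinearMap.sum_apply, map_sum, LinearMap.smul_apply]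
      simp only [map_smul, smul_eq_mul]
    rw [KirillovKostant.hamVec_ι]
    simp only [evalAt_ι, LinearMap.comp_apply, h]
    have h1 := hasDerivAt_sum_factorial (fun k => ξ (((LieAlgebra.ad ℂ 𝔤 y) ^ k) x))
      (N := N) (by simp [hN]) t
    simpa only [pow_succ, Module.End.mul_apply, LieAlgebra.ad_apply] using h1
  | mul a b ha hb =>
    have h1 := ha.mul hb
    simp only [map_mul, Derivation.leibniz, map_add, smul_eq_mul]
    refine h1.congr_deriv ?_
    ring
  | add a b ha hb =>
    simp only [map_add]
    exact ha.add hb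

theorem comp_expAdSum_zero {y : 𝔤} {N : ℕ} (hN : (LieAlgebra.ad ℂ 𝔤 y) ^ N = 0)
    (ξ : Dual ℂ 𝔤) : ξ ∘ₗ expAdSum ((0 : ℂ) • y) N = ξ := by
  ext x
  rcases N with _ | N
  · have hx0 : x = 0 := by simpa using LinearMap.congr_fun hN x
    simp [hx0]
  · simp only [LinearMap.comp_apply, expAdSum, ad_smul_pow, Finset.sum_range_succ']
    simp

/-- Constant velocity gives affine motion. The case `c = 0` yields invariance, the case `c = 1`
moves points into a slice. -/
theorem evalAt_expAdSum_eq {y : 𝔤} {N : ℕ} (hN : (LieAlgebra.ad ℂ 𝔤 y) ^ N = 0)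
    {ξ : Dual ℂ 𝔤} {X : SymmetricAlgebra ℂ 𝔤} {c : ℂ}
    (h : ∀ t : ℂ, evalAt (ξ ∘ₗ expAdSum (t • y) N) (KirillovKostant.hamVec y X) = c) (t : ℂ) :
    evalAt (ξ ∘ₗ expAdSum (t • y) N) X = evalAt ξ X + c * t := by
  have h0 := comp_expAdSum_zero hN ξ
  have hder : ∀ t, HasDerivAt
      (fun t : ℂ => evalAt (ξ ∘ₗ expAdSum (t • y) N) X - c * t) 0 t := by
    intro t
    have h1 := (hasDerivAt_evalAt_expAdSum hN ξ X t).sub ((hasDerivAt_id t).const_mul c)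
    rw [h t, mul_one, sub_self] at h1
    exact h1
  have h2 := is_const_of_deriv_eq_zero (fun t => (hder t).differentiableAt)
    (fun t => (hder t).deriv) t 0
  simp only [h0] at h2
  linear_combination h2

/-- Group invariance implies infinitesimal invariance, by differentiation at `t = 0`. -/
theorem evalAt_hamVec_eq_zero {y : 𝔤} {N : ℕ} (hN : (LieAlgebra.ad ℂ 𝔤 y) ^ N = 0)
    {ξ : Dual ℂ 𝔤} {X : SymmetricAlgebra ℂ 𝔤}
    (h : ∀ t : ℂ, evalAt (ξ ∘ₗ expAdSum (t • y) N) X = evalAt ξ X) :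
    evalAt ξ (KirillovKostant.hamVec y X) = 0 := by
  have h0 := comp_expAdSum_zero hN ξ
  have h1 := hasDerivAt_evalAt_expAdSum hN ξ X 0
  simp only [h] at h1
  rw [h0] at h1
  exact h1.unique (hasDerivAt_const _ _)

theorem hamVec_locally_nilpotent {y : 𝔤} (hy : IsNilpotent (LieAlgebra.ad ℂ 𝔤 y))
    (X : SymmetricAlgebra ℂ 𝔤) : ∃ N, (KirillovKostant.hamVec y)^[N] X = 0 := by
  obtain ⟨n, hn⟩ := hy
  induction X using SymmetricAlgebra.induction with
  | algebraMap r => exact ⟨1, by simp⟩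
  | ι x =>
    have h : ∀ k, (KirillovKostant.hamVec y)^[k] (SymmetricAlgebra.ι ℂ 𝔤 x) =
        SymmetricAlgebra.ι ℂ 𝔤 (((LieAlgebra.ad ℂ 𝔤 y) ^ k) x) := by
      intro k
      induction k with
      | zero => simp
      | succ k ih =>
        rw [Function.iterate_succ_apply', ih, KirillovKostant.hamVec_ι, pow_succ',
          Module.End.mul_apply, LieAlgebra.ad_apply]
    exact ⟨n, by simp [h, hn]⟩
  | mul a b ha hb =>
    obtain ⟨k, hk⟩ := ha
    obtain ⟨l, hl⟩ := hb
    exact ⟨k + l, Derivation.iterate_mul_eq_zero _ _ k l a b le_rfl hk hl⟩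
  | add a b ha hb =>
    obtain ⟨k, hk⟩ := ha
    obtain ⟨l, hl⟩ := hb
    refine ⟨k + l, ?_⟩
    rw [iterate_map_add]
    nth_rewrite 1 [add_comm k l]
    rw [Function.iterate_add_apply, Function.iterate_add_apply, hk, hl, iterate_map_zero,
      iterate_map_zero, add_zero]

end Exponentials

/-! ### Hamiltonian reductions with a slice -/

section SliceFamilies

open KirillovKostant

variable {𝔤 : Type*} [LieRing 𝔤] [LieAlgebra ℂ 𝔤]

theorem mem_zeroFibre {χ ξ : Dual ℂ 𝔤} {𝔪 : LieSubalgebra ℂ 𝔤} :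
    ξ ∈ zeroFibre χ 𝔪 ↔ ∀ y ∈ 𝔪, ξ y = χ y := by
  constructor
  · intro h y hy
    have := LinearMap.congr_fun (show momentMap χ 𝔪 ξ = 0 from h) ⟨y, hy⟩
    exact sub_eq_zero.1 this
  · intro h
    change momentMap χ 𝔪 ξ = 0
    ext y
    exact sub_eq_zero.2 (h y y.2)

theorem evalAt_eq_zero_of_mem_span {χ ξ : Dual ℂ 𝔤} {𝔪 : LieSubalgebra ℂ 𝔤}
    (hξ : ξ ∈ zeroFibre χ 𝔪) {X : SymmetricAlgebra ℂ 𝔤}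
    (hX : X ∈ Ideal.span (shiftedElements χ 𝔪)) : evalAt ξ X = 0 :=
  evalAt_eq_zero_of_mem_affineIdeal (W := 𝔪.toSubmodule) (mem_zeroFibre.1 hξ) hX

/-- A Nullstellensatz without radical, since the fibre is an affine subspace. It allows membership
in the ideal to be tested at points. -/
theorem mem_span_shiftedElements [FiniteDimensional ℂ 𝔤] {χ : Dual ℂ 𝔤}
    {𝔪 : LieSubalgebra ℂ 𝔤} {X : SymmetricAlgebra ℂ 𝔤} :
    X ∈ Ideal.span (shiftedElements χ 𝔪) ↔ ∀ ξ ∈ zeroFibre χ 𝔪, evalAt ξ X = 0 :=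
  ⟨fun h _ hξ => evalAt_eq_zero_of_mem_span hξ h, fun h =>
    mem_affineIdeal_of_evalAt_eq_zero (W := 𝔪.toSubmodule)
      fun ξ hξ => h ξ (mem_zeroFibre.2 hξ)⟩

theorem bracket_ι_sub (y : 𝔤) (c : ℂ) (X : SymmetricAlgebra ℂ 𝔤) :
    (kirillovKostant 𝔤).bracket (SymmetricAlgebra.ι ℂ 𝔤 y - algebraMap ℂ _ c) X =
      hamVec y X := by
  change rightBr X (SymmetricAlgebra.ι ℂ 𝔤 y - algebraMap ℂ _ c) = _
  rw [map_sub, rightBr_ι, Derivation.map_algebraMap, sub_zero]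

theorem hamVec_lie (a b : 𝔤) (X : SymmetricAlgebra ℂ 𝔤) :
    hamVec a (hamVec b X) = hamVec ⁅a, b⁆ X + hamVec b (hamVec a X) := by
  have h := br_jacobi (SymmetricAlgebra.ι ℂ 𝔤 a) (SymmetricAlgebra.ι ℂ 𝔤 b) X
  rw [br_ι_ι] at h
  simpa only [br_apply, rightBr_ι] using h

theorem mem_normalizer_shiftedElements {χ : Dual ℂ 𝔤} {𝔪 : LieSubalgebra ℂ 𝔤}
    {X : SymmetricAlgebra ℂ 𝔤} :
    X ∈ (kirillovKostant 𝔤).normalizer (shiftedElements χ 𝔪) ↔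
      ∀ y ∈ 𝔪, hamVec y X ∈ Ideal.span (shiftedElements χ 𝔪) := by
  constructor
  · intro h y hy
    rw [← bracket_ι_sub y (χ y)]
    exact h _ ⟨y, hy, rfl⟩
  · rintro h _ ⟨y, hy, rfl⟩
    rw [bracket_ι_sub]
    exact h y hy

/-- The bracket with `y` sends `w - χ(w)` to `[y, w]`, which is again a generator because `χ([y, w])
= 0`. -/
theorem hamVec_mem_span {χ : Dual ℂ 𝔤} {𝔪 : LieSubalgebra ℂ 𝔤} {y : 𝔤}
    (hy : ∀ w ∈ 𝔪, ⁅y, w⁆ ∈ 𝔪) (hχ : ∀ w ∈ 𝔪, χ ⁅y, w⁆ = 0) {X : SymmetricAlgebra ℂ 𝔤}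
    (hX : X ∈ Ideal.span (shiftedElements χ 𝔪)) :
    hamVec y X ∈ Ideal.span (shiftedElements χ 𝔪) := by
  induction hX using Submodule.span_induction with
  | mem t ht =>
    obtain ⟨w, hw, rfl⟩ := ht
    rw [map_sub, hamVec_ι, Derivation.map_algebraMap, sub_zero]
    refine Ideal.subset_span ⟨⁅y, w⁆, hy w hw, ?_⟩
    rw [hχ w hw, map_zero, sub_zero]
  | zero => simp
  | add a b _ _ ha hb => simpa using Ideal.add_mem _ ha hb
  | smul a b hb hb' =>
    rw [smul_eq_mul, Derivation.leibniz]
    exact Ideal.add_mem _ (Ideal.mul_mem_left _ _ hb') (Ideal.mul_mem_right _ _ hb)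

theorem span_le_normalizer {χ : Dual ℂ 𝔤} {𝔪 : LieSubalgebra ℂ 𝔤}
    (hχ : ∀ a ∈ 𝔪, ∀ b ∈ 𝔪, χ ⁅a, b⁆ = 0) {X : SymmetricAlgebra ℂ 𝔤}
    (hX : X ∈ Ideal.span (shiftedElements χ 𝔪)) :
    X ∈ (kirillovKostant 𝔤).normalizer (shiftedElements χ 𝔪) :=
  mem_normalizer_shiftedElements.2 fun y hy =>
    hamVec_mem_span (fun _ hw => 𝔪.lie_mem hy hw) (hχ y hy) hX

/-- As `χ` is a character of `𝔪`, the ideal lies in the normalizer, so the condition does not depend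
on the representative. -/
theorem modI_mem_classicalW {χ : Dual ℂ 𝔤} {𝔪 : LieSubalgebra ℂ 𝔤}
    (hχ : ∀ a ∈ 𝔪, ∀ b ∈ 𝔪, χ ⁅a, b⁆ = 0) {X : SymmetricAlgebra ℂ 𝔤} :
    modI χ 𝔪 X ∈ classicalW χ 𝔪 ↔
      X ∈ (kirillovKostant 𝔤).normalizer (shiftedElements χ 𝔪) := by
  constructor
  · rintro ⟨X', hX', h⟩
    have h1 : X' - X ∈ Ideal.span (shiftedElements χ 𝔪) := Ideal.Quotient.eq.1 h
    have hX'' : X' ∈ (kirillovKostant 𝔤).normalizer (shiftedElements χ 𝔪) := hX'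
    have h2 := sub_mem hX'' (span_le_normalizer hχ h1)
    simpa using h2
  · exact fun h => ⟨X, h, rfl⟩

/-- The acting algebra `𝔨` is separate from `𝔪` in order to cover `M` acting on its own fibre and
`M₀` acting on `μ₁⁻¹(0)`. -/
theorem smul_mem_zeroFibre {χ : Dual ℂ 𝔤} {𝔨 𝔪 : LieSubalgebra ℂ 𝔤}
    (hlie : ∀ y ∈ 𝔨, ∀ w ∈ 𝔪, ⁅y, w⁆ ∈ 𝔪) (hχ : ∀ y ∈ 𝔨, ∀ w ∈ 𝔪, χ ⁅y, w⁆ = 0)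
    {g : 𝔤 ≃ₗ[ℂ] 𝔤} (hg : g ∈ unipotentGroup 𝔨) {ξ : Dual ℂ 𝔤} (hξ : ξ ∈ zeroFibre χ 𝔪) :
    g • ξ ∈ zeroFibre χ 𝔪 := by
  rw [mem_zeroFibre] at hξ ⊢
  intro w hw
  have h := unipotentGroup_apply_mem (W := 𝔪.toSubmodule) (ξ := ξ) hlie
    (fun y hy w hw => by rw [hξ _ (hlie y hy w hw), hχ y hy w hw])
    (inv_mem hg) w hw
  rw [coadjoint_smul_apply, h.2, hξ w hw]

section Character

variable {χ : Dual ℂ 𝔤} {𝔪 : LieSubalgebra ℂ 𝔤}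

theorem comp_expAdSum_mem_zeroFibre (hχ : ∀ a ∈ 𝔪, ∀ b ∈ 𝔪, χ ⁅a, b⁆ = 0)
    {y : 𝔤} (hy : y ∈ 𝔪) {N : ℕ}
    (hN : (LieAlgebra.ad ℂ 𝔤 y) ^ N = 0) {ξ : Dual ℂ 𝔤} (hξ : ξ ∈ zeroFibre χ 𝔪) (t : ℂ) :
    ξ ∘ₗ expAdSum (t • y) N ∈ zeroFibre χ 𝔪 := by
  obtain ⟨g, hg, hgξ⟩ := exists_smul_eq_comp_expAdSum (y := t • y) (N := N)
    (by rw [ad_smul_pow, hN, smul_zero])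
  rw [← hgξ]
  exact smul_mem_zeroFibre (fun y hy w hw => 𝔪.lie_mem hy hw) hχ (hg 𝔪 (𝔪.smul_mem t hy)) hξ

/-- Along an exponential the derivative of `X` is the value of `{y, X} ∈ I`, which is zero because
the flow stays in the fibre. -/
theorem evalAt_smul_of_mem_normalizer (hχ : ∀ a ∈ 𝔪, ∀ b ∈ 𝔪, χ ⁅a, b⁆ = 0)
    {X : SymmetricAlgebra ℂ 𝔤}
    (hX : X ∈ (kirillovKostant 𝔤).normalizer (shiftedElements χ 𝔪)) {g : 𝔤 ≃ₗ[ℂ] 𝔤}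
    (hg : g ∈ unipotentGroup 𝔪) {ξ : Dual ℂ 𝔤} (hξ : ξ ∈ zeroFibre χ 𝔪) :
    evalAt (g • ξ) X = evalAt ξ X := by
  suffices h : ∀ ξ ∈ zeroFibre χ 𝔪, g • ξ ∈ zeroFibre χ 𝔪 ∧ evalAt (g • ξ) X = evalAt ξ X from
    (h ξ hξ).2
  refine unipotentGroup_induction (p := fun g => ∀ ξ ∈ zeroFibre χ 𝔪,
    g • ξ ∈ zeroFibre χ 𝔪 ∧ evalAt (g • ξ) X = evalAt ξ X) ?_ ?_ ?_ hg
  · intro y hy N hN g hg ξ hξ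
    have hN' := ad_neg_pow_eq_zero hN
    have hy' := 𝔪.neg_mem hy
    have hgξ : g • ξ = ξ ∘ₗ expAdSum ((1 : ℂ) • (-y)) N := by
      rw [one_smul, ← inv_coe_eq_expAdSum hN hg]
      rfl
    rw [hgξ]
    refine ⟨comp_expAdSum_mem_zeroFibre hχ hy' hN' hξ 1, ?_⟩
    rw [evalAt_expAdSum_eq hN' (c := 0), zero_mul, add_zero]
    intro t
    exact evalAt_eq_zero_of_mem_span (comp_expAdSum_mem_zeroFibre hχ hy' hN' hξ t)
      (mem_normalizer_shiftedElements.1 hX _ hy')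
  · intro ξ hξ
    rw [one_smul]
    exact ⟨hξ, rfl⟩
  · intro g g' h h' ξ hξ
    rw [mul_smul]
    exact ⟨(h _ (h' ξ hξ).1).1, (h _ (h' ξ hξ).1).2.trans (h' ξ hξ).2⟩

/-- An identification of the W-algebra with an algebra of functions on a set of points of the
zero fibre. -/
theorem exists_classicalW_algEquiv (hχ : ∀ a ∈ 𝔪, ∀ b ∈ 𝔪, χ ⁅a, b⁆ = 0)
    {Y : Type*} (pt : Y → Dual ℂ 𝔤)
    (hpt : ∀ p, pt p ∈ zeroFibre χ 𝔪) (R : Subalgebra ℂ (Y → ℂ))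
    (hmem : ∀ X ∈ (kirillovKostant 𝔤).normalizer (shiftedElements χ 𝔪),
      (fun p => evalAt (pt p) X) ∈ R)
    (hsurj : ∀ φ ∈ R, ∃ X ∈ (kirillovKostant 𝔤).normalizer (shiftedElements χ 𝔪),
      ∀ p, φ p = evalAt (pt p) X)
    (hinj : ∀ X ∈ (kirillovKostant 𝔤).normalizer (shiftedElements χ 𝔪),
      (∀ p, evalAt (pt p) X = 0) → X ∈ Ideal.span (shiftedElements χ 𝔪)) :
    ∃ Θ : classicalW χ 𝔪 ≃ₐ[ℂ] R, ∀ X (hX : modI χ 𝔪 X ∈ classicalW χ 𝔪) (p : Y),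
      (Θ ⟨modI χ 𝔪 X, hX⟩ : Y → ℂ) p = evalAt (pt p) X := by
  let E : (SymmetricAlgebra ℂ 𝔤 ⧸ Ideal.span (shiftedElements χ 𝔪)) →ₐ[ℂ] (Y → ℂ) :=
    AlgHom.pi fun p => Ideal.Quotient.liftₐ _ (evalAt (pt p))
      fun X hX => evalAt_eq_zero_of_mem_span (hpt p) hX
  have hE : ∀ X p, E (modI χ 𝔪 X) p = evalAt (pt p) X := fun X p => rfl
  have hER : ∀ w : classicalW χ 𝔪, (E.comp (classicalW χ 𝔪).val) w ∈ R := by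
    rintro ⟨_, X, hX, rfl⟩
    exact hmem X hX
  let F : classicalW χ 𝔪 →ₐ[ℂ] R := (E.comp (classicalW χ 𝔪).val).codRestrict R hER
  have hF : ∀ X (hX : modI χ 𝔪 X ∈ classicalW χ 𝔪) (p : Y),
      (F ⟨modI χ 𝔪 X, hX⟩ : Y → ℂ) p = evalAt (pt p) X := fun X hX p => rfl
  refine ⟨AlgEquiv.ofBijective F ⟨?_, ?_⟩, hF⟩
  · rw [injective_iff_map_eq_zero]
    rintro ⟨w, hw⟩ h
    obtain ⟨X, rfl⟩ := Ideal.Quotient.mk_surjective w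
    apply Subtype.ext
    refine Ideal.Quotient.eq_zero_iff_mem.2 (hinj X ((modI_mem_classicalW hχ).1 hw) fun p => ?_)
    rw [← hF X hw p, h]
    rfl
  · rintro ⟨φ, hφ⟩
    obtain ⟨X, hX, h⟩ := hsurj φ hφ
    exact ⟨⟨modI χ 𝔪 X, (modI_mem_classicalW hχ).2 hX⟩, Subtype.ext (funext fun p => (h p).symm)⟩

end Character

/-- A triangular family of elements `y i` that span `𝔪`, and of linear functions `x j` on the
zero fibre that are conjugate to them. -/
structure SliceFamily (χ : Dual ℂ 𝔤) (𝔪 : LieSubalgebra ℂ 𝔤) {d : ℕ} (y x : Fin d → 𝔤) :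
    Prop where
  span_eq : Submodule.span ℂ (Set.range y) = 𝔪.toSubmodule
  nilpotent : ∀ i, IsNilpotent (LieAlgebra.ad ℂ 𝔤 (y i))
  lie_mem : ∀ i j, j ≤ i → ⁅y i, x j⁆ ∈ 𝔪
  apply_self : ∀ i, χ ⁅y i, x i⁆ = 1
  apply_lt : ∀ i j, j < i → χ ⁅y i, x j⁆ = 0
  triangular : ∀ i j, i < j → ⁅y j, y i⁆ ∈ Submodule.span ℂ (y '' Set.Ioi i)
  character : ∀ a ∈ 𝔪, ∀ b ∈ 𝔪, χ ⁅a, b⁆ = 0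

/-- The slice defined by the linear functions `x j` on the zero fibre. -/
def sliceSet (χ : Dual ℂ 𝔤) (𝔪 : LieSubalgebra ℂ 𝔤) {d : ℕ} (x : Fin d → 𝔤) :
    Set (Dual ℂ 𝔤) :=
  {ξ | ξ ∈ zeroFibre χ 𝔪 ∧ ∀ j, ξ (x j) = 0}

theorem hamVec_mem_of_mem_span {I : Ideal (SymmetricAlgebra ℂ 𝔤)} {X : SymmetricAlgebra ℂ 𝔤}
    {s : Set 𝔤} (h : ∀ a ∈ s, hamVec a X ∈ I) {a : 𝔤} (ha : a ∈ Submodule.span ℂ s) :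
    hamVec a X ∈ I := by
  induction ha using Submodule.span_induction with
  | mem a ha => exact h a ha
  | zero =>
    have : hamVec (0 : 𝔤) X = 0 := by
      rw [← zero_smul ℂ (0 : 𝔤), hamVec_smul]
      simp
    rw [this]
    exact I.zero_mem
  | add a b _ _ ha hb =>
    rw [hamVec_add]
    exact I.add_mem ha hb
  | smul c a _ ha =>
    rw [hamVec_smul, Derivation.smul_apply, Algebra.smul_def]
    exact I.mul_mem_left _ ha

/-! ### Orbits, invariants and quotients from a slice family -/

namespace SliceFamily

variable {χ : Dual ℂ 𝔤} {𝔪 : LieSubalgebra ℂ 𝔤} {d : ℕ} {y x : Fin d → 𝔤}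

theorem y_mem (F : SliceFamily χ 𝔪 y x) (i : Fin d) : y i ∈ 𝔪 := by
  have : y i ∈ 𝔪.toSubmodule := F.span_eq ▸ Submodule.subset_span ⟨i, rfl⟩
  exact this

theorem smul_mem (F : SliceFamily χ 𝔪 y x) {g : 𝔤 ≃ₗ[ℂ] 𝔤} (hg : g ∈ unipotentGroup 𝔪)
    {ξ : Dual ℂ 𝔤} (hξ : ξ ∈ zeroFibre χ 𝔪) : g • ξ ∈ zeroFibre χ 𝔪 :=
  smul_mem_zeroFibre (fun _ hy _ hw => 𝔪.lie_mem hy hw) F.character hg hξ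

theorem mem_normalizer_iff (F : SliceFamily χ 𝔪 y x) {X : SymmetricAlgebra ℂ 𝔤} :
    X ∈ (kirillovKostant 𝔤).normalizer (shiftedElements χ 𝔪) ↔
      ∀ i, hamVec (y i) X ∈ Ideal.span (shiftedElements χ 𝔪) := by
  rw [mem_normalizer_shiftedElements]
  refine ⟨fun h i => h _ (F.y_mem i), fun h a ha => ?_⟩
  refine hamVec_mem_of_mem_span (s := Set.range y) ?_ (F.span_eq.symm ▸ ha)
  rintro _ ⟨i, rfl⟩
  exact h i

theorem mem_normalizer_of_invariant (F : SliceFamily χ 𝔪 y x) [FiniteDimensional ℂ 𝔤]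
    {X : SymmetricAlgebra ℂ 𝔤}
    (hX : ∀ g ∈ unipotentGroup 𝔪, ∀ ξ ∈ zeroFibre χ 𝔪, evalAt (g • ξ) X = evalAt ξ X) :
    X ∈ (kirillovKostant 𝔤).normalizer (shiftedElements χ 𝔪) := by
  rw [F.mem_normalizer_iff]
  intro i
  rw [mem_span_shiftedElements]
  intro ξ hξ
  obtain ⟨N, hN⟩ := F.nilpotent i
  refine evalAt_hamVec_eq_zero hN fun t => ?_
  obtain ⟨g, hg, hgξ⟩ := exists_smul_eq_comp_expAdSum (y := t • y i) (N := N)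
    (by rw [ad_smul_pow, hN, smul_zero])
  rw [← hgξ]
  exact hX g (hg 𝔪 (𝔪.smul_mem t (F.y_mem i))) ξ hξ

/-- Flowing along `y k` for the time `-ξ(x k)` kills the coordinate `x k` and keeps the earlier ones
at zero. The subgroup `G` records that only flows of the `y i` are used; for `G` generated by `M₁`
and `M₀` this replaces a factorization of `M₂`. -/
theorem exists_smul_mem_sliceSet (F : SliceFamily χ 𝔪 y x) (G : Subgroup (𝔤 ≃ₗ[ℂ] 𝔤))
    (hG : ∀ i, ∃ 𝔨 : LieSubalgebra ℂ 𝔤, y i ∈ 𝔨 ∧ unipotentGroup 𝔨 ≤ G) {ξ : Dual ℂ 𝔤}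
    (hξ : ξ ∈ zeroFibre χ 𝔪) : ∃ g ∈ G, g ∈ unipotentGroup 𝔪 ∧ g • ξ ∈ sliceSet χ 𝔪 x := by
  suffices H : ∀ k : ℕ, k ≤ d → ∃ g ∈ G, g ∈ unipotentGroup 𝔪 ∧
      ∀ j : Fin d, (j : ℕ) < k → (g • ξ) (x j) = 0 by
    obtain ⟨g, hg, hgm, h⟩ := H d le_rfl
    exact ⟨g, hg, hgm, F.smul_mem hgm hξ, fun j => h j j.2⟩
  intro k
  induction k with
  | zero => exact fun _ => ⟨1, one_mem _, one_mem _, fun j hj => absurd hj (by omega)⟩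
  | succ k ih =>
    intro hk
    obtain ⟨g, hg, hgm, h⟩ := ih (by omega)
    let i : Fin d := ⟨k, by omega⟩
    have hη : g • ξ ∈ zeroFibre χ 𝔪 := F.smul_mem hgm hξ
    obtain ⟨N, hN⟩ := F.nilpotent i
    obtain ⟨𝔨, hi𝔨, h𝔨⟩ := hG i
    obtain ⟨u, hu, huξ⟩ := exists_smul_eq_comp_expAdSum (y := (-(g • ξ) (x i)) • y i) (N := N)
      (by rw [ad_smul_pow, hN, smul_zero])
    -- The velocity of `x j` under `y i` is the value of `[y i, x j]`, constant on the fibre as soon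
    -- as this bracket lies in `𝔪`.
    have hval : ∀ j c, ⁅y i, x j⁆ ∈ 𝔪 → χ ⁅y i, x j⁆ = c →
        (u • g • ξ) (x j) = (g • ξ) (x j) + c * -(g • ξ) (x i) := by
      intro j c hj hc
      have h1 := evalAt_expAdSum_eq hN (ξ := g • ξ) (X := SymmetricAlgebra.ι ℂ 𝔤 (x j)) (c := c)
        (fun t => by
          rw [hamVec_ι, evalAt_ι, mem_zeroFibre.1
            (comp_expAdSum_mem_zeroFibre F.character (F.y_mem i) hN hη t) _ hj, hc])
        (-(g • ξ) (x i))
      rwa [evalAt_ι, evalAt_ι, ← huξ] at h1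
    refine ⟨u * g, mul_mem (h𝔨 (hu 𝔨 (𝔨.smul_mem _ hi𝔨))) hg,
      mul_mem (hu 𝔪 (𝔪.smul_mem _ (F.y_mem i))) hgm, ?_⟩
    intro j hj
    rw [mul_smul]
    rcases (show j ≤ i from Nat.lt_succ_iff.1 hj).eq_or_lt with rfl | hji
    · rw [hval _ 1 (F.lie_mem _ _ le_rfl) (F.apply_self _)]
      ring
    · rw [hval j 0 (F.lie_mem _ _ hji.le) (F.apply_lt _ _ hji), h j hji]
      ring

/-- Modulo `I`, the derivations `{y i, ·}` and the functions `x j` satisfy the hypotheses of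
`exists_forall_invariant`. Every polynomial thus gets an invariant substitute with the same
restriction to the slice. -/
theorem exists_projection (F : SliceFamily χ 𝔪 y x) (X : SymmetricAlgebra ℂ 𝔤) :
    ∃ Y ∈ (kirillovKostant 𝔤).normalizer (shiftedElements χ 𝔪),
      X - Y ∈ Ideal.span (Set.range fun j => SymmetricAlgebra.ι ℂ 𝔤 (x j)) := by
  have hι : ∀ a ∈ 𝔪, SymmetricAlgebra.ι ℂ 𝔤 a - algebraMap ℂ _ (χ a) ∈
      Ideal.span (shiftedElements χ 𝔪) := fun a ha => Ideal.subset_span ⟨a, ha, rfl⟩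
  obtain ⟨Y, hY, hXY⟩ := exists_forall_invariant (fun i => hamVec (y i))
    (fun j => SymmetricAlgebra.ι ℂ 𝔤 (x j)) (Ideal.span (shiftedElements χ 𝔪))
    (fun i => by
      have := hι _ (F.lie_mem i i le_rfl)
      rwa [F.apply_self, map_one, ← hamVec_ι] at this)
    (fun i j hji => by
      have := hι _ (F.lie_mem i j hji.le)
      rwa [F.apply_lt i j hji, map_zero, sub_zero, ← hamVec_ι] at this)
    -- By Jacobi, `{y_j, {y_i, X}} = {[y_j, y_i], X} + {y_i, {y_j, X}}`. Triangularity handles the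
    -- first term, stability of `I` under `y_i` the second.
    (fun i j hij X hX => by
      rw [hamVec_lie]
      refine Ideal.add_mem _ (hamVec_mem_of_mem_span ?_ (F.triangular i j hij))
        (hamVec_mem_span (fun w hw => 𝔪.lie_mem (F.y_mem i) hw)
          (F.character _ (F.y_mem i)) (hX j hij))
      rintro _ ⟨l, hl, rfl⟩
      exact hX l hl)
    (fun i X => hamVec_locally_nilpotent (F.nilpotent i) X) X
  exact ⟨Y, F.mem_normalizer_iff.2 hY, hXY⟩

theorem evalAt_eq_of_sub_mem {ξ : Dual ℂ 𝔤} (hξ : ∀ j, ξ (x j) = 0)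
    {X Y : SymmetricAlgebra ℂ 𝔤}
    (h : X - Y ∈ Ideal.span (Set.range fun j => SymmetricAlgebra.ι ℂ 𝔤 (x j))) :
    evalAt ξ X = evalAt ξ Y := by
  have h1 : Ideal.span (Set.range fun j => SymmetricAlgebra.ι ℂ 𝔤 (x j)) ≤
      RingHom.ker (evalAt ξ) := by
    refine Ideal.span_le.2 ?_
    rintro _ ⟨j, rfl⟩
    simp [RingHom.mem_ker, hξ j]
  have h2 := h1 h
  rw [RingHom.mem_ker, map_sub] at h2
  exact sub_eq_zero.1 h2

/-- An orbit meets the slice at most once. -/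
theorem eq_of_smul_eq (F : SliceFamily χ 𝔪 y x) {ξ ξ' : Dual ℂ 𝔤} (hξ : ξ ∈ sliceSet χ 𝔪 x)
    (hξ' : ξ' ∈ sliceSet χ 𝔪 x) {g : 𝔤 ≃ₗ[ℂ] 𝔤} (hg : g ∈ unipotentGroup 𝔪)
    (h : g • ξ = ξ') : ξ = ξ' := by
  ext v
  -- The invariant that agrees with the coordinate `v` on the slice separates points that differ at
  -- `v`.
  obtain ⟨Y, hY, hXY⟩ := F.exists_projection (SymmetricAlgebra.ι ℂ 𝔤 v)
  rw [← evalAt_ι ξ, ← evalAt_ι ξ', evalAt_eq_of_sub_mem hξ.2 hXY,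
    evalAt_eq_of_sub_mem hξ'.2 hXY, ← h, evalAt_smul_of_mem_normalizer F.character hY hg hξ.1]

theorem evalAt_eq_zero_of_sliceSet (F : SliceFamily χ 𝔪 y x) {X : SymmetricAlgebra ℂ 𝔤}
    (hX : X ∈ (kirillovKostant 𝔤).normalizer (shiftedElements χ 𝔪)) {ξ : Dual ℂ 𝔤}
    (hξ : ξ ∈ zeroFibre χ 𝔪)
    (h : ∀ g ∈ unipotentGroup 𝔪, g • ξ ∈ sliceSet χ 𝔪 x → evalAt (g • ξ) X = 0) :
    evalAt ξ X = 0 := by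
  obtain ⟨g, -, hg, hgξ⟩ := F.exists_smul_mem_sliceSet ⊤ (fun i => ⟨𝔪, F.y_mem i, le_top⟩) hξ
  rw [← evalAt_smul_of_mem_normalizer F.character hX hg hξ]
  exact h g hg hgξ

/-- Every orbit in the fibre meets the slice, so an invariant is determined by its restriction
there. -/
theorem mem_span_of_sliceSet (F : SliceFamily χ 𝔪 y x) [FiniteDimensional ℂ 𝔤]
    {X : SymmetricAlgebra ℂ 𝔤}
    (hX : X ∈ (kirillovKostant 𝔤).normalizer (shiftedElements χ 𝔪))
    (h : ∀ ξ ∈ sliceSet χ 𝔪 x, evalAt ξ X = 0) : X ∈ Ideal.span (shiftedElements χ 𝔪) := by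
  rw [mem_span_shiftedElements]
  exact fun ξ hξ => F.evalAt_eq_zero_of_sliceSet hX hξ fun g _ hgξ => h _ hgξ

theorem bijective_mk (F : SliceFamily χ 𝔪 y x) : Function.Bijective (fun ξ : sliceSet χ 𝔪 x =>
    OrbitSpace.mk (unipotentGroup 𝔪) (⟨ξ, ξ.2.1⟩ : zeroFibre χ 𝔪)) := by
  constructor
  · intro ξ ξ' h
    obtain ⟨g, hg⟩ := OrbitSpace.mk_eq_mk.1 h
    exact (Subtype.ext (F.eq_of_smul_eq ξ'.2 ξ.2 g.2 hg)).symm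
  · intro p
    obtain ⟨ξ, rfl⟩ := OrbitSpace.mk_surjective p
    obtain ⟨g, -, hg, hgξ⟩ :=
      F.exists_smul_mem_sliceSet ⊤ (fun i => ⟨𝔪, F.y_mem i, le_top⟩) ξ.2
    exact ⟨⟨_, hgξ⟩, OrbitSpace.mk_eq_mk.2 ⟨⟨g, hg⟩, rfl⟩⟩

theorem isAffineVariety (F : SliceFamily χ 𝔪 y x) [FiniteDimensional ℂ 𝔤] :
    IsAffineVariety (polyFunctions (sliceSet χ 𝔪 x)) := by
  -- The form `χ` need not vanish on the `x j`; the base point of the slice is taken in its orbit.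
  obtain ⟨g, -, -, h₀⟩ := F.exists_smul_mem_sliceSet ⊤ (fun i => ⟨𝔪, F.y_mem i, le_top⟩)
    (mem_zeroFibre.2 fun _ _ => rfl : χ ∈ zeroFibre χ 𝔪)
  refine isAffineVariety_polyFunctions (𝔪.toSubmodule ⊔ Submodule.span ℂ (Set.range x)) (g • χ) ?_
  intro ξ
  constructor
  · intro hξ w hw
    have hle : 𝔪.toSubmodule ⊔ Submodule.span ℂ (Set.range x) ≤ LinearMap.ker (ξ - g • χ) := by
      refine sup_le ?_ (Submodule.span_le.2 ?_)
      · intro w hw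
        rw [LinearMap.mem_ker, LinearMap.sub_apply, mem_zeroFibre.1 hξ.1 w hw,
          mem_zeroFibre.1 h₀.1 w hw, sub_self]
      · rintro _ ⟨j, rfl⟩
        rw [SetLike.mem_coe, LinearMap.mem_ker, LinearMap.sub_apply, hξ.2 j, h₀.2 j, sub_self]
    exact sub_eq_zero.1 (hle hw)
  · intro h
    refine ⟨mem_zeroFibre.2 fun w hw => ?_, fun j => ?_⟩
    · rw [h w (Submodule.mem_sup_left hw), mem_zeroFibre.1 h₀.1 w hw]
    · rw [h _ (Submodule.mem_sup_right (Submodule.subset_span ⟨j, rfl⟩)), h₀.2 j]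

theorem exists_rep (p : HamRed χ 𝔪) : ∃ ξ : zeroFibre χ 𝔪, OrbitSpace.mk (unipotentGroup 𝔪) ξ = p :=
  OrbitSpace.mk_surjective p

/-- The W-algebra is the coordinate ring of the Hamiltonian reduction. -/
theorem exists_algEquiv_hamRedFunctions (F : SliceFamily χ 𝔪 y x) [FiniteDimensional ℂ 𝔤] :
    ∃ Θ : classicalW χ 𝔪 ≃ₐ[ℂ] hamRedFunctions χ 𝔪,
      ∀ X (hX : modI χ 𝔪 X ∈ classicalW χ 𝔪) (ξ : zeroFibre χ 𝔪),
        (Θ ⟨modI χ 𝔪 X, hX⟩ : _ → ℂ) (OrbitSpace.mk (unipotentGroup 𝔪) ξ) =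
          evalAt (ξ : Dual ℂ 𝔤) X := by
  choose rep hrep using exists_rep (χ := χ) (𝔪 := 𝔪)
  have hinv : ∀ X ∈ (kirillovKostant 𝔤).normalizer (shiftedElements χ 𝔪),
      ∀ ξ : zeroFibre χ 𝔪, evalAt (rep (OrbitSpace.mk (unipotentGroup 𝔪) ξ) : Dual ℂ 𝔤) X =
        evalAt (ξ : Dual ℂ 𝔤) X := by
    intro X hX ξ
    obtain ⟨g, hg⟩ := OrbitSpace.mk_eq_mk.1 (hrep (OrbitSpace.mk (unipotentGroup 𝔪) ξ))
    rw [← hg]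
    exact evalAt_smul_of_mem_normalizer F.character hX g.2 ξ.2
  obtain ⟨Θ, hΘ⟩ := exists_classicalW_algEquiv F.character (fun p => (rep p : Dual ℂ 𝔤))
    (fun p => (rep p).2) (hamRedFunctions χ 𝔪)
    (fun X hX => mem_polyFunctions.2 ⟨X, fun ξ => hinv X hX ξ⟩)
    (fun φ hφ => by
      obtain ⟨X, hX⟩ := mem_polyFunctions.1 hφ
      refine ⟨X, F.mem_normalizer_of_invariant ?_, ?_⟩
      · intro g hg ξ hξ
        rw [← hX ⟨ξ, hξ⟩, ← hX ⟨g • ξ, F.smul_mem hg hξ⟩]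
        exact congrArg φ (OrbitSpace.mk_eq_mk.2 ⟨⟨g, hg⟩, rfl⟩)
      · intro p
        rw [← hX]
        exact congrArg φ (hrep p).symm)
    (fun X hX h => mem_span_shiftedElements.2 fun ξ hξ => by
      rw [← hinv X hX ⟨ξ, hξ⟩]
      exact h _)
  exact ⟨Θ, fun X hX ξ => (hΘ X hX _).trans (hinv X ((modI_mem_classicalW F.character).1 hX) ξ)⟩

/-- The W-algebra is the coordinate ring of the slice. -/
theorem exists_algEquiv_polyFunctions (F : SliceFamily χ 𝔪 y x) [FiniteDimensional ℂ 𝔤] :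
    ∃ Θ : classicalW χ 𝔪 ≃ₐ[ℂ] polyFunctions (sliceSet χ 𝔪 x),
      ∀ X (hX : modI χ 𝔪 X ∈ classicalW χ 𝔪) (ξ : sliceSet χ 𝔪 x),
        (Θ ⟨modI χ 𝔪 X, hX⟩ : _ → ℂ) ξ = evalAt (ξ : Dual ℂ 𝔤) X :=
  exists_classicalW_algEquiv F.character (fun ξ : sliceSet χ 𝔪 x => (ξ : Dual ℂ 𝔤))
    (fun ξ => ξ.2.1) _ (fun X _ => mem_polyFunctions.2 ⟨X, fun _ => rfl⟩)
    (fun φ hφ => by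
      obtain ⟨X, hX⟩ := mem_polyFunctions.1 hφ
      obtain ⟨Y, hY, hXY⟩ := F.exists_projection X
      exact ⟨Y, hY, fun ξ => (hX ξ).trans (evalAt_eq_of_sub_mem ξ.2.2 hXY)⟩)
    (fun X hX h => F.mem_span_of_sliceSet hX fun ξ hξ => h ⟨ξ, hξ⟩)

theorem hasGeometricQuotient (F : SliceFamily χ 𝔪 y x) [FiniteDimensional ℂ 𝔤] :
    HasGeometricQuotient (unipotentGroup 𝔪) (zeroFibre χ 𝔪) (polyFunctions (zeroFibre χ 𝔪)) := by
  obtain ⟨Θ, hΘ⟩ := F.exists_algEquiv_hamRedFunctions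
  refine hasGeometricQuotient_of_slice F.isAffineVariety (fun g ξ hξ => F.smul_mem g.2 hξ)
    (fun ξ : sliceSet χ 𝔪 x => ⟨ξ, ξ.2.1⟩) F.bijective_mk ?_ ?_
  · intro a ha
    obtain ⟨X, hX⟩ := mem_polyFunctions.1 ha
    exact mem_polyFunctions.2 ⟨X, fun ξ => hX _⟩
  · intro b hb
    obtain ⟨X, hX⟩ := mem_polyFunctions.1 hb
    obtain ⟨Y, hY, hXY⟩ := F.exists_projection X
    refine ⟨_, (Θ ⟨modI χ 𝔪 Y, (modI_mem_classicalW F.character).2 hY⟩).2, fun ξ => ?_⟩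
    rw [hΘ, hX ξ]
    exact (evalAt_eq_of_sub_mem ξ.2.2 hXY).symm

end SliceFamily

end SliceFamilies

/-! ### Reduction in two stages -/

noncomputable section TwoStages

open KirillovKostant

/-- Lift of a function to the orbit space. -/
def OrbitSpace.lift {G : Type*} [Group G] {X : Type*} [MulAction G X] {Z : Set X} {β : Type*}
    (f : Z → β) (h : ∀ z z' : Z, OrbitSpace.mk G z = OrbitSpace.mk G z' → f z = f z') :
    OrbitSpace G Z → β :=
  Quotient.lift f fun z z' hz => h z z' (Quotient.sound hz)

/-- Both Poisson structures come from the coordinate rings, so it is enough that composition with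
`σ` corresponds to the Poisson map `Ψ`. -/
theorem isPoissonIso_transport {A A' X Y : Type*} [CommRing A] [Algebra ℂ A] [CommRing A']
    [Algebra ℂ A'] {RX : Subalgebra ℂ (X → ℂ)} {RY : Subalgebra ℂ (Y → ℂ)}
    (P : PoissonStructure A) (P' : PoissonStructure A') (Ψ : A' ≃ₐ[ℂ] A)
    (hΨ : ∀ a b, Ψ (P'.bracket a b) = P.bracket (Ψ a) (Ψ b))
    (Θ : A ≃ₐ[ℂ] RX) (Θ' : A' ≃ₐ[ℂ] RY) (σ : X ≃ Y)
    (h : ∀ a p, (Θ' a : Y → ℂ) (σ p) = (Θ (Ψ a) : X → ℂ) p) :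
    IsPoissonIso (P.transport Θ) (P'.transport Θ') σ := by
  have hcomp : ∀ a, (Θ' a : Y → ℂ) ∘ σ = Θ (Ψ a) := fun a => funext (h a)
  have hreg : ∀ φ : Y → ℂ, φ ∈ RY ↔ φ ∘ σ ∈ RX := by
    intro φ
    constructor
    · intro hφ
      obtain ⟨a, ha⟩ := Θ'.surjective ⟨φ, hφ⟩
      have h1 : (Θ' a : Y → ℂ) = φ := congrArg Subtype.val ha
      rw [← h1, hcomp]
      exact (Θ (Ψ a)).2
    · intro hφ
      obtain ⟨b, hb⟩ := Θ.surjective ⟨φ ∘ σ, hφ⟩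
      obtain ⟨a, rfl⟩ := Ψ.surjective b
      have h1 : (Θ (Ψ a) : X → ℂ) = φ ∘ σ := congrArg Subtype.val hb
      have h2 : (Θ' a : Y → ℂ) = φ := by
        funext q
        obtain ⟨p, rfl⟩ := σ.surjective q
        rw [h, h1]
        rfl
      rw [← h2]
      exact (Θ' a).2
  refine ⟨hreg, fun φ ψ p => ?_⟩
  obtain ⟨a, rfl⟩ := Θ'.surjective φ
  obtain ⟨b, rfl⟩ := Θ'.surjective ψ
  have ha : (⟨(Θ' a : Y → ℂ) ∘ σ, (hreg _).1 (Θ' a).2⟩ : RX) = Θ (Ψ a) := Subtype.ext (hcomp a)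
  have hb : (⟨(Θ' b : Y → ℂ) ∘ σ, (hreg _).1 (Θ' b).2⟩ : RX) = Θ (Ψ b) := Subtype.ext (hcomp b)
  rw [ha, hb]
  change (Θ' (P'.bracket (Θ'.symm (Θ' a)) (Θ'.symm (Θ' b))) : Y → ℂ) (σ p) =
    (Θ (P.bracket (Θ.symm (Θ (Ψ a))) (Θ.symm (Θ (Ψ b)))) : X → ℂ) p
  rw [h, hΨ]
  simp

/-- The isomorphism of algebras of functions induced by a bijection. -/
theorem exists_algEquiv_of_equiv {X Y : Type*} {RX : Subalgebra ℂ (X → ℂ)}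
    {RY : Subalgebra ℂ (Y → ℂ)} (σ : X ≃ Y) (h : ∀ φ : Y → ℂ, φ ∈ RY ↔ φ ∘ σ ∈ RX) :
    ∃ E : RX ≃ₐ[ℂ] RY, ∀ φ p, (E φ : Y → ℂ) (σ p) = (φ : X → ℂ) p := by
  have hmem : ∀ φ : RX, ((pullback σ.symm).comp RX.val) φ ∈ RY := by
    intro φ
    rw [h]
    have : ((pullback σ.symm).comp RX.val) φ ∘ σ = φ :=
      funext fun p => congrArg (φ : X → ℂ) (σ.symm_apply_apply p)
    rw [this]
    exact φ.2
  let E : RX →ₐ[ℂ] RY := ((pullback σ.symm).comp RX.val).codRestrict RY hmem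
  have hE : ∀ φ p, (E φ : Y → ℂ) (σ p) = (φ : X → ℂ) p :=
    fun φ p => congrArg (φ : X → ℂ) (σ.symm_apply_apply p)
  refine ⟨AlgEquiv.ofBijective E ⟨?_, ?_⟩, hE⟩
  · intro φ ψ hφψ
    apply Subtype.ext
    funext p
    rw [← hE, ← hE, hφψ]
  · intro φ
    refine ⟨⟨φ ∘ σ, (h φ).1 φ.2⟩, Subtype.ext (funext fun q => ?_)⟩
    obtain ⟨p, rfl⟩ := σ.surjective q
    exact hE _ p

variable {𝔤 : Type*} [LieRing 𝔤] [LieAlgebra ℂ 𝔤]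

/-- Compatible slice families for a reduction in two stages, by `𝔪₁` and then by `𝔪₀`. -/
structure TwoStage (χ₁ χ₂ : Dual ℂ 𝔤) (𝔪₁ 𝔪₂ 𝔪₀ : LieSubalgebra ℂ 𝔤) {d₁ d₂ : ℕ}
    (y₁ x₁ : Fin d₁ → 𝔤) (y₂ x₂ : Fin d₂ → 𝔤) : Prop where
  first : SliceFamily χ₁ 𝔪₁ y₁ x₁
  total : SliceFamily χ₂ 𝔪₂ y₂ x₂
  sup_eq : 𝔪₁.toSubmodule ⊔ 𝔪₀.toSubmodule = 𝔪₂.toSubmodule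
  ideal : ∀ a ∈ 𝔪₂, ∀ b ∈ 𝔪₁, ⁅a, b⁆ ∈ 𝔪₁
  agree : ∀ a ∈ 𝔪₁, χ₁ a = χ₂ a
  adapted : ∀ i, y₂ i ∈ 𝔪₁ ∨ y₂ i ∈ 𝔪₀

namespace TwoStage

variable {χ₁ χ₂ : Dual ℂ 𝔤} {𝔪₁ 𝔪₂ 𝔪₀ : LieSubalgebra ℂ 𝔤} {d₁ d₂ : ℕ}
  {y₁ x₁ : Fin d₁ → 𝔤} {y₂ x₂ : Fin d₂ → 𝔤}

theorem first_le (H : TwoStage χ₁ χ₂ 𝔪₁ 𝔪₂ 𝔪₀ y₁ x₁ y₂ x₂) :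
    𝔪₁.toSubmodule ≤ 𝔪₂.toSubmodule := H.sup_eq ▸ le_sup_left

theorem second_le (H : TwoStage χ₁ χ₂ 𝔪₁ 𝔪₂ 𝔪₀ y₁ x₁ y₂ x₂) :
    𝔪₀.toSubmodule ≤ 𝔪₂.toSubmodule := H.sup_eq ▸ le_sup_right

theorem exists_add (H : TwoStage χ₁ χ₂ 𝔪₁ 𝔪₂ 𝔪₀ y₁ x₁ y₂ x₂) {a : 𝔤} (ha : a ∈ 𝔪₂) :
    ∃ b ∈ 𝔪₁, ∃ c ∈ 𝔪₀, b + c = a := by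
  have ha' : a ∈ 𝔪₁.toSubmodule ⊔ 𝔪₀.toSubmodule := H.sup_eq ▸ ha
  exact Submodule.mem_sup.1 ha'

theorem apply_lie (H : TwoStage χ₁ χ₂ 𝔪₁ 𝔪₂ 𝔪₀ y₁ x₁ y₂ x₂) {a b : 𝔤} (ha : a ∈ 𝔪₂)
    (hb : b ∈ 𝔪₁) : χ₁ ⁅a, b⁆ = 0 := by
  rw [H.agree _ (H.ideal a ha b hb), H.total.character a ha b (H.first_le hb)]

theorem mem_zeroFibre_iff (H : TwoStage χ₁ χ₂ 𝔪₁ 𝔪₂ 𝔪₀ y₁ x₁ y₂ x₂) {ξ : Dual ℂ 𝔤} :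
    ξ ∈ zeroFibre χ₂ 𝔪₂ ↔ ξ ∈ zeroFibre χ₁ 𝔪₁ ∧ ∀ a ∈ 𝔪₀, ξ a = χ₂ a := by
  constructor
  · intro h
    rw [mem_zeroFibre] at h
    exact ⟨mem_zeroFibre.2 fun a ha => (h a (H.first_le ha)).trans (H.agree a ha).symm,
      fun a ha => h a (H.second_le ha)⟩
  · rintro ⟨h1, h0⟩
    rw [mem_zeroFibre] at h1 ⊢
    intro a ha
    obtain ⟨b, hb, c, hc, rfl⟩ := H.exists_add ha
    rw [map_add, map_add, h1 b hb, h0 c hc, H.agree b hb]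

theorem zeroFibre_subset (H : TwoStage χ₁ χ₂ 𝔪₁ 𝔪₂ 𝔪₀ y₁ x₁ y₂ x₂) :
    zeroFibre χ₂ 𝔪₂ ⊆ zeroFibre χ₁ 𝔪₁ := fun _ h => (H.mem_zeroFibre_iff.1 h).1

theorem span_le (H : TwoStage χ₁ χ₂ 𝔪₁ 𝔪₂ 𝔪₀ y₁ x₁ y₂ x₂) :
    Ideal.span (shiftedElements χ₁ 𝔪₁) ≤ Ideal.span (shiftedElements χ₂ 𝔪₂) := by
  refine Ideal.span_le.2 ?_
  rintro _ ⟨a, ha, rfl⟩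
  refine Ideal.subset_span ⟨a, H.first_le ha, ?_⟩
  rw [H.agree a ha]

/-- For `b ∈ 𝔪₁` the bracket `[b, a]` lies in `𝔪₁` and `χ₁` vanishes on it, so it is itself a
generator of `I₁`. -/
theorem generator_mem (H : TwoStage χ₁ χ₂ 𝔪₁ 𝔪₂ 𝔪₀ y₁ x₁ y₂ x₂) {a : 𝔤} (ha : a ∈ 𝔪₀)
    (c : ℂ) : SymmetricAlgebra.ι ℂ 𝔤 a - algebraMap ℂ _ c ∈
      (kirillovKostant 𝔤).normalizer (shiftedElements χ₁ 𝔪₁) := by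
  rw [mem_normalizer_shiftedElements]
  intro b hb
  rw [map_sub, hamVec_ι, Derivation.map_algebraMap, sub_zero]
  have h1 := H.ideal a (H.second_le ha) b hb
  have h2 := H.apply_lie (H.second_le ha) hb
  rw [← lie_skew]
  refine Ideal.subset_span ⟨-⁅a, b⁆, 𝔪₁.neg_mem h1, ?_⟩
  rw [map_neg χ₁, h2, neg_zero, map_zero, sub_zero]

/-- The class in the first W-algebra of an element of the normalizer. -/
def cls (H : TwoStage χ₁ χ₂ 𝔪₁ 𝔪₂ 𝔪₀ y₁ x₁ y₂ x₂) (X : SymmetricAlgebra ℂ 𝔤)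
    (hX : X ∈ (kirillovKostant 𝔤).normalizer (shiftedElements χ₁ 𝔪₁)) : classicalW χ₁ 𝔪₁ :=
  ⟨modI χ₁ 𝔪₁ X, (modI_mem_classicalW H.first.character).2 hX⟩

/-- The restriction of functions from the first W-algebra to the total zero fibre. -/
def toTotal (H : TwoStage χ₁ χ₂ 𝔪₁ 𝔪₂ 𝔪₀ y₁ x₁ y₂ x₂) :
    classicalW χ₁ 𝔪₁ →ₐ[ℂ] SymmetricAlgebra ℂ 𝔤 ⧸ Ideal.span (shiftedElements χ₂ 𝔪₂) :=
  (Ideal.Quotient.factorₐ ℂ H.span_le).comp (classicalW χ₁ 𝔪₁).val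

theorem toTotal_mk (H : TwoStage χ₁ χ₂ 𝔪₁ 𝔪₂ 𝔪₀ y₁ x₁ y₂ x₂) (X : SymmetricAlgebra ℂ 𝔤)
    (hX : modI χ₁ 𝔪₁ X ∈ classicalW χ₁ 𝔪₁) : H.toTotal ⟨modI χ₁ 𝔪₁ X, hX⟩ = modI χ₂ 𝔪₂ X :=
  rfl

theorem toTotal_eq_zero (H : TwoStage χ₁ χ₂ 𝔪₁ 𝔪₂ 𝔪₀ y₁ x₁ y₂ x₂) {w : classicalW χ₁ 𝔪₁}
    (hw : w ∈ Ideal.span (stageElements χ₁ χ₂ 𝔪₁ 𝔪₀)) : H.toTotal w = 0 := by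
  have : Ideal.span (stageElements χ₁ χ₂ 𝔪₁ 𝔪₀) ≤ RingHom.ker H.toTotal := by
    refine Ideal.span_le.2 ?_
    rintro ⟨w, hw⟩ ⟨a, ha, rfl⟩
    rw [SetLike.mem_coe, RingHom.mem_ker, toTotal_mk]
    exact Ideal.Quotient.eq_zero_iff_mem.2 (Ideal.subset_span ⟨a, H.second_le ha, rfl⟩)
  exact this hw

/-- An element of `I₂` is a combination of generators with arbitrary coefficients, whereas `I₀`
admits only invariant ones. Replacing each coefficient by its projection costs an error that
vanishes on the first slice; the `𝔪₁`-parts of the generators go into `I₁`. -/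
theorem exists_stage_approximation (H : TwoStage χ₁ χ₂ 𝔪₁ 𝔪₂ 𝔪₀ y₁ x₁ y₂ x₂)
    {X : SymmetricAlgebra ℂ 𝔤} (hX : X ∈ Ideal.span (shiftedElements χ₂ 𝔪₂)) :
    ∃ (Y : SymmetricAlgebra ℂ 𝔤)
      (hY : Y ∈ (kirillovKostant 𝔤).normalizer (shiftedElements χ₁ 𝔪₁)),
      H.cls Y hY ∈ Ideal.span (stageElements χ₁ χ₂ 𝔪₁ 𝔪₀) ∧
      X - Y ∈ Ideal.span (shiftedElements χ₁ 𝔪₁) ⊔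
        Ideal.span (Set.range fun j => SymmetricAlgebra.ι ℂ 𝔤 (x₁ j)) := by
  induction hX using Submodule.span_induction with
  | mem t ht =>
    obtain ⟨a, ha, rfl⟩ := ht
    obtain ⟨b, hb, c, hc, rfl⟩ := H.exists_add ha
    refine ⟨_, H.generator_mem hc (χ₂ c), Ideal.subset_span ⟨c, hc, rfl⟩,
      Ideal.mem_sup_left (Ideal.subset_span ⟨b, hb, ?_⟩)⟩
    rw [H.agree b hb, map_add, map_add χ₂, map_add (algebraMap ℂ _)]
    ring
  | zero =>
    refine ⟨0, zero_mem _, ?_, by simp⟩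
    have : H.cls 0 (zero_mem _) = 0 := Subtype.ext (map_zero _)
    rw [this]
    exact Ideal.zero_mem _
  | add a b _ _ ha hb =>
    obtain ⟨Y, hY, h1, h2⟩ := ha
    obtain ⟨Y', hY', h1', h2'⟩ := hb
    refine ⟨Y + Y', add_mem hY hY', ?_, ?_⟩
    · have : H.cls (Y + Y') (add_mem hY hY') = H.cls Y hY + H.cls Y' hY' :=
        Subtype.ext (map_add _ _ _)
      rw [this]
      exact Ideal.add_mem _ h1 h1'
    · rw [add_sub_add_comm]
      exact Ideal.add_mem _ h2 h2'
  | smul a b _ hb =>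
    obtain ⟨Y, hY, h1, h2⟩ := hb
    obtain ⟨a', ha', haa'⟩ := H.first.exists_projection a
    refine ⟨a' * Y, mul_mem ha' hY, ?_, ?_⟩
    · have : H.cls (a' * Y) (mul_mem ha' hY) = H.cls a' ha' * H.cls Y hY :=
        Subtype.ext (map_mul _ _ _)
      rw [this]
      exact Ideal.mul_mem_left _ _ h1
    · have : a • b - a' * Y = a * (b - Y) + Y * (a - a') := by
        rw [smul_eq_mul]
        ring
      rw [this]
      exact Ideal.add_mem _ (Ideal.mul_mem_left _ _ h2)
        (Ideal.mul_mem_left _ _ (Ideal.mem_sup_right haa'))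

theorem bracket_cls (H : TwoStage χ₁ χ₂ 𝔪₁ 𝔪₂ 𝔪₀ y₁ x₁ y₂ x₂) {X Y : SymmetricAlgebra ℂ 𝔤}
    (hX : X ∈ (kirillovKostant 𝔤).normalizer (shiftedElements χ₁ 𝔪₁))
    (hY : Y ∈ (kirillovKostant 𝔤).normalizer (shiftedElements χ₁ 𝔪₁)) :
    (classicalWPoisson χ₁ 𝔪₁).bracket (H.cls X hX) (H.cls Y hY) =
      H.cls ((kirillovKostant 𝔤).bracket X Y)
        (PoissonStructure.bracket_mem_normalizer hX hY) :=
  Subtype.ext ((kirillovKostant 𝔤).reduced_bracket_mk (shiftedElements χ₁ 𝔪₁) hX rfl rfl)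

/-- The functions in the first W-algebra that vanish on the total zero fibre form the ideal of
the second stage. -/
theorem cls_mem_span [FiniteDimensional ℂ 𝔤]
    (H : TwoStage χ₁ χ₂ 𝔪₁ 𝔪₂ 𝔪₀ y₁ x₁ y₂ x₂) {X : SymmetricAlgebra ℂ 𝔤}
    (hX : X ∈ (kirillovKostant 𝔤).normalizer (shiftedElements χ₁ 𝔪₁))
    (hX₂ : X ∈ Ideal.span (shiftedElements χ₂ 𝔪₂)) :
    H.cls X hX ∈ Ideal.span (stageElements χ₁ χ₂ 𝔪₁ 𝔪₀) := by
  obtain ⟨Y, hY, h1, h2⟩ := H.exists_stage_approximation hX₂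
  -- The difference is invariant for the first stage and vanishes on the first slice.
  have h3 : X - Y ∈ Ideal.span (shiftedElements χ₁ 𝔪₁) := by
    refine H.first.mem_span_of_sliceSet (sub_mem hX hY) fun ξ hξ => ?_
    obtain ⟨a, ha, b, hb, hab⟩ := Submodule.mem_sup.1 h2
    rw [← hab, map_add, evalAt_eq_zero_of_mem_span hξ.1 ha, zero_add]
    rw [SliceFamily.evalAt_eq_of_sub_mem (Y := 0) hξ.2 (by simpa using hb), map_zero]
  have h4 : H.cls X hX = H.cls Y hY := Subtype.ext (Ideal.Quotient.eq.2 h3)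
  rw [h4]
  exact h1

/-- `Y` is the invariant projection of `X` for the first stage. A point of `μ₂⁻¹(0)` is carried into
the first slice by an element of `M₁ ⊆ M₂`; this changes neither the value of `X` nor that of `Y`,
and the two agree on the slice. -/
theorem exists_lift [FiniteDimensional ℂ 𝔤]
    (H : TwoStage χ₁ χ₂ 𝔪₁ 𝔪₂ 𝔪₀ y₁ x₁ y₂ x₂) {X : SymmetricAlgebra ℂ 𝔤}
    (hX : X ∈ (kirillovKostant 𝔤).normalizer (shiftedElements χ₂ 𝔪₂)) :
    ∃ Y ∈ (kirillovKostant 𝔤).normalizer (shiftedElements χ₁ 𝔪₁),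
      X - Y ∈ Ideal.span (shiftedElements χ₂ 𝔪₂) := by
  obtain ⟨Y, hY, hXY⟩ := H.first.exists_projection X
  refine ⟨Y, hY, mem_span_shiftedElements.2 fun ξ hξ => ?_⟩
  have hξ₁ := H.zeroFibre_subset hξ
  obtain ⟨g, -, hg, hgξ⟩ := H.first.exists_smul_mem_sliceSet ⊤
    (fun i => ⟨𝔪₁, H.first.y_mem i, le_top⟩) hξ₁
  rw [map_sub, ← evalAt_smul_of_mem_normalizer H.first.character hY hg hξ₁,
    ← evalAt_smul_of_mem_normalizer H.total.character hX (unipotentGroup_mono H.first_le hg) hξ,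
    SliceFamily.evalAt_eq_of_sub_mem hgξ.2 hXY, sub_self]

/-- The normalizer of the second stage consists of the functions in the total normalizer. -/
theorem cls_mem_normalizer_iff [FiniteDimensional ℂ 𝔤]
    (H : TwoStage χ₁ χ₂ 𝔪₁ 𝔪₂ 𝔪₀ y₁ x₁ y₂ x₂)
    {X : SymmetricAlgebra ℂ 𝔤}
    (hX : X ∈ (kirillovKostant 𝔤).normalizer (shiftedElements χ₁ 𝔪₁)) :
    H.cls X hX ∈ (classicalWPoisson χ₁ 𝔪₁).normalizer (stageElements χ₁ χ₂ 𝔪₁ 𝔪₀) ↔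
      X ∈ (kirillovKostant 𝔤).normalizer (shiftedElements χ₂ 𝔪₂) := by
  constructor
  · intro h
    rw [mem_normalizer_shiftedElements]
    intro a ha
    obtain ⟨b, hb, c, hc, rfl⟩ := H.exists_add ha
    rw [hamVec_add, Derivation.add_apply]
    refine Ideal.add_mem _ (H.span_le (mem_normalizer_shiftedElements.1 hX b hb)) ?_
    -- The `𝔪₁`-part of the condition came from the first normalizer; the `𝔪₀`-part is the
    -- second-stage condition restricted to the total fibre.
    have h1 := h (H.cls _ (H.generator_mem hc (χ₂ c))) ⟨c, hc, rfl⟩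
    rw [H.bracket_cls] at h1
    have h2 : modI χ₂ 𝔪₂ _ = 0 := H.toTotal_eq_zero h1
    rw [bracket_ι_sub] at h2
    exact Ideal.Quotient.eq_zero_iff_mem.1 h2
  · rintro h ⟨w, hw⟩ ⟨c, hc, rfl⟩
    have h1 := H.bracket_cls (H.generator_mem hc (χ₂ c)) hX
    change (classicalWPoisson χ₁ 𝔪₁).bracket (H.cls _ (H.generator_mem hc (χ₂ c))) _ ∈ _
    rw [h1]
    refine H.cls_mem_span _ ?_
    rw [bracket_ι_sub]
    exact mem_normalizer_shiftedElements.1 h c (H.second_le hc)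

theorem exists_rep_stageW [FiniteDimensional ℂ 𝔤]
    (H : TwoStage χ₁ χ₂ 𝔪₁ 𝔪₂ 𝔪₀ y₁ x₁ y₂ x₂)
    {a : classicalW χ₁ 𝔪₁ ⧸ Ideal.span (stageElements χ₁ χ₂ 𝔪₁ 𝔪₀)}
    (ha : a ∈ stageW χ₁ χ₂ 𝔪₁ 𝔪₀) :
    ∃ (X : SymmetricAlgebra ℂ 𝔤)
      (hX : X ∈ (kirillovKostant 𝔤).normalizer (shiftedElements χ₁ 𝔪₁)),
      X ∈ (kirillovKostant 𝔤).normalizer (shiftedElements χ₂ 𝔪₂) ∧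
      modI₀ χ₁ χ₂ 𝔪₁ 𝔪₀ (H.cls X hX) = a := by
  obtain ⟨⟨w, hw⟩, hwn, rfl⟩ := ha
  obtain ⟨X, rfl⟩ := Ideal.Quotient.mk_surjective w
  have hX := (modI_mem_classicalW H.first.character).1 hw
  exact ⟨X, hX, (H.cls_mem_normalizer_iff hX).1 hwn, rfl⟩

/-- The map induced by restriction of functions on the quotient of the first W-algebra. -/
def stageToTotal (H : TwoStage χ₁ χ₂ 𝔪₁ 𝔪₂ 𝔪₀ y₁ x₁ y₂ x₂) :
    (classicalW χ₁ 𝔪₁ ⧸ Ideal.span (stageElements χ₁ χ₂ 𝔪₁ 𝔪₀)) →ₐ[ℂ]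
      SymmetricAlgebra ℂ 𝔤 ⧸ Ideal.span (shiftedElements χ₂ 𝔪₂) :=
  Ideal.Quotient.liftₐ _ H.toTotal fun _ hw => H.toTotal_eq_zero hw

theorem stageToTotal_mk (H : TwoStage χ₁ χ₂ 𝔪₁ 𝔪₂ 𝔪₀ y₁ x₁ y₂ x₂)
    (X : SymmetricAlgebra ℂ 𝔤) (hX : modI χ₁ 𝔪₁ X ∈ classicalW χ₁ 𝔪₁) :
    H.stageToTotal (modI₀ χ₁ χ₂ 𝔪₁ 𝔪₀ ⟨modI χ₁ 𝔪₁ X, hX⟩) = modI χ₂ 𝔪₂ X := by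
  rw [← H.toTotal_mk X hX]
  exact Ideal.Quotient.liftₐ_apply _ _ _ _

theorem stageToTotal_cls (H : TwoStage χ₁ χ₂ 𝔪₁ 𝔪₂ 𝔪₀ y₁ x₁ y₂ x₂)
    (X : SymmetricAlgebra ℂ 𝔤)
    (hX : X ∈ (kirillovKostant 𝔤).normalizer (shiftedElements χ₁ 𝔪₁)) :
    H.stageToTotal (modI₀ χ₁ χ₂ 𝔪₁ 𝔪₀ (H.cls X hX)) = modI χ₂ 𝔪₂ X :=
  H.stageToTotal_mk X _

theorem stageToTotal_mem [FiniteDimensional ℂ 𝔤]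
    (H : TwoStage χ₁ χ₂ 𝔪₁ 𝔪₂ 𝔪₀ y₁ x₁ y₂ x₂) (a : stageW χ₁ χ₂ 𝔪₁ 𝔪₀) :
    (H.stageToTotal.comp (stageW χ₁ χ₂ 𝔪₁ 𝔪₀).val) a ∈ classicalW χ₂ 𝔪₂ := by
  obtain ⟨a, ha⟩ := a
  obtain ⟨X, hX, hX₂, rfl⟩ := H.exists_rep_stageW ha
  have h : (H.stageToTotal.comp (stageW χ₁ χ₂ 𝔪₁ 𝔪₀).val)
      ⟨modI₀ χ₁ χ₂ 𝔪₁ 𝔪₀ (H.cls X hX), ha⟩ = modI χ₂ 𝔪₂ X := H.stageToTotal_cls X hX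
  rw [h]
  exact (modI_mem_classicalW H.total.character).2 hX₂

/-- The comparison map from the two-stage reduction to the one-stage reduction. -/
def comparison [FiniteDimensional ℂ 𝔤] (H : TwoStage χ₁ χ₂ 𝔪₁ 𝔪₂ 𝔪₀ y₁ x₁ y₂ x₂) :
    stageW χ₁ χ₂ 𝔪₁ 𝔪₀ →ₐ[ℂ] classicalW χ₂ 𝔪₂ :=
  (H.stageToTotal.comp (stageW χ₁ χ₂ 𝔪₁ 𝔪₀).val).codRestrict _ H.stageToTotal_mem

theorem coe_comparison [FiniteDimensional ℂ 𝔤] (H : TwoStage χ₁ χ₂ 𝔪₁ 𝔪₂ 𝔪₀ y₁ x₁ y₂ x₂)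
    (a : stageW χ₁ χ₂ 𝔪₁ 𝔪₀) :
    (H.comparison a : _ ⧸ Ideal.span (shiftedElements χ₂ 𝔪₂)) = H.stageToTotal a := rfl

/-- Injectivity is `cls_mem_span`. Surjectivity is `exists_lift`: the lift differs from the given
element by `I₂`, hence stays in the second normalizer. -/
theorem comparison_bijective [FiniteDimensional ℂ 𝔤]
    (H : TwoStage χ₁ χ₂ 𝔪₁ 𝔪₂ 𝔪₀ y₁ x₁ y₂ x₂) : Function.Bijective H.comparison := by
  constructor
  · rw [injective_iff_map_eq_zero]
    rintro ⟨a, ha⟩ h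
    obtain ⟨X, hX, hX₂, rfl⟩ := H.exists_rep_stageW ha
    have h1 : H.stageToTotal (modI₀ χ₁ χ₂ 𝔪₁ 𝔪₀ (H.cls X hX)) = 0 := congrArg Subtype.val h
    rw [stageToTotal_cls] at h1
    exact Subtype.ext (Ideal.Quotient.eq_zero_iff_mem.2
      (H.cls_mem_span hX (Ideal.Quotient.eq_zero_iff_mem.1 h1)))
  · rintro ⟨b, hb⟩
    obtain ⟨X, rfl⟩ := Ideal.Quotient.mk_surjective b
    have hX := (modI_mem_classicalW H.total.character).1 hb
    obtain ⟨Y, hY, hXY⟩ := H.exists_lift hX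
    have hY₂ : Y ∈ (kirillovKostant 𝔤).normalizer (shiftedElements χ₂ 𝔪₂) := by
      have := sub_mem hX (span_le_normalizer H.total.character hXY)
      simpa using this
    refine ⟨⟨modI₀ χ₁ χ₂ 𝔪₁ 𝔪₀ (H.cls Y hY), ⟨_, (H.cls_mem_normalizer_iff hY).2 hY₂, rfl⟩⟩,
      Subtype.ext ?_⟩
    rw [coe_comparison, stageToTotal_cls]
    exact (Ideal.Quotient.eq.2 hXY).symm

theorem coe_stageWPoisson_bracket {w w' : classicalW χ₁ 𝔪₁}
    (hw : w ∈ (classicalWPoisson χ₁ 𝔪₁).normalizer (stageElements χ₁ χ₂ 𝔪₁ 𝔪₀))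
    {a b : stageW χ₁ χ₂ 𝔪₁ 𝔪₀} (ha : modI₀ χ₁ χ₂ 𝔪₁ 𝔪₀ w = a) (hb : modI₀ χ₁ χ₂ 𝔪₁ 𝔪₀ w' = b) :
    ((stageWPoisson χ₁ χ₂ 𝔪₁ 𝔪₀).bracket a b : _ ⧸ Ideal.span (stageElements χ₁ χ₂ 𝔪₁ 𝔪₀)) =
      modI₀ χ₁ χ₂ 𝔪₁ 𝔪₀ ((classicalWPoisson χ₁ 𝔪₁).bracket w w') :=
  (classicalWPoisson χ₁ 𝔪₁).reduced_bracket_mk (stageElements χ₁ χ₂ 𝔪₁ 𝔪₀) hw ha hb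

theorem coe_classicalWPoisson_bracket {X Y : SymmetricAlgebra ℂ 𝔤}
    (hX : X ∈ (kirillovKostant 𝔤).normalizer (shiftedElements χ₂ 𝔪₂))
    {a b : classicalW χ₂ 𝔪₂} (ha : modI χ₂ 𝔪₂ X = a) (hb : modI χ₂ 𝔪₂ Y = b) :
    ((classicalWPoisson χ₂ 𝔪₂).bracket a b : _ ⧸ Ideal.span (shiftedElements χ₂ 𝔪₂)) =
      modI χ₂ 𝔪₂ ((kirillovKostant 𝔤).bracket X Y) :=
  (kirillovKostant 𝔤).reduced_bracket_mk (shiftedElements χ₂ 𝔪₂) hX ha hb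

/-- Both brackets are computed by the Kirillov-Kostant bracket of the same representatives. -/
theorem map_bracket_of_rep [FiniteDimensional ℂ 𝔤]
    (H : TwoStage χ₁ χ₂ 𝔪₁ 𝔪₂ 𝔪₀ y₁ x₁ y₂ x₂)
    {Ψ : stageW χ₁ χ₂ 𝔪₁ 𝔪₀ →ₐ[ℂ] classicalW χ₂ 𝔪₂}
    (hΨ : ∀ a, (Ψ a : _ ⧸ Ideal.span (shiftedElements χ₂ 𝔪₂)) = H.stageToTotal a)
    {a b : stageW χ₁ χ₂ 𝔪₁ 𝔪₀} {X Y : SymmetricAlgebra ℂ 𝔤}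
    (hX : X ∈ (kirillovKostant 𝔤).normalizer (shiftedElements χ₁ 𝔪₁))
    (hY : Y ∈ (kirillovKostant 𝔤).normalizer (shiftedElements χ₁ 𝔪₁))
    (hX₂ : X ∈ (kirillovKostant 𝔤).normalizer (shiftedElements χ₂ 𝔪₂))
    (ha : modI₀ χ₁ χ₂ 𝔪₁ 𝔪₀ (H.cls X hX) = a) (hb : modI₀ χ₁ χ₂ 𝔪₁ 𝔪₀ (H.cls Y hY) = b) :
    Ψ ((stageWPoisson χ₁ χ₂ 𝔪₁ 𝔪₀).bracket a b) =
      (classicalWPoisson χ₂ 𝔪₂).bracket (Ψ a) (Ψ b) := by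
  apply Subtype.ext
  have hXa : modI χ₂ 𝔪₂ X = Ψ a := by
    rw [hΨ, ← ha, stageToTotal_cls]
  have hYb : modI χ₂ 𝔪₂ Y = Ψ b := by
    rw [hΨ, ← hb, stageToTotal_cls]
  rw [coe_classicalWPoisson_bracket hX₂ hXa hYb, hΨ,
    coe_stageWPoisson_bracket ((H.cls_mem_normalizer_iff hX).2 hX₂) ha hb, H.bracket_cls,
    stageToTotal_cls]

theorem map_bracket_of_coe_eq [FiniteDimensional ℂ 𝔤]
    (H : TwoStage χ₁ χ₂ 𝔪₁ 𝔪₂ 𝔪₀ y₁ x₁ y₂ x₂)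
    {Ψ : stageW χ₁ χ₂ 𝔪₁ 𝔪₀ →ₐ[ℂ] classicalW χ₂ 𝔪₂}
    (hΨ : ∀ a, (Ψ a : _ ⧸ Ideal.span (shiftedElements χ₂ 𝔪₂)) = H.stageToTotal a)
    (a b : stageW χ₁ χ₂ 𝔪₁ 𝔪₀) :
    Ψ ((stageWPoisson χ₁ χ₂ 𝔪₁ 𝔪₀).bracket a b) =
      (classicalWPoisson χ₂ 𝔪₂).bracket (Ψ a) (Ψ b) :=
  (H.exists_rep_stageW a.2).elim fun _ hX => hX.elim fun hX hX' =>
    (H.exists_rep_stageW b.2).elim fun _ hY => hY.elim fun hY hY' =>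
      H.map_bracket_of_rep hΨ hX hY hX'.1 hX'.2 hY'.2

/-- Reduction in stages for the W-algebras. -/
theorem exists_algEquiv_stageW [FiniteDimensional ℂ 𝔤]
    (H : TwoStage χ₁ χ₂ 𝔪₁ 𝔪₂ 𝔪₀ y₁ x₁ y₂ x₂) :
    ∃ Ψ : stageW χ₁ χ₂ 𝔪₁ 𝔪₀ ≃ₐ[ℂ] classicalW χ₂ 𝔪₂,
      (∀ a b, Ψ ((stageWPoisson χ₁ χ₂ 𝔪₁ 𝔪₀).bracket a b) =
        (classicalWPoisson χ₂ 𝔪₂).bracket (Ψ a) (Ψ b)) ∧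
      (∀ (X : SymmetricAlgebra ℂ 𝔤) (hX₁ : modI χ₁ 𝔪₁ X ∈ classicalW χ₁ 𝔪₁)
        (hX₀ : modI₀ χ₁ χ₂ 𝔪₁ 𝔪₀ ⟨modI χ₁ 𝔪₁ X, hX₁⟩ ∈ stageW χ₁ χ₂ 𝔪₁ 𝔪₀),
        (Ψ ⟨modI₀ χ₁ χ₂ 𝔪₁ 𝔪₀ ⟨modI χ₁ 𝔪₁ X, hX₁⟩, hX₀⟩ :
          _ ⧸ Ideal.span (shiftedElements χ₂ 𝔪₂)) = modI χ₂ 𝔪₂ X) :=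
  ⟨AlgEquiv.ofBijective H.comparison H.comparison_bijective,
    H.map_bracket_of_coe_eq H.coe_comparison,
    fun X hX₁ _ => H.stageToTotal_mk X hX₁⟩

end TwoStage

end TwoStages

/-! ### The geometry of the reduction in two stages -/

noncomputable section TwoStageGeometry

variable {𝔤 : Type*} [LieRing 𝔤] [LieAlgebra ℂ 𝔤]

namespace TwoStage

variable {χ₁ χ₂ : Dual ℂ 𝔤} {𝔪₁ 𝔪₂ 𝔪₀ : LieSubalgebra ℂ 𝔤} {d₁ d₂ : ℕ}
  {y₁ x₁ : Fin d₁ → 𝔤} {y₂ x₂ : Fin d₂ → 𝔤}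

theorem second_smul_mem (H : TwoStage χ₁ χ₂ 𝔪₁ 𝔪₂ 𝔪₀ y₁ x₁ y₂ x₂) {g : 𝔤 ≃ₗ[ℂ] 𝔤}
    (hg : g ∈ unipotentGroup 𝔪₀) {ξ : Dual ℂ 𝔤} (hξ : ξ ∈ zeroFibre χ₁ 𝔪₁) :
    g • ξ ∈ zeroFibre χ₁ 𝔪₁ :=
  smul_mem_zeroFibre (fun a ha b hb => H.ideal a (H.second_le ha) b hb)
    (fun _ ha _ hb => H.apply_lie (H.second_le ha) hb) hg hξ

/-- The action of the second group on the first reduction. -/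
@[reducible]
def secondAction (H : TwoStage χ₁ χ₂ 𝔪₁ 𝔪₂ 𝔪₀ y₁ x₁ y₂ x₂) :
    MulAction (unipotentGroup 𝔪₀) (HamRed χ₁ 𝔪₁) where
  smul g := OrbitSpace.lift
    (fun ξ => OrbitSpace.mk (unipotentGroup 𝔪₁)
      ⟨(g : 𝔤 ≃ₗ[ℂ] 𝔤) • (ξ : Dual ℂ 𝔤), H.second_smul_mem g.2 ξ.2⟩)
    (fun ξ ξ' h => by
      -- The action descends to `M₁`-orbits because `M₀` normalizes `M₁`.
      obtain ⟨u, hu⟩ := OrbitSpace.mk_eq_mk.1 h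
      refine OrbitSpace.mk_eq_mk.2 ⟨⟨(g : 𝔤 ≃ₗ[ℂ] 𝔤) * u * (g : 𝔤 ≃ₗ[ℂ] 𝔤)⁻¹,
        unipotentGroup_conj_mem (fun a ha b hb => H.ideal a (H.second_le ha) b hb) g.2 u.2⟩, ?_⟩
      change ((g : 𝔤 ≃ₗ[ℂ] 𝔤) * u * (g : 𝔤 ≃ₗ[ℂ] 𝔤)⁻¹) • (g : 𝔤 ≃ₗ[ℂ] 𝔤) • (ξ' : Dual ℂ 𝔤) =
        (g : 𝔤 ≃ₗ[ℂ] 𝔤) • (ξ : Dual ℂ 𝔤)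
      rw [← hu, smul_smul, inv_mul_cancel_right, mul_smul]
      rfl)
  one_smul p := by
    obtain ⟨ξ, rfl⟩ := OrbitSpace.mk_surjective p
    exact congrArg (OrbitSpace.mk _) (Subtype.ext (one_smul _ (ξ : Dual ℂ 𝔤)))
  mul_smul g g' p := by
    obtain ⟨ξ, rfl⟩ := OrbitSpace.mk_surjective p
    exact congrArg (OrbitSpace.mk _) (Subtype.ext
      (mul_smul (g : 𝔤 ≃ₗ[ℂ] 𝔤) (g' : 𝔤 ≃ₗ[ℂ] 𝔤) (ξ : Dual ℂ 𝔤)))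

/-- The moment map of the second stage. -/
def secondMoment (H : TwoStage χ₁ χ₂ 𝔪₁ 𝔪₂ 𝔪₀ y₁ x₁ y₂ x₂) : HamRed χ₁ 𝔪₁ → Dual ℂ 𝔪₀ :=
  OrbitSpace.lift (fun ξ => momentMap χ₂ 𝔪₀ ξ) fun ξ ξ' h => by
    obtain ⟨u, hu⟩ := OrbitSpace.mk_eq_mk.1 h
    have hξ' := mem_zeroFibre.1 ξ'.2
    -- Since `[𝔪₁, 𝔪₂] ⊆ 𝔪₁` and `χ₁` kills these brackets, `M₁` preserves the restriction to `𝔪₂ ⊇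
    -- 𝔪₀` of a point of the fibre.
    have hlie : ∀ a ∈ 𝔪₁, ∀ b ∈ 𝔪₂.toSubmodule, ⁅a, b⁆ ∈ 𝔪₁ := fun a ha b hb => by
      rw [← lie_skew]
      exact 𝔪₁.neg_mem (H.ideal b hb a ha)
    ext a
    have h1 := unipotentGroup_apply_mem (𝔪 := 𝔪₁) (W := 𝔪₂.toSubmodule) (ξ := ξ')
      (fun a ha b hb => H.first_le (hlie a ha b hb))
      (fun a ha b hb => by
        rw [hξ' _ (hlie a ha b hb), ← lie_skew, map_neg, H.apply_lie hb ha, neg_zero])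
      (inv_mem u.2) a (H.second_le a.2)
    change (ξ : Dual ℂ 𝔤) a - χ₂ a = (ξ' : Dual ℂ 𝔤) a - χ₂ a
    rw [← hu, ← h1.2]
    rfl

theorem mk_mem_secondFibre (H : TwoStage χ₁ χ₂ 𝔪₁ 𝔪₂ 𝔪₀ y₁ x₁ y₂ x₂)
    (ξ : zeroFibre χ₁ 𝔪₁) :
    OrbitSpace.mk (unipotentGroup 𝔪₁) ξ ∈ H.secondMoment ⁻¹' {0} ↔
      (ξ : Dual ℂ 𝔤) ∈ zeroFibre χ₂ 𝔪₂ := by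
  rw [H.mem_zeroFibre_iff]
  change (ξ : Dual ℂ 𝔤) ∈ zeroFibre χ₂ 𝔪₀ ↔ _
  rw [mem_zeroFibre]
  exact ⟨fun h => ⟨ξ.2, h⟩, fun h => h.2⟩

/-- The class in the fibre of the second moment map of a point of the total zero fibre. -/
def fibrePoint (H : TwoStage χ₁ χ₂ 𝔪₁ 𝔪₂ 𝔪₀ y₁ x₁ y₂ x₂) (ξ : zeroFibre χ₂ 𝔪₂) :
    (H.secondMoment ⁻¹' {0} : Set (HamRed χ₁ 𝔪₁)) :=
  ⟨OrbitSpace.mk (unipotentGroup 𝔪₁) ⟨ξ, H.zeroFibre_subset ξ.2⟩,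
    (H.mk_mem_secondFibre _).2 ξ.2⟩

theorem fibrePoint_surjective (H : TwoStage χ₁ χ₂ 𝔪₁ 𝔪₂ 𝔪₀ y₁ x₁ y₂ x₂) :
    Function.Surjective H.fibrePoint := by
  rintro ⟨p, hp⟩
  obtain ⟨ξ, rfl⟩ := OrbitSpace.mk_surjective p
  exact ⟨⟨ξ, (H.mk_mem_secondFibre ξ).1 hp⟩, rfl⟩

/-- The space of orbits of the second stage. -/
abbrev SecondRed (H : TwoStage χ₁ χ₂ 𝔪₁ 𝔪₂ 𝔪₀ y₁ x₁ y₂ x₂) : Type _ :=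
  letI := H.secondAction
  OrbitSpace (unipotentGroup 𝔪₀) (H.secondMoment ⁻¹' {0})

/-- The class in the second reduction of a point of the total zero fibre. -/
def secondMk (H : TwoStage χ₁ χ₂ 𝔪₁ 𝔪₂ 𝔪₀ y₁ x₁ y₂ x₂) (ξ : zeroFibre χ₂ 𝔪₂) :
    H.SecondRed :=
  letI := H.secondAction
  OrbitSpace.mk (unipotentGroup 𝔪₀) (H.fibrePoint ξ)

theorem secondMk_surjective (H : TwoStage χ₁ χ₂ 𝔪₁ 𝔪₂ 𝔪₀ y₁ x₁ y₂ x₂) :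
    Function.Surjective H.secondMk := by
  let _ := H.secondAction
  intro p
  obtain ⟨q, rfl⟩ := OrbitSpace.mk_surjective p
  obtain ⟨ξ, rfl⟩ := H.fibrePoint_surjective q
  exact ⟨ξ, rfl⟩

theorem exists_smul_of_secondMk_eq (H : TwoStage χ₁ χ₂ 𝔪₁ 𝔪₂ 𝔪₀ y₁ x₁ y₂ x₂)
    {ξ ξ' : zeroFibre χ₂ 𝔪₂} (h : H.secondMk ξ = H.secondMk ξ') :
    ∃ g ∈ unipotentGroup 𝔪₂, g • (ξ' : Dual ℂ 𝔤) = ξ := by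
  let _ := H.secondAction
  obtain ⟨g, hg⟩ := OrbitSpace.mk_eq_mk.1 h
  obtain ⟨u, hu⟩ := OrbitSpace.mk_eq_mk.1 hg
  refine ⟨(u : 𝔤 ≃ₗ[ℂ] 𝔤)⁻¹ * g, mul_mem (inv_mem (unipotentGroup_mono H.first_le u.2))
    (unipotentGroup_mono H.second_le g.2), ?_⟩
  rw [mul_smul, inv_smul_eq_iff]
  exact hu.symm

theorem secondMk_smul_first (H : TwoStage χ₁ χ₂ 𝔪₁ 𝔪₂ 𝔪₀ y₁ x₁ y₂ x₂)
    {ξ ξ' : zeroFibre χ₂ 𝔪₂} {g : 𝔤 ≃ₗ[ℂ] 𝔤} (hg : g ∈ unipotentGroup 𝔪₁)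
    (h : g • (ξ' : Dual ℂ 𝔤) = ξ) : H.secondMk ξ = H.secondMk ξ' :=
  letI := H.secondAction
  congrArg (OrbitSpace.mk (unipotentGroup 𝔪₀))
    (Subtype.ext (OrbitSpace.mk_eq_mk.2 ⟨⟨g, hg⟩, h⟩))

theorem secondMk_smul_second (H : TwoStage χ₁ χ₂ 𝔪₁ 𝔪₂ 𝔪₀ y₁ x₁ y₂ x₂)
    {ξ ξ' : zeroFibre χ₂ 𝔪₂} {g : 𝔤 ≃ₗ[ℂ] 𝔤} (hg : g ∈ unipotentGroup 𝔪₀)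
    (h : g • (ξ' : Dual ℂ 𝔤) = ξ) : H.secondMk ξ = H.secondMk ξ' :=
  letI := H.secondAction
  OrbitSpace.mk_eq_mk.2 ⟨⟨g, hg⟩, congrArg (OrbitSpace.mk (unipotentGroup 𝔪₁)) (Subtype.ext h)⟩

theorem secondMk_smul_sup (H : TwoStage χ₁ χ₂ 𝔪₁ 𝔪₂ 𝔪₀ y₁ x₁ y₂ x₂) {g : 𝔤 ≃ₗ[ℂ] 𝔤}
    (hg : g ∈ unipotentGroup 𝔪₁ ⊔ unipotentGroup 𝔪₀) :
    ∀ ξ ξ' : zeroFibre χ₂ 𝔪₂, g • (ξ' : Dual ℂ 𝔤) = ξ → H.secondMk ξ = H.secondMk ξ' := by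
  have hle : unipotentGroup 𝔪₁ ⊔ unipotentGroup 𝔪₀ ≤ unipotentGroup 𝔪₂ :=
    sup_le (unipotentGroup_mono H.first_le) (unipotentGroup_mono H.second_le)
  rw [Subgroup.sup_eq_closure] at hg hle
  induction hg using Subgroup.closure_induction with
  | mem g hg =>
    intro ξ ξ' h
    rcases hg with hg | hg
    · exact H.secondMk_smul_first hg h
    · exact H.secondMk_smul_second hg h
  | one =>
    intro ξ ξ' h
    rw [one_smul] at h
    rw [Subtype.ext h]
  | mul g g' _ hg' ih ih' =>
    intro ξ ξ' h
    have h1 : g' • (ξ' : Dual ℂ 𝔤) ∈ zeroFibre χ₂ 𝔪₂ := H.total.smul_mem (hle hg') ξ'.2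
    rw [mul_smul] at h
    exact (ih ξ ⟨_, h1⟩ h).trans (ih' ⟨_, h1⟩ ξ' rfl)
  | inv g _ ih =>
    intro ξ ξ' h
    exact (ih ξ' ξ (by rw [← h, smul_inv_smul])).symm

theorem exists_mem_sup_smul_mem_sliceSet (H : TwoStage χ₁ χ₂ 𝔪₁ 𝔪₂ 𝔪₀ y₁ x₁ y₂ x₂)
    {ξ : Dual ℂ 𝔤} (hξ : ξ ∈ zeroFibre χ₂ 𝔪₂) :
    ∃ g ∈ unipotentGroup 𝔪₁ ⊔ unipotentGroup 𝔪₀,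
      g ∈ unipotentGroup 𝔪₂ ∧ g • ξ ∈ sliceSet χ₂ 𝔪₂ x₂ :=
  H.total.exists_smul_mem_sliceSet _ (fun i => (H.adapted i).elim
    (fun h => ⟨𝔪₁, h, le_sup_left⟩) (fun h => ⟨𝔪₀, h, le_sup_right⟩)) hξ

/-- No factorization of `M₂` is needed: two points of one `M₂`-orbit are moved into the slice by the
group generated by `M₁` and `M₀`, and they coincide there because the orbit meets the slice once. -/
theorem secondMk_eq_iff (H : TwoStage χ₁ χ₂ 𝔪₁ 𝔪₂ 𝔪₀ y₁ x₁ y₂ x₂)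
    (ξ ξ' : zeroFibre χ₂ 𝔪₂) : H.secondMk ξ = H.secondMk ξ' ↔
      OrbitSpace.mk (unipotentGroup 𝔪₂) ξ = OrbitSpace.mk (unipotentGroup 𝔪₂) ξ' := by
  constructor
  · intro h
    obtain ⟨g, hg, h⟩ := H.exists_smul_of_secondMk_eq h
    exact OrbitSpace.mk_eq_mk.2 ⟨⟨g, hg⟩, h⟩
  · intro h
    obtain ⟨g, hg⟩ := OrbitSpace.mk_eq_mk.1 h
    obtain ⟨u, hu, hu₂, huξ⟩ := H.exists_mem_sup_smul_mem_sliceSet ξ.2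
    obtain ⟨u', hu', hu₂', huξ'⟩ := H.exists_mem_sup_smul_mem_sliceSet ξ'.2
    have h1 : u' • (ξ' : Dual ℂ 𝔤) = u • (ξ : Dual ℂ 𝔤) := by
      refine H.total.eq_of_smul_eq huξ' huξ (g := u * g * u'⁻¹)
        (mul_mem (mul_mem hu₂ g.2) (inv_mem hu₂')) ?_
      rw [smul_smul, inv_mul_cancel_right, mul_smul, ← hg]
      rfl
    rw [← H.secondMk_smul_sup hu ⟨_, huξ.1⟩ ξ rfl, H.secondMk_smul_sup hu' ⟨_, huξ.1⟩ ξ' h1]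

/-- The identification of the one-stage reduction with the two-stage reduction. -/
def redEquiv (H : TwoStage χ₁ χ₂ 𝔪₁ 𝔪₂ 𝔪₀ y₁ x₁ y₂ x₂) : HamRed χ₂ 𝔪₂ ≃ H.SecondRed :=
  Equiv.ofBijective
    (OrbitSpace.lift H.secondMk fun ξ ξ' h => (H.secondMk_eq_iff ξ ξ').2 h) <| by
    constructor
    · intro p q h
      obtain ⟨ξ, rfl⟩ := OrbitSpace.mk_surjective p
      obtain ⟨ξ', rfl⟩ := OrbitSpace.mk_surjective q
      exact (H.secondMk_eq_iff ξ ξ').1 h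
    · intro p
      obtain ⟨ξ, rfl⟩ := H.secondMk_surjective p
      exact ⟨OrbitSpace.mk _ ξ, rfl⟩

/-- The regular functions on the two-stage reduction. -/
abbrev secondFunctions (H : TwoStage χ₁ χ₂ 𝔪₁ 𝔪₂ 𝔪₀ y₁ x₁ y₂ x₂) :
    Subalgebra ℂ (H.SecondRed → ℂ) :=
  letI := H.secondAction
  quotientFunctions (unipotentGroup 𝔪₀)
    (restrictFunctions (hamRedFunctions χ₁ 𝔪₁) (H.secondMoment ⁻¹' {0}))

theorem mem_secondFunctions (H : TwoStage χ₁ χ₂ 𝔪₁ 𝔪₂ 𝔪₀ y₁ x₁ y₂ x₂)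
    {φ : H.SecondRed → ℂ} :
    φ ∈ H.secondFunctions ↔ ∃ ψ ∈ hamRedFunctions χ₁ 𝔪₁,
      ∀ ξ : zeroFibre χ₂ 𝔪₂, φ (H.secondMk ξ) = ψ (H.fibrePoint ξ : HamRed χ₁ 𝔪₁) := by
  constructor
  · rintro ⟨ψ, hψ, h⟩
    exact ⟨ψ, hψ, fun ξ => (congrFun h (H.fibrePoint ξ)).symm⟩
  · rintro ⟨ψ, hψ, h⟩
    refine ⟨ψ, hψ, funext fun p => ?_⟩
    obtain ⟨ξ, rfl⟩ := H.fibrePoint_surjective p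
    exact (h ξ).symm

theorem comp_redEquiv_mem (H : TwoStage χ₁ χ₂ 𝔪₁ 𝔪₂ 𝔪₀ y₁ x₁ y₂ x₂)
    {φ : H.SecondRed → ℂ} (hφ : φ ∈ H.secondFunctions) :
    φ ∘ H.redEquiv ∈ hamRedFunctions χ₂ 𝔪₂ := by
  obtain ⟨ψ, hψ, h⟩ := H.mem_secondFunctions.1 hφ
  obtain ⟨X, hX⟩ := mem_polyFunctions.1 hψ
  exact mem_polyFunctions.2 ⟨X, fun ξ => (h ξ).trans (hX ⟨ξ, H.zeroFibre_subset ξ.2⟩)⟩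

/-- By `exists_lift`, an `M₂`-invariant function on `μ₂⁻¹(0)` is the restriction of an
`M₁`-invariant one on `μ₁⁻¹(0)`. -/
theorem mem_secondFunctions_of_comp [FiniteDimensional ℂ 𝔤]
    (H : TwoStage χ₁ χ₂ 𝔪₁ 𝔪₂ 𝔪₀ y₁ x₁ y₂ x₂) {φ : H.SecondRed → ℂ}
    (hφ : φ ∘ H.redEquiv ∈ hamRedFunctions χ₂ 𝔪₂) : φ ∈ H.secondFunctions := by
  obtain ⟨Θ₁, hΘ₁⟩ := H.first.exists_algEquiv_hamRedFunctions
  obtain ⟨Θ₂, hΘ₂⟩ := H.total.exists_algEquiv_hamRedFunctions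
  obtain ⟨⟨w, hw⟩, hw'⟩ := Θ₂.surjective ⟨_, hφ⟩
  obtain ⟨X, rfl⟩ := Ideal.Quotient.mk_surjective w
  obtain ⟨Y, hY, hXY⟩ := H.exists_lift ((modI_mem_classicalW H.total.character).1 hw)
  refine H.mem_secondFunctions.2
    ⟨_, (Θ₁ ⟨modI χ₁ 𝔪₁ Y, (modI_mem_classicalW H.first.character).2 hY⟩).2, fun ξ => ?_⟩
  have h1 : φ (H.secondMk ξ) = evalAt (ξ : Dual ℂ 𝔤) X :=
    (congrFun (congrArg Subtype.val hw') (OrbitSpace.mk _ ξ)).symm.trans (hΘ₂ X hw ξ)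
  have h2 := evalAt_eq_zero_of_mem_span ξ.2 hXY
  rw [map_sub, sub_eq_zero] at h2
  exact (h1.trans h2).trans (hΘ₁ Y _ ⟨ξ, H.zeroFibre_subset ξ.2⟩).symm

theorem mem_secondFunctions_iff [FiniteDimensional ℂ 𝔤]
    (H : TwoStage χ₁ χ₂ 𝔪₁ 𝔪₂ 𝔪₀ y₁ x₁ y₂ x₂) (φ : H.SecondRed → ℂ) :
    φ ∈ H.secondFunctions ↔ φ ∘ H.redEquiv ∈ hamRedFunctions χ₂ 𝔪₂ :=
  ⟨H.comp_redEquiv_mem, H.mem_secondFunctions_of_comp⟩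

/-- The identification of the slice with the two-stage reduction. -/
def sliceEquiv (H : TwoStage χ₁ χ₂ 𝔪₁ 𝔪₂ 𝔪₀ y₁ x₁ y₂ x₂) :
    sliceSet χ₂ 𝔪₂ x₂ ≃ H.SecondRed :=
  (Equiv.ofBijective _ H.total.bijective_mk).trans H.redEquiv

/-- The slice of the one-stage reduction by `𝔪₂` also serves as a slice for `M₀` on `μ₀⁻¹(0)`. -/
theorem second_hasGeometricQuotient [FiniteDimensional ℂ 𝔤]
    (H : TwoStage χ₁ χ₂ 𝔪₁ 𝔪₂ 𝔪₀ y₁ x₁ y₂ x₂) :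
    letI := H.secondAction
    HasGeometricQuotient (unipotentGroup 𝔪₀) (H.secondMoment ⁻¹' {0})
      (restrictFunctions (hamRedFunctions χ₁ 𝔪₁) (H.secondMoment ⁻¹' {0})) := by
  let _ := H.secondAction
  refine hasGeometricQuotient_of_slice H.total.isAffineVariety ?_
    (fun ξ : sliceSet χ₂ 𝔪₂ x₂ => H.fibrePoint ⟨ξ, ξ.2.1⟩) H.sliceEquiv.bijective ?_ ?_
  · intro g p hp
    obtain ⟨ξ, rfl⟩ := OrbitSpace.mk_surjective p
    exact (H.mk_mem_secondFibre ⟨(g : 𝔤 ≃ₗ[ℂ] 𝔤) • (ξ : Dual ℂ 𝔤), H.second_smul_mem g.2 ξ.2⟩).2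
      (H.total.smul_mem (unipotentGroup_mono H.second_le g.2) ((H.mk_mem_secondFibre ξ).1 hp))
  · rintro _ ⟨ψ, hψ, rfl⟩
    obtain ⟨X, hX⟩ := mem_polyFunctions.1 hψ
    exact mem_polyFunctions.2 ⟨X, fun ξ => hX ⟨ξ, H.zeroFibre_subset ξ.2.1⟩⟩
  · intro b hb
    obtain ⟨Θ₂, hΘ₂⟩ := H.total.exists_algEquiv_hamRedFunctions
    obtain ⟨E, hE⟩ := exists_algEquiv_of_equiv H.redEquiv H.mem_secondFunctions_iff
    obtain ⟨X, hX⟩ := mem_polyFunctions.1 hb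
    obtain ⟨Y, hY, hXY⟩ := H.total.exists_projection X
    refine ⟨_, (E (Θ₂ ⟨modI χ₂ 𝔪₂ Y, (modI_mem_classicalW H.total.character).2 hY⟩)).2,
      fun ξ => ?_⟩
    refine (hE _ (OrbitSpace.mk _ ⟨ξ, ξ.2.1⟩)).trans ?_
    rw [hΘ₂, hX ξ]
    exact (SliceFamily.evalAt_eq_of_sub_mem ξ.2.2 hXY).symm

end TwoStage

end TwoStageGeometry

/-! ### Assembly for compatible slice families -/

section Reduction

variable {𝔤 : Type*} [LieRing 𝔤] [LieAlgebra ℂ 𝔤] [FiniteDimensional ℂ 𝔤]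

set_option maxHeartbeats 1000000 in
/-- Hamiltonian reduction in two stages, for compatible slice families. -/
theorem TwoStage.reduction {χ₁ χ₂ : Dual ℂ 𝔤} {𝔪₁ 𝔪₂ 𝔪₀ : LieSubalgebra ℂ 𝔤} {d₁ d₂ : ℕ}
    {y₁ x₁ : Fin d₁ → 𝔤} {y₂ x₂ : Fin d₂ → 𝔤} (H : TwoStage χ₁ χ₂ 𝔪₁ 𝔪₂ 𝔪₀ y₁ x₁ y₂ x₂) :
    ∃ Ψ : stageW χ₁ χ₂ 𝔪₁ 𝔪₀ ≃ₐ[ℂ] classicalW χ₂ 𝔪₂,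
      (∀ a b, Ψ ((stageWPoisson χ₁ χ₂ 𝔪₁ 𝔪₀).bracket a b) =
        (classicalWPoisson χ₂ 𝔪₂).bracket (Ψ a) (Ψ b)) ∧
      (∀ (X : SymmetricAlgebra ℂ 𝔤) (hX₁ : modI χ₁ 𝔪₁ X ∈ classicalW χ₁ 𝔪₁)
        (hX₀ : modI₀ χ₁ χ₂ 𝔪₁ 𝔪₀ ⟨modI χ₁ 𝔪₁ X, hX₁⟩ ∈
          stageW χ₁ χ₂ 𝔪₁ 𝔪₀),
        (Ψ ⟨modI₀ χ₁ χ₂ 𝔪₁ 𝔪₀ ⟨modI χ₁ 𝔪₁ X, hX₁⟩, hX₀⟩ :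
          _ ⧸ Ideal.span (shiftedElements χ₂ 𝔪₂)) = modI χ₂ 𝔪₂ X) ∧
      ∃ (_ : MulAction (unipotentGroup 𝔪₀) (HamRed χ₁ 𝔪₁))
        (μ₀ : HamRed χ₁ 𝔪₁ → Dual ℂ 𝔪₀),
        (∀ (g : unipotentGroup 𝔪₀) (ξ : zeroFibre χ₁ 𝔪₁),
          ∃ h : g • (ξ : Dual ℂ 𝔤) ∈ zeroFibre χ₁ 𝔪₁,
            g • OrbitSpace.mk (unipotentGroup 𝔪₁) ξ =
              OrbitSpace.mk (unipotentGroup 𝔪₁) ⟨g • (ξ : Dual ℂ 𝔤), h⟩) ∧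
        (∀ ξ : zeroFibre χ₁ 𝔪₁,
          μ₀ (OrbitSpace.mk (unipotentGroup 𝔪₁) ξ) = momentMap χ₂ 𝔪₀ ξ) ∧
        HasGeometricQuotient (unipotentGroup 𝔪₀) (μ₀ ⁻¹' {0})
          (restrictFunctions (hamRedFunctions χ₁ 𝔪₁) (μ₀ ⁻¹' {0})) ∧
        ∃ (Θ₁ : classicalW χ₁ 𝔪₁ ≃ₐ[ℂ] hamRedFunctions χ₁ 𝔪₁)
          (Θ₂ : classicalW χ₂ 𝔪₂ ≃ₐ[ℂ] hamRedFunctions χ₂ 𝔪₂)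
          (ΘS : classicalW χ₂ 𝔪₂ ≃ₐ[ℂ] polyFunctions (sliceSet χ₂ 𝔪₂ x₂))
          (Θ₀ : stageW χ₁ χ₂ 𝔪₁ 𝔪₀ ≃ₐ[ℂ]
            quotientFunctions (unipotentGroup 𝔪₀)
              (restrictFunctions (hamRedFunctions χ₁ 𝔪₁) (μ₀ ⁻¹' {0}))),
          (∀ X (hX : modI χ₁ 𝔪₁ X ∈ classicalW χ₁ 𝔪₁) (ξ : zeroFibre χ₁ 𝔪₁),
            (Θ₁ ⟨modI χ₁ 𝔪₁ X, hX⟩ : _ → ℂ) (OrbitSpace.mk (unipotentGroup 𝔪₁) ξ) =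
              evalAt (ξ : Dual ℂ 𝔤) X) ∧
          (∀ X (hX : modI χ₂ 𝔪₂ X ∈ classicalW χ₂ 𝔪₂) (ξ : zeroFibre χ₂ 𝔪₂),
            (Θ₂ ⟨modI χ₂ 𝔪₂ X, hX⟩ : _ → ℂ) (OrbitSpace.mk (unipotentGroup 𝔪₂) ξ) =
              evalAt (ξ : Dual ℂ 𝔤) X) ∧
          (∀ X (hX : modI χ₂ 𝔪₂ X ∈ classicalW χ₂ 𝔪₂) (ξ : sliceSet χ₂ 𝔪₂ x₂),
            (ΘS ⟨modI χ₂ 𝔪₂ X, hX⟩ : _ → ℂ) ξ = evalAt (ξ : Dual ℂ 𝔤) X) ∧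
          (∀ w (hw : modI₀ χ₁ χ₂ 𝔪₁ 𝔪₀ w ∈ stageW χ₁ χ₂ 𝔪₁ 𝔪₀)
            (p : μ₀ ⁻¹' {0}),
            (Θ₀ ⟨modI₀ χ₁ χ₂ 𝔪₁ 𝔪₀ w, hw⟩ : _ → ℂ)
              (OrbitSpace.mk (unipotentGroup 𝔪₀) p) =
                (Θ₁ w : HamRed χ₁ 𝔪₁ → ℂ) (p : HamRed χ₁ 𝔪₁)) ∧
          (∃ σ : HamRed χ₂ 𝔪₂ ≃ OrbitSpace (unipotentGroup 𝔪₀) (μ₀ ⁻¹' {0}),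
            (∀ (ξ : zeroFibre χ₂ 𝔪₂),
              ∃ (h₁ : (ξ : Dual ℂ 𝔤) ∈ zeroFibre χ₁ 𝔪₁)
                (h₀ : OrbitSpace.mk (unipotentGroup 𝔪₁) ⟨(ξ : Dual ℂ 𝔤), h₁⟩ ∈ μ₀ ⁻¹' {0}),
                σ (OrbitSpace.mk (unipotentGroup 𝔪₂) ξ) =
                  OrbitSpace.mk (unipotentGroup 𝔪₀) ⟨_, h₀⟩) ∧
            IsPoissonIso ((classicalWPoisson χ₂ 𝔪₂).transport Θ₂)
              ((stageWPoisson χ₁ χ₂ 𝔪₁ 𝔪₀).transport Θ₀) σ ∧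
            (∀ a p, (Θ₀ a : _ → ℂ) (σ p) = (Θ₂ (Ψ a) : _ → ℂ) p)) ∧
          (∃ τ : sliceSet χ₂ 𝔪₂ x₂ ≃ OrbitSpace (unipotentGroup 𝔪₀) (μ₀ ⁻¹' {0}),
            IsPoissonIso ((classicalWPoisson χ₂ 𝔪₂).transport ΘS)
              ((stageWPoisson χ₁ χ₂ 𝔪₁ 𝔪₀).transport Θ₀) τ) := by
  obtain ⟨Ψ, hΨ, hΨX⟩ := H.exists_algEquiv_stageW
  obtain ⟨Θ₁, hΘ₁⟩ := H.first.exists_algEquiv_hamRedFunctions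
  obtain ⟨Θ₂, hΘ₂⟩ := H.total.exists_algEquiv_hamRedFunctions
  obtain ⟨ΘS, hΘS⟩ := H.total.exists_algEquiv_polyFunctions
  obtain ⟨E, hE⟩ := exists_algEquiv_of_equiv H.redEquiv H.mem_secondFunctions_iff
  -- The identification `Θ₀` is defined through `Ψ`, `Θ₂` and the bijection of quotients, so `Ψ` is
  -- the comorphism by construction. Its compatibility with `Θ₁` is checked afterwards.
  have hσ : ∀ a p, ((Ψ.trans Θ₂).trans E a : _ → ℂ) (H.redEquiv p) =
      (Θ₂ (Ψ a) : _ → ℂ) p := fun a p => hE _ p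
  have hS : ∀ (b : classicalW χ₂ 𝔪₂) (ξ : sliceSet χ₂ 𝔪₂ x₂),
      (Θ₂ b : _ → ℂ) (OrbitSpace.mk (unipotentGroup 𝔪₂) (⟨ξ, ξ.2.1⟩ : zeroFibre χ₂ 𝔪₂)) =
        (ΘS b : _ → ℂ) ξ := by
    rintro ⟨b, hb⟩ ξ
    obtain ⟨X, rfl⟩ := Ideal.Quotient.mk_surjective b
    rw [hΘ₂, hΘS]
  refine ⟨Ψ, hΨ, hΨX, H.secondAction, H.secondMoment,
    fun g ξ => ⟨H.second_smul_mem g.2 ξ.2, rfl⟩, fun ξ => rfl, H.second_hasGeometricQuotient,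
    Θ₁, Θ₂, ΘS, (Ψ.trans Θ₂).trans E, hΘ₁, hΘ₂, hΘS, ?_,
    ⟨H.redEquiv, fun ξ => ⟨H.zeroFibre_subset ξ.2, (H.fibrePoint ξ).2, rfl⟩, ?_, hσ⟩,
    ⟨H.sliceEquiv, ?_⟩⟩
  · rintro ⟨w, hw₁⟩ hw p
    obtain ⟨X, rfl⟩ := Ideal.Quotient.mk_surjective w
    obtain ⟨ξ, rfl⟩ := H.fibrePoint_surjective p
    refine (hσ _ (OrbitSpace.mk _ ξ)).trans ?_
    have h1 := hΨX X hw₁ hw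
    have h2 : modI χ₂ 𝔪₂ X ∈ classicalW χ₂ 𝔪₂ := h1 ▸ (Ψ _).2
    have h3 : Ψ ⟨modI₀ χ₁ χ₂ 𝔪₁ 𝔪₀ ⟨modI χ₁ 𝔪₁ X, hw₁⟩, hw⟩ = ⟨modI χ₂ 𝔪₂ X, h2⟩ :=
      Subtype.ext h1
    rw [h3, hΘ₂]
    exact (hΘ₁ X hw₁ ⟨ξ, H.zeroFibre_subset ξ.2⟩).symm
  · exact isPoissonIso_transport _ _ Ψ hΨ Θ₂ _ H.redEquiv hσ
  · exact isPoissonIso_transport _ _ Ψ hΨ ΘS _ H.sliceEquiv fun a ξ =>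
      (hσ a (OrbitSpace.mk _ ⟨ξ, ξ.2.1⟩)).trans (hS (Ψ a) ξ)

end Reduction

/-! ### Gradings by the integers -/

noncomputable section Gradings

variable {𝔤 : Type*} [AddCommGroup 𝔤] [Module ℂ 𝔤] {Γ : ℤ → Submodule ℂ 𝔤}

/-- The projection to the component of degree `k`. -/
def gradeProj (h : DirectSum.IsInternal Γ) (k : ℤ) : 𝔤 →ₗ[ℂ] 𝔤 :=
  (Γ k).subtype ∘ₗ DirectSum.component ℂ ℤ (fun i => Γ i) k ∘ₗ
    (LinearEquiv.ofBijective (DirectSum.coeLinearMap Γ) h).symm.toLinearMap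

theorem gradeProj_mem (h : DirectSum.IsInternal Γ) (k : ℤ) (x : 𝔤) : gradeProj h k x ∈ Γ k := by
  simp [gradeProj]

theorem gradeProj_of_mem (h : DirectSum.IsInternal Γ) (k : ℤ) {j : ℤ} {x : 𝔤} (hx : x ∈ Γ j) :
    gradeProj h k x = if j = k then x else 0 := by
  have h1 : (LinearEquiv.ofBijective (DirectSum.coeLinearMap Γ) h).symm x =
      DirectSum.lof ℂ ℤ (fun i => Γ i) j ⟨x, hx⟩ := by
    rw [LinearEquiv.symm_apply_eq]
    exact (DirectSum.coeLinearMap_lof Γ j ⟨x, hx⟩).symm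
  simp only [gradeProj, LinearMap.coe_comp, Function.comp_apply, LinearEquiv.coe_coe, h1]
  split_ifs with hjk
  · subst hjk
    simp [DirectSum.component.lof_self]
  · rw [DirectSum.component.of, dif_neg hjk]
    simp

theorem gradeProj_same (h : DirectSum.IsInternal Γ) {k : ℤ} {x : 𝔤} (hx : x ∈ Γ k) :
    gradeProj h k x = x := by
  rw [gradeProj_of_mem h k hx, if_pos rfl]

theorem gradeProj_ne (h : DirectSum.IsInternal Γ) {j k : ℤ} (hjk : j ≠ k) {x : 𝔤}
    (hx : x ∈ Γ j) : gradeProj h k x = 0 := by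
  rw [gradeProj_of_mem h k hx, if_neg hjk]

theorem mem_of_gradeProj_mem (h : DirectSum.IsInternal Γ) {V : Submodule ℂ 𝔤} {v : 𝔤}
    (hv : ∀ k, gradeProj h k v ∈ V) : v ∈ V := by
  classical
  have h1 : v = DirectSum.coeLinearMap Γ
      ((LinearEquiv.ofBijective (DirectSum.coeLinearMap Γ) h).symm v) :=
    ((LinearEquiv.ofBijective (DirectSum.coeLinearMap Γ) h).apply_symm_apply v).symm
  rw [h1, DirectSum.coeLinearMap_eq_dfinsuppSum]
  exact Submodule.sum_mem _ fun k _ => hv k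

theorem eq_zero_of_gradeProj (h : DirectSum.IsInternal Γ) {v : 𝔤}
    (hv : ∀ k, gradeProj h k v = 0) : v = 0 := by
  have := mem_of_gradeProj_mem h (V := ⊥) (v := v) (fun k => by simp [hv k])
  simpa using this

theorem linearMap_ext_of_grading (h : DirectSum.IsInternal Γ) {W : Type*} [AddCommGroup W]
    [Module ℂ W] {S T : 𝔤 →ₗ[ℂ] W} (hST : ∀ k, ∀ x ∈ Γ k, S x = T x) : S = T := by
  ext v
  exact mem_of_gradeProj_mem h (V := LinearMap.eqLocus S T)
    (fun k => hST k _ (gradeProj_mem h k v))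

theorem gradeProj_map (h : DirectSum.IsInternal Γ) {T : 𝔤 →ₗ[ℂ] 𝔤} {d : ℤ}
    (hT : ∀ k, ∀ x ∈ Γ k, T x ∈ Γ (d + k)) (k : ℤ) (v : 𝔤) :
    gradeProj h (d + k) (T v) = T (gradeProj h k v) := by
  have : gradeProj h (d + k) ∘ₗ T = T ∘ₗ gradeProj h k := by
    refine linearMap_ext_of_grading h fun j x hx => ?_
    simp only [LinearMap.coe_comp, Function.comp_apply]
    rw [gradeProj_of_mem h _ (hT j x hx), gradeProj_of_mem h _ hx]
    by_cases hjk : j = k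
    · simp [hjk]
    · rw [if_neg hjk, if_neg (by omega), map_zero]
  exact LinearMap.congr_fun this v

theorem exists_grade_bound [FiniteDimensional ℂ 𝔤] (h : DirectSum.IsInternal Γ) :
    ∃ K : ℕ, ∀ k : ℤ, (K : ℤ) < |k| → Γ k = ⊥ := by
  have hfin : {k | Γ k ≠ ⊥}.Finite :=
    WellFoundedGT.finite_ne_bot_of_iSupIndep h.submodule_iSupIndep
  refine ⟨hfin.toFinset.sup Int.natAbs, fun k hk => ?_⟩
  by_contra hne
  have := Finset.le_sup (f := Int.natAbs) (hfin.mem_toFinset.2 hne)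
  rw [Int.abs_eq_natAbs] at hk
  omega

theorem isNilpotent_of_degree_pos [FiniteDimensional ℂ 𝔤] (h : DirectSum.IsInternal Γ)
    {T : Module.End ℂ 𝔤} {d : ℤ} (hd : 1 ≤ d) (hT : ∀ k, ∀ x ∈ Γ k, T x ∈ Γ (d + k)) :
    IsNilpotent T := by
  obtain ⟨K, hK⟩ := exists_grade_bound h
  have hpow : ∀ (n : ℕ) (k : ℤ), ∀ x ∈ Γ k, (T ^ n) x ∈ Γ (n * d + k) := by
    intro n
    induction n with
    | zero => intro k x hx; simpa using hx
    | succ n ih =>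
      intro k x hx
      rw [pow_succ', Module.End.mul_apply]
      have := hT _ _ (ih k x hx)
      have e : d + (n * d + k) = ((n + 1 : ℕ) : ℤ) * d + k := by push_cast; ring
      rwa [e] at this
  -- Nonzero components have degrees in `[-K, K]`, and `2K + 1` steps of degree at least 1 leave
  -- this range.
  refine ⟨2 * K + 1, linearMap_ext_of_grading h fun k x hx => ?_⟩
  rw [LinearMap.zero_apply]
  by_cases hk : (K : ℤ) < |k|
  · rw [hK k hk, Submodule.mem_bot] at hx
    rw [hx, map_zero]
  · have h1 := hpow (2 * K + 1) k x hx
    rw [hK _ ?_, Submodule.mem_bot] at h1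
    · exact h1
    · rw [not_lt, abs_le] at hk
      refine lt_of_lt_of_le ?_ (le_abs_self _)
      push_cast
      nlinarith

/-- A space that is spanned by homogeneous elements has an ordered homogeneous basis. -/
theorem exists_homogeneous_family [FiniteDimensional ℂ 𝔤] {S : Set 𝔤}
    (hS : ∀ v ∈ S, ∃ k, v ∈ Γ k) :
    ∃ (d : ℕ) (y : Fin d → 𝔤) (k : Fin d → ℤ), Monotone k ∧ (∀ i, y i ∈ S) ∧
      (∀ i, y i ∈ Γ (k i)) ∧ LinearIndependent ℂ y ∧
      Submodule.span ℂ (Set.range y) = Submodule.span ℂ S := by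
  obtain ⟨b, hbS, hspan, hli⟩ := exists_linearIndependent ℂ S
  have : Finite b := hli.finite
  have : Fintype b := Fintype.ofFinite b
  choose deg hdeg using hS
  let ε := (Fintype.equivFin b).symm
  let k₀ : Fin (Fintype.card b) → ℤ := fun i => deg (ε i) (hbS (ε i).2)
  let σ := Tuple.sort k₀
  refine ⟨_, fun i => (ε (σ i) : 𝔤), k₀ ∘ σ, Tuple.monotone_sort k₀, fun i => hbS (ε (σ i)).2,
    fun i => hdeg _ _, ?_, ?_⟩
  · exact hli.comp (fun i => ε (σ i)) (ε.injective.comp σ.injective)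
  · rw [← hspan]
    congr 1
    have : (fun i => (ε (σ i) : 𝔤)) = Subtype.val ∘ (σ.trans ε) := rfl
    rw [this, (σ.trans ε).surjective.range_comp]
    simp

/-- A linearly independent homogeneous family has a homogeneous dual family. -/
theorem exists_homogeneous_dual [FiniteDimensional ℂ 𝔤] (h : DirectSum.IsInternal Γ)
    {B : LinearMap.BilinForm ℂ 𝔤} (hB : B.Nondegenerate)
    (hsymm : ∀ x y, B x y = B y x)
    (horth : ∀ i j : ℤ, i + j ≠ 0 → ∀ x ∈ Γ i, ∀ y ∈ Γ j, B x y = 0)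
    {d : ℕ} {u : Fin d → 𝔤} {k : Fin d → ℤ} (hu : ∀ i, u i ∈ Γ (k i))
    (hli : LinearIndependent ℂ u) :
    ∃ w : Fin d → 𝔤, (∀ j, w j ∈ Γ (-k j)) ∧ ∀ i j, B (u i) (w j) = if i = j then 1 else 0 := by
  have h1 : ∀ j, ∃ w : 𝔤, ∀ i, B w (u i) = if i = j then 1 else 0 := by
    intro j
    obtain ⟨g, hg⟩ := LinearMap.exists_extend ((Basis.span hli).coord j)
    refine ⟨(B.toDual hB).symm g, fun i => ?_⟩
    rw [LinearMap.BilinForm.apply_toDual_symm_apply]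
    have h2 : g (u i) = (g ∘ₗ (Submodule.span ℂ (Set.range u)).subtype) (Basis.span hli i) := by
      simp [Basis.span_apply]
    rw [h2, hg, Basis.coord_apply, Basis.repr_self, Finsupp.single_apply]
  choose w hw using h1
  -- Only the component of degree `-k j` pairs with elements of degree `k j`, so discarding the
  -- others preserves duality.
  refine ⟨fun j => gradeProj h (-k j) (w j), fun j => gradeProj_mem _ _ _, fun i j => ?_⟩
  by_cases hij : k i = k j
  · have h2 : B (u i) ∘ₗ gradeProj h (-k i) = B (u i) := by
      refine linearMap_ext_of_grading h fun l x hx => ?_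
      rw [LinearMap.comp_apply, gradeProj_of_mem h _ hx]
      split_ifs with hl
      · rfl
      · rw [map_zero, horth (k i) l (by omega) _ (hu i) _ hx]
    have h3 := LinearMap.congr_fun h2 (w j)
    rw [LinearMap.comp_apply, hij] at h3
    rw [h3, hsymm, hw]
  · rw [if_neg (fun e => hij (by rw [e]))]
    exact horth (k i) (-k j) (by omega) _ (hu i) _ (gradeProj_mem _ _ _)

end Gradings

/-! ### Good gradings and good algebras -/

noncomputable section GoodGradings

variable {𝔤 : Type*} [LieRing 𝔤] [LieAlgebra ℂ 𝔤] {Γ : ℤ → Submodule ℂ 𝔤}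
  {B : LinearMap.BilinForm ℂ 𝔤} {f q : 𝔤} {𝔪 : LieSubalgebra ℂ 𝔤}

/-- Invariance of `B`, applied to `q`, gives `(i + j) B(x, y) = 0`. -/
theorem IsGradingElement.orthogonal (hq : IsGradingElement Γ q)
    (hinv : ∀ x y z, B ⁅x, y⁆ z = B x ⁅y, z⁆) (i j : ℤ) (hij : i + j ≠ 0) (x : 𝔤) (hx : x ∈ Γ i)
    (y : 𝔤) (hy : y ∈ Γ j) : B x y = 0 := by
  have h := hinv x q y
  rw [← lie_skew, (hq i x).1 hx, (hq j y).1 hy] at h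
  simp only [map_neg, map_smul, LinearMap.neg_apply, LinearMap.smul_apply, smul_eq_mul] at h
  have h2 : ((i + j : ℤ) : ℂ) * B x y = 0 := by
    push_cast
    linear_combination -h
  exact (mul_eq_zero.1 h2).resolve_left (by exact_mod_cast hij)

theorem IsGoodGrading.gradeProj_lie (hΓ : IsGoodGrading Γ f) {i : ℤ} {x : 𝔤} (hx : x ∈ Γ i)
    (k : ℤ) (v : 𝔤) :
    gradeProj hΓ.isInternal (i + k) ⁅x, v⁆ = ⁅x, gradeProj hΓ.isInternal k v⁆ :=
  gradeProj_map hΓ.isInternal (T := LieAlgebra.ad ℂ 𝔤 x)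
    (fun k y hy => hΓ.lie_mem i k x hx y hy) k v

theorem IsGoodGrading.isNilpotent_ad [FiniteDimensional ℂ 𝔤] (hΓ : IsGoodGrading Γ f) {i : ℤ}
    (hi : 1 ≤ i) {x : 𝔤} (hx : x ∈ Γ i) : IsNilpotent (LieAlgebra.ad ℂ 𝔤 x) :=
  isNilpotent_of_degree_pos hΓ.isInternal hi fun k y hy => hΓ.lie_mem i k x hx y hy

namespace IsGoodAlgebra

variable {χ : Dual ℂ 𝔤}

theorem le (h𝔪 : IsGoodAlgebra χ Γ 𝔪) {k : ℤ} (hk : 2 ≤ k) {x : 𝔤} (hx : x ∈ Γ k) : x ∈ 𝔪 := by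
  obtain ⟨𝔩, h1, h2, h3⟩ := h𝔪
  rw [← LieSubalgebra.mem_toSubmodule, h3]
  exact Submodule.mem_sup_right
    (Submodule.mem_iSup_of_mem k (Submodule.mem_iSup_of_mem hk hx))

theorem gradeProj_eq_zero (h𝔪 : IsGoodAlgebra χ Γ 𝔪) (h : DirectSum.IsInternal Γ) {k : ℤ}
    (hk : k ≤ 0) {v : 𝔤} (hv : v ∈ 𝔪) : gradeProj h k v = 0 := by
  obtain ⟨𝔩, h1, h2, h3⟩ := h𝔪
  have h4 : 𝔪.toSubmodule ≤ LinearMap.ker (gradeProj h k) := by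
    rw [h3]
    refine sup_le (fun x hx => ?_) (iSup₂_le fun i hi x hx => ?_)
    · exact gradeProj_ne h (by omega) (h1 hx)
    · exact gradeProj_ne h (by omega) hx
  exact h4 hv

/-- Since `𝔩 = 𝔪 ∩ Γ 1`, the Lagrangian condition can be stated through `𝔪` alone. -/
theorem exists_lagrangian (h𝔪 : IsGoodAlgebra χ Γ 𝔪) (h : DirectSum.IsInternal Γ) :
    (∀ x ∈ Γ 1, x ∈ 𝔪 ↔ ∀ y ∈ 𝔪, y ∈ Γ 1 → χ ⁅x, y⁆ = 0) ∧
      ∀ v ∈ 𝔪, gradeProj h 1 v ∈ 𝔪 := by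
  obtain ⟨𝔩, h1, h2, h3⟩ := h𝔪
  have h4 : 𝔪.toSubmodule ≤ 𝔩.comap (gradeProj h 1) := by
    rw [h3]
    refine sup_le (fun x hx => ?_) (iSup₂_le fun i hi x hx => ?_)
    · rw [Submodule.mem_comap, gradeProj_same h (h1 hx)]
      exact hx
    · rw [Submodule.mem_comap, gradeProj_ne h (by omega) hx]
      exact zero_mem _
  have h5 : 𝔩 ≤ 𝔪.toSubmodule := h3 ▸ le_sup_left
  have h6 : ∀ x ∈ Γ 1, x ∈ 𝔪 ↔ x ∈ 𝔩 := fun x hx =>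
    ⟨fun hm => by simpa [gradeProj_same h hx] using h4 hm, fun hl => h5 hl⟩
  refine ⟨fun x hx => ?_, fun v hv => h5 (h4 hv)⟩
  rw [h6 x hx, h2 x hx]
  exact ⟨fun hy y hy1 hy2 => hy y ((h6 y hy2).1 hy1), fun hy y hyl => hy y (h5 hyl) (h1 hyl)⟩

theorem gradeProj_mem (h𝔪 : IsGoodAlgebra χ Γ 𝔪) (h : DirectSum.IsInternal Γ) (k : ℤ) {v : 𝔤}
    (hv : v ∈ 𝔪) : gradeProj h k v ∈ 𝔪 := by
  rcases lt_trichotomy k 1 with hk | rfl | hk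
  · rw [h𝔪.gradeProj_eq_zero h (by omega) hv]
    exact zero_mem _
  · exact (h𝔪.exists_lagrangian h).2 v hv
  · exact h𝔪.le (k := k) (by omega) (_root_.gradeProj_mem h k v)

theorem degree_pos (h𝔪 : IsGoodAlgebra χ Γ 𝔪) (h : DirectSum.IsInternal Γ) {k : ℤ} {v : 𝔤}
    (hv : v ∈ 𝔪) (hk : v ∈ Γ k) (hne : v ≠ 0) : 1 ≤ k := by
  by_contra hlt
  have := h𝔪.gradeProj_eq_zero h (k := k) (by omega) hv
  rw [gradeProj_same h hk] at this
  exact hne this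

/-- `f` pairs only with degree 2, and `𝔪` lives in degrees at least 1. Only two elements of degree 1
could contribute, and there `𝔪` is isotropic. -/
theorem character (h𝔪 : IsGoodAlgebra (B f) Γ 𝔪) (hΓ : IsGoodGrading Γ f)
    (hq : IsGradingElement Γ q) (hinv : ∀ x y z, B ⁅x, y⁆ z = B x ⁅y, z⁆)
    (a : 𝔤) (ha : a ∈ 𝔪) (b : 𝔤) (hb : b ∈ 𝔪) : B f ⁅a, b⁆ = 0 := by
  have h := hΓ.isInternal
  suffices h1 : ∀ k l, ∀ a ∈ 𝔪, a ∈ Γ k → ∀ b ∈ 𝔪, b ∈ Γ l → B f ⁅a, b⁆ = 0 by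
    have h2 : ∀ k, ∀ a ∈ 𝔪, a ∈ Γ k → B f ⁅a, b⁆ = 0 := fun k a ha hk =>
      mem_of_gradeProj_mem h (V := LinearMap.ker (B f ∘ₗ LieAlgebra.ad ℂ 𝔤 a)) (v := b)
        fun l => h1 k l a ha hk _ (h𝔪.gradeProj_mem h l hb) (_root_.gradeProj_mem h l b)
    have h3 : a ∈ LinearMap.ker (B f ∘ₗ LieAlgebra.ad ℂ 𝔤 b) :=
      mem_of_gradeProj_mem h fun l => by
        have := h2 l _ (h𝔪.gradeProj_mem h l ha) (_root_.gradeProj_mem h l a)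
        rw [← lie_skew, map_neg, neg_eq_zero] at this
        exact this
    rw [← lie_skew, map_neg, neg_eq_zero]
    exact h3
  intro k l a ha hk b hb hl
  by_cases ha0 : a = 0
  · simp [ha0]
  by_cases hb0 : b = 0
  · simp [hb0]
  have hk1 := h𝔪.degree_pos h ha hk ha0
  have hl1 := h𝔪.degree_pos h hb hl hb0
  by_cases hkl : k + l = 2
  · obtain rfl : k = 1 := by omega
    obtain rfl : l = 1 := by omega
    exact ((h𝔪.exists_lagrangian h).1 a hk).1 ha b hb hl
  · exact hq.orthogonal hinv (-2) (k + l) (by omega) f hΓ.mem _ (hΓ.lie_mem k l a hk b hl)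

/-- The space `𝔪` is spanned by its homogeneous elements. -/
theorem span_homogeneous (h𝔪 : IsGoodAlgebra χ Γ 𝔪) (h : DirectSum.IsInternal Γ) :
    Submodule.span ℂ {v | v ∈ 𝔪 ∧ ∃ k, v ∈ Γ k} = 𝔪.toSubmodule := by
  refine le_antisymm (Submodule.span_le.2 fun v hv => hv.1) fun v hv => ?_
  exact mem_of_gradeProj_mem h fun k =>
    Submodule.subset_span ⟨h𝔪.gradeProj_mem h k hv, k, _root_.gradeProj_mem h k v⟩

/-- Injectivity of `ad f` on `𝔪`. -/
theorem eq_zero_of_lie_eq_zero (h𝔪 : IsGoodAlgebra χ Γ 𝔪) (hΓ : IsGoodGrading Γ f) {v : 𝔤}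
    (hv : v ∈ 𝔪) (h0 : ⁅f, v⁆ = 0) : v = 0 := by
  refine eq_zero_of_gradeProj hΓ.isInternal fun k => ?_
  by_cases hk : k ≤ 0
  · exact h𝔪.gradeProj_eq_zero _ hk hv
  · refine hΓ.injective k (by omega) _ (_root_.gradeProj_mem _ _ _) ?_
    rw [← hΓ.gradeProj_lie hΓ.mem, h0, map_zero]

/-- For `j ≤ i`, `[y i, x j]` has degree `k i + 2 - k j ≥ 2`, hence lies in `𝔪`. As `[y j, y i]` has
degree above `k i`, only basis vectors of index above `i` occur in it. -/
theorem sliceFamily [FiniteDimensional ℂ 𝔤] (h𝔪 : IsGoodAlgebra (B f) Γ 𝔪)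
    (hΓ : IsGoodGrading Γ f)
    (hq : IsGradingElement Γ q) (hinv : ∀ x y z, B ⁅x, y⁆ z = B x ⁅y, z⁆)
    {d : ℕ} {y x : Fin d → 𝔤} {k : Fin d → ℤ} (hk : Monotone k) (hy : ∀ i, y i ∈ Γ (k i))
    (hli : LinearIndependent ℂ y) (hspan : Submodule.span ℂ (Set.range y) = 𝔪.toSubmodule)
    (hx : ∀ j, x j ∈ Γ (2 - k j)) (hdual : ∀ i j, B f ⁅y i, x j⁆ = if i = j then 1 else 0) :
    SliceFamily (B f) 𝔪 y x := by
  have h := hΓ.isInternal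
  have hm : ∀ i, y i ∈ 𝔪 := fun i => by
    rw [← LieSubalgebra.mem_toSubmodule, ← hspan]
    exact Submodule.subset_span ⟨i, rfl⟩
  have hpos : ∀ i, 1 ≤ k i := fun i => h𝔪.degree_pos h (hm i) (hy i) (hli.ne_zero i)
  refine ⟨hspan, fun i => hΓ.isNilpotent_ad (hpos i) (hy i), fun i j hji => ?_,
    fun i => by simp [hdual], fun i j hij => by simp [hdual, hij.ne'], fun i j hij => ?_,
    h𝔪.character hΓ hq hinv⟩
  · have := hk hji
    exact h𝔪.le (k := k i + (2 - k j)) (by omega) (hΓ.lie_mem _ _ _ (hy i) _ (hx j))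
  · have h1 : ⁅y j, y i⁆ ∈ Submodule.span ℂ (Set.range y) := by
      rw [hspan]
      exact 𝔪.lie_mem (hm j) (hm i)
    have h2 : Submodule.span ℂ (Set.range y) ≤
        (Submodule.span ℂ (y '' Set.Ioi i)).comap (gradeProj h (k j + k i)) := by
      rw [Submodule.span_le]
      rintro _ ⟨l, rfl⟩
      rw [SetLike.mem_coe, Submodule.mem_comap, gradeProj_of_mem h _ (hy l)]
      split_ifs with hl
      · refine Submodule.subset_span ⟨l, ?_, rfl⟩
        by_contra hle
        have h3 := hk (not_lt.1 hle)
        have h4 := hpos j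
        omega
      · exact zero_mem _
    have h3 := h2 h1
    rwa [Submodule.mem_comap, gradeProj_same h (hΓ.lie_mem _ _ _ (hy j) _ (hy i))] at h3

/-- A good algebra has a slice family. -/
theorem exists_sliceFamily [FiniteDimensional ℂ 𝔤] (h𝔪 : IsGoodAlgebra (B f) Γ 𝔪)
    (hΓ : IsGoodGrading Γ f) (hq : IsGradingElement Γ q) (hsymm : ∀ x y, B x y = B y x)
    (hinv : ∀ x y z, B ⁅x, y⁆ z = B x ⁅y, z⁆) (hB : B.Nondegenerate) :
    ∃ (d : ℕ) (y x : Fin d → 𝔤), SliceFamily (B f) 𝔪 y x := by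
  have h := hΓ.isInternal
  obtain ⟨d, y, k, hk, hyS, hy, hli, hspan⟩ :=
    exists_homogeneous_family (Γ := Γ) (S := {v | v ∈ 𝔪 ∧ ∃ k, v ∈ Γ k}) fun v hv => hv.2
  rw [h𝔪.span_homogeneous h] at hspan
  -- Independence gives a dual family `x j` of the `[f, y i]`, and by invariance `B([f, y i], x j) =
  -- χ([y i, x j])`.
  have hli' : LinearIndependent ℂ fun i => ⁅f, y i⁆ := by
    refine hli.map (f := LieAlgebra.ad ℂ 𝔤 f) ?_
    rw [hspan, Submodule.disjoint_def]
    exact fun v hv h0 => h𝔪.eq_zero_of_lie_eq_zero hΓ hv h0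
  obtain ⟨x, hx, hdual⟩ := exists_homogeneous_dual h hB hsymm
    (hq.orthogonal hinv) (fun i => hΓ.lie_mem _ _ _ hΓ.mem _ (hy i)) hli'
  refine ⟨d, y, x, h𝔪.sliceFamily hΓ hq hinv hk hy hli hspan (fun j => ?_) fun i j => ?_⟩
  · have := hx j
    rwa [show -(-2 + k j) = 2 - k j by ring] at this
  · rw [← hinv]
    exact hdual i j

end IsGoodAlgebra

end GoodGradings

/-! ### The Slodowy slice as a slice of a good algebra -/

noncomputable section SlodowySlices

variable {𝔤 : Type*} [LieRing 𝔤] [LieAlgebra ℂ 𝔤] {Γ : ℤ → Submodule ℂ 𝔤}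
  {B : LinearMap.BilinForm ℂ 𝔤} {e h f q : 𝔤} {𝔪 : LieSubalgebra ℂ 𝔤}

/-! ### The operator `ad e ∘ ad f` in positive degrees -/

namespace IsGradedTriple

theorem lie_h_pow_e (ht : IsGradedTriple Γ e h f) {x : 𝔤} {m : ℂ} (hx : ⁅h, x⁆ = m • x) (i : ℕ) :
    ⁅h, (LieAlgebra.ad ℂ 𝔤 e ^ i) x⁆ = (m + 2 * i) • (LieAlgebra.ad ℂ 𝔤 e ^ i) x := by
  induction i with
  | zero => simpa using hx
  | succ i ih =>
    rw [pow_succ', Module.End.mul_apply, LieAlgebra.ad_apply, leibniz_lie, ih, ht.lie_h_e]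
    simp only [smul_lie, lie_smul, ← add_smul]
    congr 1
    push_cast
    ring

/-- Commuting `f` past the powers of `e` leaves minus the sum of the weights `m + 2j`, `0 ≤ j ≤ i`,
which is `-(i + 1)(m + i)`. -/
theorem lie_f_pow_e (ht : IsGradedTriple Γ e h f) {x : 𝔤} {m : ℂ} (hx : ⁅h, x⁆ = m • x)
    (h0 : ⁅e, ⁅f, x⁆⁆ = 0) (i : ℕ) :
    ⁅f, (LieAlgebra.ad ℂ 𝔤 e ^ (i + 1)) x⁆ =
      (-((i + 1) * (m + i))) • (LieAlgebra.ad ℂ 𝔤 e ^ i) x := by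
  have hfe : ⁅f, e⁆ = -h := by rw [← lie_skew, ht.lie_e_f]
  induction i with
  | zero =>
    rw [pow_succ', Module.End.mul_apply, LieAlgebra.ad_apply, leibniz_lie, hfe]
    simp [h0, hx]
  | succ i ih =>
    rw [pow_succ', Module.End.mul_apply, LieAlgebra.ad_apply, leibniz_lie, hfe, ih, neg_lie,
      ht.lie_h_pow_e hx, lie_smul, ← LieAlgebra.ad_apply ℂ, ← Module.End.mul_apply, ← pow_succ',
      ← neg_smul, ← add_smul]
    congr 1
    push_cast
    ring

/-- A nonzero kernel in degree `k` is `h`-stable and contains an eigenvector `z` of weight `m`. Then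
`[f, z] ≠ 0` is killed by `e`, so `m - 2` is a natural number `n`. The coefficients `(i + 1)(n + 2 +
i)` in `lie_f_pow_e` never vanish, so no power of `ad e` kills `z`, against nilpotency. -/
theorem eq_zero_of_lie_lie_eq_zero [FiniteDimensional ℂ 𝔤] (ht : IsGradedTriple Γ e h f)
    (hΓ : IsGoodGrading Γ f) {k : ℤ} (hk : 1 ≤ k) {x : 𝔤} (hx : x ∈ Γ k)
    (h0 : ⁅e, ⁅f, x⁆⁆ = 0) : x = 0 := by
  by_cases hh : h = 0
  · have hf : f = 0 := by
      have := ht.lie_h_f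
      rw [hh, zero_lie, eq_comm, neg_eq_zero] at this
      exact (smul_eq_zero.1 this).resolve_left two_ne_zero
    exact hΓ.injective k hk x hx (by rw [hf, zero_lie])
  have t : IsSl2Triple h e f := ⟨hh, ht.lie_e_f, by rw [ht.lie_h_e, two_smul, two_nsmul],
    by rw [ht.lie_h_f, two_smul, two_nsmul]⟩
  let W : Submodule ℂ 𝔤 := Γ k ⊓ LinearMap.ker (LieAlgebra.ad ℂ 𝔤 e ∘ₗ LieAlgebra.ad ℂ 𝔤 f)
  have hW : ∀ x ∈ W, LieAlgebra.ad ℂ 𝔤 h x ∈ W := by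
    rintro x ⟨hx1, hx2⟩
    refine ⟨by simpa using hΓ.lie_mem 0 k h ht.h_mem x hx1, ?_⟩
    replace hx2 : ⁅e, ⁅f, x⁆⁆ = 0 := hx2
    change ⁅e, ⁅f, ⁅h, x⁆⁆⁆ = 0
    have h1 : ⁅f, ⁅h, x⁆⁆ = (2 : ℂ) • ⁅f, x⁆ + ⁅h, ⁅f, x⁆⁆ := by
      rw [leibniz_lie f, ← lie_skew f h, ht.lie_h_f, neg_neg, smul_lie]
    have h2 : ⁅e, ⁅h, ⁅f, x⁆⁆⁆ = 0 := by
      rw [leibniz_lie e, hx2, ← lie_skew e h, ht.lie_h_e, neg_lie, smul_lie, hx2]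
      simp
    rw [h1, lie_add, lie_smul, hx2, h2, smul_zero, add_zero]
  by_contra hne
  have : Nontrivial W := ⟨⟨⟨x, hx, h0⟩, 0, fun e => hne (congrArg Subtype.val e)⟩⟩
  obtain ⟨m, hm⟩ := Module.End.exists_eigenvalue ((LieAlgebra.ad ℂ 𝔤 h).restrict hW)
  obtain ⟨⟨z, hz1, hz2⟩, hz⟩ := hm.exists_hasEigenvector
  have hz0 : z ≠ 0 := fun h => hz.2 (Subtype.ext h)
  have hzm : ⁅h, z⁆ = m • z := congrArg Subtype.val hz.apply_eq_smul
  have P : t.HasPrimitiveVectorWith ⁅f, z⁆ (m - 2) :=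
    ⟨fun h => hz0 (hΓ.injective k hk z hz1 h), by
      rw [leibniz_lie, ht.lie_h_f, hzm, neg_lie, smul_lie, lie_smul, sub_smul]; abel, hz2⟩
  obtain ⟨n, hn⟩ := P.exists_nat
  have hm2 : m = n + 2 := by linear_combination hn
  have hpow : ∀ i : ℕ, (LieAlgebra.ad ℂ 𝔤 e ^ i) z ≠ 0 := by
    intro i
    induction i with
    | zero => simpa using hz0
    | succ i ih =>
      intro h
      have h1 := ht.lie_f_pow_e hzm hz2 i
      rw [h, lie_zero, eq_comm, smul_eq_zero, or_iff_left ih, hm2, neg_eq_zero] at h1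
      have h2 : ((i : ℂ) + 1) * (n + 2 + i) = (((i + 1) * (n + 2 + i) : ℕ) : ℂ) := by
        push_cast; ring
      rw [h2, Nat.cast_eq_zero] at h1
      simp at h1
  obtain ⟨N, hN⟩ := hΓ.isNilpotent_ad (by norm_num) ht.e_mem
  exact hpow N (by rw [hN, LinearMap.zero_apply])

theorem exists_lie_lie_eq [FiniteDimensional ℂ 𝔤] (ht : IsGradedTriple Γ e h f)
    (hΓ : IsGoodGrading Γ f) {k : ℤ} (hk : 1 ≤ k) {y : 𝔤} (hy : y ∈ Γ k) :
    ∃ x ∈ Γ k, ⁅e, ⁅f, x⁆⁆ = y := by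
  let T : Module.End ℂ 𝔤 := LieAlgebra.ad ℂ 𝔤 e ∘ₗ LieAlgebra.ad ℂ 𝔤 f
  have hT : ∀ x ∈ Γ k, T x ∈ Γ k := fun x hx => by
    have := hΓ.lie_mem _ _ _ ht.e_mem _ (hΓ.lie_mem _ _ _ hΓ.mem _ hx)
    rwa [add_neg_cancel_left] at this
  have hinj : Function.Injective (T.restrict hT) := by
    rw [← LinearMap.ker_eq_bot, LinearMap.ker_eq_bot']
    rintro ⟨x, hx⟩ h0
    exact Subtype.ext (ht.eq_zero_of_lie_lie_eq_zero hΓ hk hx (congrArg Subtype.val h0))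
  obtain ⟨⟨x, hx⟩, hxy⟩ := LinearMap.injective_iff_surjective.1 hinj ⟨y, hy⟩
  exact ⟨x, hx, congrArg Subtype.val hxy⟩

end IsGradedTriple

/-! ### The Slodowy slice inside the fibre of a good algebra -/

namespace IsGoodAlgebra

theorem eq_zero_of_lie_lie_eq_zero [FiniteDimensional ℂ 𝔤] {χ : Dual ℂ 𝔤}
    (h𝔪 : IsGoodAlgebra χ Γ 𝔪) (hΓ : IsGoodGrading Γ f) (ht : IsGradedTriple Γ e h f) {v : 𝔤}
    (hv : v ∈ 𝔪) (h0 : ⁅e, ⁅f, v⁆⁆ = 0) : v = 0 := by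
  refine eq_zero_of_gradeProj hΓ.isInternal fun k => ?_
  by_cases hk : k ≤ 0
  · exact h𝔪.gradeProj_eq_zero _ hk hv
  · refine ht.eq_zero_of_lie_lie_eq_zero hΓ (by omega) (_root_.gradeProj_mem _ _ _) ?_
    rw [← hΓ.gradeProj_lie hΓ.mem, ← hΓ.gradeProj_lie ht.e_mem, h0, map_zero]

theorem exists_lie_eq [FiniteDimensional ℂ 𝔤] {χ : Dual ℂ 𝔤}
    (h𝔪 : IsGoodAlgebra χ Γ 𝔪) (hΓ : IsGoodGrading Γ f) (ht : IsGradedTriple Γ e h f) {v : 𝔤}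
    (hv : v ∈ 𝔪) : ∃ z, ⁅e, z⁆ = v := by
  suffices v ∈ LinearMap.range (LieAlgebra.ad ℂ 𝔤 e : Module.End ℂ 𝔤) from this
  refine mem_of_gradeProj_mem hΓ.isInternal fun k => ?_
  by_cases hk : k ≤ 0
  · rw [h𝔪.gradeProj_eq_zero _ hk hv]
    exact zero_mem _
  · obtain ⟨x, -, hx⟩ := ht.exists_lie_lie_eq hΓ (k := k) (by omega)
      (_root_.gradeProj_mem hΓ.isInternal k v)
    exact ⟨_, hx⟩

/-- The orthogonal complement of `𝔪` is contained in `[f, 𝔪] + Ker ad e`. -/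
theorem exists_add_of_orthogonal [FiniteDimensional ℂ 𝔤] (h𝔪 : IsGoodAlgebra (B f) Γ 𝔪)
    (hΓ : IsGoodGrading Γ f) (hq : IsGradingElement Γ q) (ht : IsGradedTriple Γ e h f)
    (hinv : ∀ x y z, B ⁅x, y⁆ z = B x ⁅y, z⁆) (hB : B.Nondegenerate) {v : 𝔤}
    (hv : ∀ y ∈ 𝔪, B v y = 0) : ∃ y ∈ 𝔪, ∃ s, ⁅e, s⁆ = 0 ∧ ⁅f, y⁆ + s = v := by
  have hI := hΓ.isInternal
  suffices v ∈ 𝔪.toSubmodule.map (LieAlgebra.ad ℂ 𝔤 f : Module.End ℂ 𝔤) ⊔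
      LinearMap.ker (LieAlgebra.ad ℂ 𝔤 e : Module.End ℂ 𝔤) by
    obtain ⟨_, ⟨y, hy, rfl⟩, s, hs, hsum⟩ := Submodule.mem_sup.1 this
    exact ⟨y, hy, s, hs, hsum⟩
  have hproj : ∀ (k l : ℤ), ∀ y ∈ Γ l, k + l = 0 → B (gradeProj hI k v) y = B v y := by
    intro k l y hy hkl
    have : B.flip y ∘ₗ gradeProj hI k = B.flip y := by
      refine linearMap_ext_of_grading hI fun j x hx => ?_
      rw [LinearMap.comp_apply, gradeProj_of_mem hI _ hx]
      split_ifs with hj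
      · rfl
      · rw [map_zero]
        exact (hq.orthogonal hinv j l (by omega) x hx y hy).symm
    exact LinearMap.congr_fun this v
  refine mem_of_gradeProj_mem hI fun k => ?_
  have hmem := _root_.gradeProj_mem hI k v
  rcases lt_trichotomy k (-1) with hk | rfl | hk
  -- Degree below `-1`: the component pairs only with `Γ (-k) ⊆ 𝔪`, so it vanishes.
  · have : B (gradeProj hI k v) = 0 := by
      refine linearMap_ext_of_grading hI fun l y hy => ?_
      rw [LinearMap.zero_apply]
      by_cases hkl : k + l = 0
      · rw [hproj k l y hy hkl, hv y (h𝔪.le (k := l) (by omega) hy)]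
      · exact hq.orthogonal hinv k l hkl _ hmem y hy
    have h0 : gradeProj hI k v = 0 := (LinearMap.BilinForm.toDual B hB).injective (by
      rw [map_zero]; exact this)
    rw [h0]
    exact zero_mem _
  -- Degree `-1`: the component is `[f, u]`, and orthogonality to `𝔪` puts `u` in the Lagrangian
  -- subspace.
  · obtain ⟨u, hu, huv⟩ := hΓ.surjective 1 le_rfl _ (by simpa using hmem)
    refine Submodule.mem_sup_left ⟨u, ?_, huv⟩
    refine ((h𝔪.exists_lagrangian hI).1 u hu).2 fun y hy hy1 => ?_
    rw [← hinv, huv, hproj _ 1 y hy1 (by norm_num), hv y hy]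
  -- Degree at least 0: subtracting `[f, w]` with `w ∈ Γ (k + 2) ⊆ 𝔪` makes the component commute
  -- with `e`.
  · obtain ⟨w, hw, hwv⟩ := ht.exists_lie_lie_eq hΓ (k := 2 + k) (by omega)
      (hΓ.lie_mem _ _ _ ht.e_mem _ hmem)
    refine Submodule.mem_sup.2 ⟨⁅f, w⁆, ⟨w, h𝔪.le (by omega) hw, rfl⟩,
      gradeProj hI k v - ⁅f, w⁆, ?_, add_sub_cancel _ _⟩
    rw [LinearMap.mem_ker, LieAlgebra.ad_apply, lie_sub, hwv, sub_self]

/-- A good algebra that is spanned by a set of homogeneous elements has a slice family in this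
set, for which the slice is the Slodowy slice. -/
theorem exists_slodowy_sliceFamily [FiniteDimensional ℂ 𝔤] (h𝔪 : IsGoodAlgebra (B f) Γ 𝔪)
    (hΓ : IsGoodGrading Γ f) (hq : IsGradingElement Γ q) (ht : IsGradedTriple Γ e h f)
    (hsymm : ∀ x y, B x y = B y x) (hinv : ∀ x y z, B ⁅x, y⁆ z = B x ⁅y, z⁆)
    (hB : B.Nondegenerate) {S : Set 𝔤} (hS : ∀ v ∈ S, ∃ k, v ∈ Γ k)
    (hspanS : Submodule.span ℂ S = 𝔪.toSubmodule) :
    ∃ (d : ℕ) (y x : Fin d → 𝔤), SliceFamily (B f) 𝔪 y x ∧ (∀ i, y i ∈ S) ∧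
      slodowySlice B e f = sliceSet (B f) 𝔪 x := by
  have hI := hΓ.isInternal
  obtain ⟨d, y, k, hk, hyS, hy, hli, hspan⟩ := exists_homogeneous_family hS
  rw [hspanS] at hspan
  -- Dualizing `[e, [f, y i]]` instead of `[f, y i]` puts `x j = -[e, w j]` in the image of `ad e`,
  -- which is orthogonal to `Ker ad e`.
  have hli' : LinearIndependent ℂ fun i => ⁅e, ⁅f, y i⁆⁆ := by
    refine hli.map (f := LieAlgebra.ad ℂ 𝔤 e ∘ₗ LieAlgebra.ad ℂ 𝔤 f) ?_
    rw [hspan, Submodule.disjoint_def]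
    exact fun v hv h0 => h𝔪.eq_zero_of_lie_lie_eq_zero hΓ ht hv h0
  obtain ⟨w, hw, hdual⟩ := exists_homogeneous_dual hI hB hsymm (hq.orthogonal hinv)
    (fun i => hΓ.lie_mem _ _ _ ht.e_mem _ (hΓ.lie_mem _ _ _ hΓ.mem _ (hy i))) hli'
  have hx : ∀ j, -⁅e, w j⁆ ∈ Γ (2 - k j) := fun j => by
    have := neg_mem (hΓ.lie_mem _ _ _ ht.e_mem _ (hw j))
    rwa [show 2 + -(2 + (-2 + k j)) = 2 - k j by ring] at this
  have hdual' : ∀ i j, B ⁅f, y i⁆ (-⁅e, w j⁆) = if i = j then 1 else 0 := fun i j => by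
    rw [map_neg, ← hinv, ← lie_skew, map_neg, LinearMap.neg_apply, neg_neg]
    exact hdual i j
  have H : SliceFamily (B f) 𝔪 y fun j => -⁅e, w j⁆ :=
    h𝔪.sliceFamily hΓ hq hinv hk hy hli hspan hx fun i j => by rw [← hinv]; exact hdual' i j
  have hker : ∀ s, ⁅e, s⁆ = 0 → ∀ z, B s ⁅e, z⁆ = 0 := fun s hs z => by
    rw [← hinv, ← lie_skew, hs]; simp
  have hfx : ∀ j, B f (-⁅e, w j⁆) = 0 := fun j => by
    have h1 := h𝔪.degree_pos hI (hspan ▸ Submodule.subset_span ⟨j, rfl⟩ : y j ∈ 𝔪.toSubmodule)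
      (hy j) (hli.ne_zero j)
    exact hq.orthogonal hinv (-2) _ (by omega) f hΓ.mem _ (hx j)
  refine ⟨d, y, _, H, hyS, Set.Subset.antisymm ?_ ?_⟩
  · rintro _ ⟨s, hs, rfl⟩
    refine ⟨mem_zeroFibre.2 fun y hy => ?_, fun j => ?_⟩
    · obtain ⟨z, rfl⟩ := h𝔪.exists_lie_eq hΓ ht hy
      simp [hker s hs]
    · rw [map_add, LinearMap.add_apply, hfx, map_neg, hker s hs, neg_zero, add_zero]
  · rintro ξ ⟨h1, h2⟩
    rw [mem_zeroFibre] at h1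
    have hξ : ξ = B ((B.toDual hB).symm ξ) :=
      ((B.toDual hB).apply_symm_apply ξ).symm
    obtain ⟨z, hz, s, hs, hsum⟩ := h𝔪.exists_add_of_orthogonal hΓ hq ht hinv hB
      (v := (B.toDual hB).symm ξ - f) fun y hy => by
        rw [map_sub, LinearMap.sub_apply, ← hξ, h1 y hy, sub_self]
    have hξ' : ξ = B (f + (⁅f, z⁆ + s)) := by rw [hsum, add_sub_cancel, ← hξ]
    -- For `ξ = B(f + [f, z] + s)` the slice equation `ξ(x j) = 0` says that the `j`-th coordinate
    -- of `z` is zero.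
    suffices hz0 : z = 0 by
      refine ⟨s, hs, ?_⟩
      rw [hξ', hz0, lie_zero, zero_add]
    have hz' : z ∈ Submodule.span ℂ (Set.range y) := hspan ▸ hz
    obtain ⟨c, rfl⟩ := (Submodule.mem_span_range_iff_exists_fun ℂ).1 hz'
    refine Finset.sum_eq_zero fun j _ => ?_
    have h3 := h2 j
    rw [hξ', map_add, map_add, LinearMap.add_apply, LinearMap.add_apply, hfx, zero_add,
      map_neg (B s), hker s hs, neg_zero, add_zero, lie_sum, map_sum, LinearMap.sum_apply] at h3
    simp only [lie_smul, map_smul, LinearMap.smul_apply, hdual', smul_eq_mul, mul_ite, mul_one,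
      mul_zero, Finset.sum_ite_eq', Finset.mem_univ, if_true] at h3
    rw [h3, zero_smul]

end IsGoodAlgebra

end SlodowySlices

/-! ### Reduction by stages for good algebras -/

noncomputable section Stages

variable {𝔤 : Type*} [LieRing 𝔤] [LieAlgebra ℂ 𝔤] {Γ : ℤ → Submodule ℂ 𝔤} {q : 𝔤}

theorem IsGradingElement.gradeProj_lie (hq : IsGradingElement Γ q) (h : DirectSum.IsInternal Γ)
    (k : ℤ) (v : 𝔤) : gradeProj h k ⁅q, v⁆ = (k : ℂ) • gradeProj h k v := by
  have : gradeProj h k ∘ₗ LieAlgebra.ad ℂ 𝔤 q = (k : ℂ) • gradeProj h k := by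
    refine linearMap_ext_of_grading h fun j x hx => ?_
    rw [LinearMap.comp_apply, LieAlgebra.ad_apply, (hq j x).1 hx, map_smul, LinearMap.smul_apply,
      gradeProj_of_mem h k hx]
    split_ifs with hjk
    · rw [hjk]
    · rw [smul_zero, smul_zero]
  exact LinearMap.congr_fun this v

/-- A subspace that is stable under the grading element is spanned by homogeneous elements. -/
theorem IsGradingElement.le_span_homogeneous [FiniteDimensional ℂ 𝔤] (hq : IsGradingElement Γ q)
    (h : DirectSum.IsInternal Γ) {V : Submodule ℂ 𝔤} (hV : ∀ v ∈ V, ⁅q, v⁆ ∈ V) :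
    V ≤ Submodule.span ℂ {v | v ∈ V ∧ ∃ k, v ∈ Γ k} := by
  intro v hv
  have h1 : v ∈ ⨆ μ, (LieAlgebra.ad ℂ 𝔤 q : Module.End ℂ 𝔤).genEigenspace μ 1 :=
    mem_of_gradeProj_mem h fun k => Submodule.mem_iSup_of_mem (k : ℂ) <| by
      rw [Module.End.mem_genEigenspace_one]
      exact (hq k _).1 (gradeProj_mem h k v)
  -- A stable subspace is the sum of its intersections with the eigenspaces; eigenvectors with
  -- non-integral eigenvalue then turn out to be zero.
  have h2 := (Submodule.inf_iSup_genEigenspace (f := LieAlgebra.ad ℂ 𝔤 q) hV 1).le ⟨hv, h1⟩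
  refine (iSup_le fun μ w hw => ?_ : _ ≤ Submodule.span ℂ {v | v ∈ V ∧ ∃ k, v ∈ Γ k}) h2
  obtain ⟨hwV, hw⟩ := hw
  replace hw : ⁅q, w⁆ = μ • w := Module.End.mem_genEigenspace_one.1 hw
  by_cases hμ : ∃ k : ℤ, μ = k
  · obtain ⟨k, rfl⟩ := hμ
    exact Submodule.subset_span ⟨hwV, k, (hq k w).2 hw⟩
  · suffices w = 0 by rw [this]; exact zero_mem _
    refine eq_zero_of_gradeProj h fun k => ?_
    have h3 := hq.gradeProj_lie h k w
    rw [hw, map_smul, ← sub_eq_zero, ← sub_smul] at h3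
    exact (smul_eq_zero.1 h3).resolve_left (sub_ne_zero.2 fun e => hμ ⟨k, e⟩)

/-- `ad q` is nilpotent on `𝔥` and multiplies the component of degree `k` by `k`, so components of
nonzero degree vanish. -/
theorem IsGradingElement.mem_zero_of_isNilpotent (hq : IsGradingElement Γ q)
    (h : DirectSum.IsInternal Γ) {𝔥 : LieSubalgebra ℂ 𝔤} [LieRing.IsNilpotent 𝔥] (hq𝔥 : q ∈ 𝔥)
    {x : 𝔤} (hx : x ∈ 𝔥) : x ∈ Γ 0 := by
  obtain ⟨N, hN⟩ := LieModule.isNilpotent_toEnd_of_isNilpotent ℂ 𝔥 𝔥 ⟨q, hq𝔥⟩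
  have hcoe : ∀ n : ℕ, ((LieModule.toEnd ℂ 𝔥 𝔥 ⟨q, hq𝔥⟩ ^ n) ⟨x, hx⟩ : 𝔤) =
      (LieAlgebra.ad ℂ 𝔤 q ^ n) x := by
    intro n
    induction n with
    | zero => simp
    | succ n ih =>
      rw [pow_succ', pow_succ', Module.End.mul_apply, Module.End.mul_apply, ← ih]
      rfl
  have hpow : ∀ (n : ℕ) (k : ℤ), gradeProj h k ((LieAlgebra.ad ℂ 𝔤 q ^ n) x) =
      (k : ℂ) ^ n • gradeProj h k x := by
    intro n k
    induction n with
    | zero => simp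
    | succ n ih =>
      rw [pow_succ', Module.End.mul_apply, LieAlgebra.ad_apply, hq.gradeProj_lie, ih, smul_smul,
        pow_succ']
  refine mem_of_gradeProj_mem h fun k => ?_
  by_cases hk : k = 0
  · rw [hk]
    exact gradeProj_mem h 0 x
  · have h0 := hpow N k
    rw [← hcoe, hN, LinearMap.zero_apply, ZeroMemClass.coe_zero, map_zero, eq_comm,
      smul_eq_zero] at h0
    rw [h0.resolve_left (pow_ne_zero _ (by exact_mod_cast hk))]
    exact zero_mem _

/-- The slice families of the two stages. -/
theorem exists_twoStage [FiniteDimensional ℂ 𝔤]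
    {B : LinearMap.BilinForm ℂ 𝔤} (hB_symm : ∀ x y, B x y = B y x)
    (hB_inv : ∀ x y z, B ⁅x, y⁆ z = B x ⁅y, z⁆) (hB_nondeg : B.Nondegenerate)
    {f₁ f₂ : 𝔤} {Γ₁ Γ₂ : ℤ → Submodule ℂ 𝔤} (hΓ₁ : IsGoodGrading Γ₁ f₁)
    (hΓ₂ : IsGoodGrading Γ₂ f₂) {q₁ q₂ : 𝔤} (hq₁ : IsGradingElement Γ₁ q₁)
    (hq₂ : IsGradingElement Γ₂ q₂)
    {𝔥 : LieSubalgebra ℂ 𝔤} [LieRing.IsNilpotent 𝔥] (hq₁𝔥 : q₁ ∈ 𝔥) (hq₂𝔥 : q₂ ∈ 𝔥)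
    {𝔪₁ 𝔪₂ 𝔪₀ : LieSubalgebra ℂ 𝔤}
    (h𝔪₁ : IsGoodAlgebra (B f₁) Γ₁ 𝔪₁) (h𝔪₂ : IsGoodAlgebra (B f₂) Γ₂ 𝔪₂)
    {e₂ h₂ : 𝔤} (htriple : IsGradedTriple Γ₂ e₂ h₂ f₂)
    (hsup : 𝔪₁.toSubmodule ⊔ 𝔪₀.toSubmodule = 𝔪₂.toSubmodule)
    (hstable : ∀ x ∈ 𝔥, ∀ y ∈ 𝔪₀, ⁅x, y⁆ ∈ 𝔪₀)
    (hideal : ∀ x ∈ 𝔪₂, ∀ y ∈ 𝔪₁, ⁅x, y⁆ ∈ 𝔪₁)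
    (hf₀ : f₂ - f₁ ∈ Γ₁ 0) (h𝔪₀ : 𝔪₀.toSubmodule ≤ Γ₁ 0) :
    ∃ (d₁ d₂ : ℕ) (y₁ x₁ : Fin d₁ → 𝔤) (y₂ x₂ : Fin d₂ → 𝔤),
      TwoStage (B f₁) (B f₂) 𝔪₁ 𝔪₂ 𝔪₀ y₁ x₁ y₂ x₂ ∧
      slodowySlice B e₂ f₂ = sliceSet (B f₂) 𝔪₂ x₂ := by
  have hI₁ := hΓ₁.isInternal
  have hI₂ := hΓ₂.isInternal
  have hq₂0 : q₂ ∈ Γ₁ 0 := hq₁.mem_zero_of_isNilpotent hI₁ hq₁𝔥 hq₂𝔥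
  have hst₂ : ∀ v ∈ 𝔪₂, ⁅q₂, v⁆ ∈ 𝔪₂ := fun v hv =>
    mem_of_gradeProj_mem hI₂ (V := 𝔪₂.toSubmodule) fun k => by
      rw [hq₂.gradeProj_lie]
      exact Submodule.smul_mem _ _ (h𝔪₂.gradeProj_mem hI₂ k hv)
  -- The `𝔪₀`-part of `[q₂, v]` is its component of `Γ₁`-degree 0, which is the bracket of `q₂` with
  -- the zero component of `v`, because `𝔪₁` lives in positive degrees.
  have hst₁ : ∀ v ∈ 𝔪₁, ⁅q₂, v⁆ ∈ 𝔪₁ := by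
    intro v hv
    have hv2 : v ∈ 𝔪₂.toSubmodule := hsup ▸ Submodule.mem_sup_left hv
    have h1 : ⁅q₂, v⁆ ∈ 𝔪₁.toSubmodule ⊔ 𝔪₀.toSubmodule := hsup ▸ hst₂ v hv2
    obtain ⟨a, ha, b, hb, hab⟩ := Submodule.mem_sup.1 h1
    have h2 := hΓ₁.gradeProj_lie hq₂0 0 v
    rw [add_zero, ← hab, map_add, h𝔪₁.gradeProj_eq_zero hI₁ le_rfl ha,
      h𝔪₁.gradeProj_eq_zero hI₁ le_rfl hv, gradeProj_same hI₁ (h𝔪₀ hb), zero_add, lie_zero] at h2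
    rw [← hab, h2, add_zero]
    exact ha
  -- Stability of both summands under `q₂` gives a `Γ₂`-homogeneous spanning set inside `𝔪₁ ∪ 𝔪₀`,
  -- as the field `adapted` requires.
  have hspan : Submodule.span ℂ {v | (v ∈ 𝔪₁ ∨ v ∈ 𝔪₀) ∧ ∃ k, v ∈ Γ₂ k} = 𝔪₂.toSubmodule := by
    refine le_antisymm (Submodule.span_le.2 ?_) ?_
    · rintro v ⟨hv | hv, -⟩
      · exact hsup ▸ Submodule.mem_sup_left hv
      · exact hsup ▸ Submodule.mem_sup_right hv
    · rw [← hsup]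
      refine sup_le ?_ ?_
      · exact (hq₂.le_span_homogeneous hI₂ hst₁).trans
          (Submodule.span_mono fun v hv => ⟨Or.inl hv.1, hv.2⟩)
      · exact (hq₂.le_span_homogeneous hI₂ (hstable q₂ hq₂𝔥)).trans
          (Submodule.span_mono fun v hv => ⟨Or.inr hv.1, hv.2⟩)
  obtain ⟨d₁, y₁, x₁, H₁⟩ := h𝔪₁.exists_sliceFamily hΓ₁ hq₁ hB_symm hB_inv hB_nondeg
  obtain ⟨d₂, y₂, x₂, H₂, hy₂, hS⟩ := h𝔪₂.exists_slodowy_sliceFamily hΓ₂ hq₂ htriple hB_symm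
    hB_inv hB_nondeg (fun v hv => hv.2) hspan
  refine ⟨d₁, d₂, y₁, x₁, y₂, x₂, ⟨H₁, H₂, hsup, hideal, fun a ha => ?_, fun i => (hy₂ i).1⟩, hS⟩
  -- The two characters agree on `𝔪₁`: `f₂ - f₁` has degree 0 and `𝔪₁` only positive degrees.
  suffices B (f₂ - f₁) a = 0 by
    rw [map_sub, LinearMap.sub_apply, sub_eq_zero] at this
    exact this.symm
  refine mem_of_gradeProj_mem hI₁ (V := LinearMap.ker (B (f₂ - f₁))) fun k => ?_
  by_cases hk : k ≤ 0
  · rw [h𝔪₁.gradeProj_eq_zero hI₁ hk ha]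
    exact zero_mem _
  · exact hq₁.orthogonal hB_inv 0 k (by omega) _ hf₀ _ (gradeProj_mem hI₁ k a)

end Stages

/-! ### Reduction by stages for Slodowy slices -/

set_option maxHeartbeats 2000000 in
theorem theorem2p3 {𝔤 : Type*} [LieRing 𝔤] [LieAlgebra ℂ 𝔤] [FiniteDimensional ℂ 𝔤]
    [LieAlgebra.IsSimple ℂ 𝔤]
    -- a nondegenerate symmetric invariant bilinear form
    (B : LinearMap.BilinForm ℂ 𝔤) (hB_symm : ∀ x y, B x y = B y x)
    (hB_inv : ∀ x y z, B ⁅x, y⁆ z = B x ⁅y, z⁆) (hB_nondeg : B.Nondegenerate)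
    -- two nilpotent elements with good gradings, good algebras
    (f₁ f₂ : 𝔤) (hf₁ : IsNilpotent (LieAlgebra.ad ℂ 𝔤 f₁))
    (hf₂ : IsNilpotent (LieAlgebra.ad ℂ 𝔤 f₂))
    (Γ₁ Γ₂ : ℤ → Submodule ℂ 𝔤) (hΓ₁ : IsGoodGrading Γ₁ f₁) (hΓ₂ : IsGoodGrading Γ₂ f₂)
    (q₁ q₂ : 𝔤) (hq₁ : IsGradingElement Γ₁ q₁) (hq₂ : IsGradingElement Γ₂ q₂)
    (𝔥 : LieSubalgebra ℂ 𝔤) (h𝔥 : 𝔥.IsCartanSubalgebra) (hq₁𝔥 : q₁ ∈ 𝔥) (hq₂𝔥 : q₂ ∈ 𝔥)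
    (𝔪₁ 𝔪₂ : LieSubalgebra ℂ 𝔤)
    (h𝔪₁ : IsGoodAlgebra (B f₁) Γ₁ 𝔪₁) (h𝔪₂ : IsGoodAlgebra (B f₂) Γ₂ 𝔪₂)
    (e₂ h₂ : 𝔤) (htriple : IsGradedTriple Γ₂ e₂ h₂ f₂)
    -- `𝔪₂ = 𝔪₁ ⊕ 𝔪₀`, where `𝔪₀` is an `𝔥`-stable subalgebra and `𝔪₁` is an ideal of `𝔪₂`
    (𝔪₀ : LieSubalgebra ℂ 𝔤)
    (hsup : 𝔪₁.toSubmodule ⊔ 𝔪₀.toSubmodule = 𝔪₂.toSubmodule)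
    (hdisj : Disjoint 𝔪₁.toSubmodule 𝔪₀.toSubmodule)
    (hstable : ∀ x ∈ 𝔥, ∀ y ∈ 𝔪₀, ⁅x, y⁆ ∈ 𝔪₀)
    (hideal : ∀ x ∈ 𝔪₂, ∀ y ∈ 𝔪₁, ⁅x, y⁆ ∈ 𝔪₁)
    -- `f₀ = f₂ - f₁` and `𝔪₀` lie in degree `0` of the first grading
    (hf₀ : f₂ - f₁ ∈ Γ₁ 0) (h𝔪₀ : 𝔪₀.toSubmodule ≤ Γ₁ 0)
    -- `q₀ = q₂ - q₁` commutes with `f₁`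
    (hq₀ : ⁅q₂ - q₁, f₁⁆ = 0) :
    -- the one-stage reductions `μ₁⁻¹(0) / M₁` and `μ₂⁻¹(0) / M₂` are well-defined varieties
    HasGeometricQuotient (unipotentGroup 𝔪₁) (zeroFibre (B f₁) 𝔪₁)
      (polyFunctions (zeroFibre (B f₁) 𝔪₁)) ∧
    HasGeometricQuotient (unipotentGroup 𝔪₂) (zeroFibre (B f₂) 𝔪₂)
      (polyFunctions (zeroFibre (B f₂) 𝔪₂)) ∧
    zeroFibre (B f₂) 𝔪₂ ⊆ zeroFibre (B f₁) 𝔪₁ ∧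
    slodowySlice B e₂ f₂ ⊆ zeroFibre (B f₂) 𝔪₂ ∧
    IsAffineVariety (polyFunctions (slodowySlice B e₂ f₂)) ∧
    -- the generators of the ideal `I₀` are in the first W-algebra
    (∀ y ∈ 𝔪₀, modI (B f₁) 𝔪₁ (SymmetricAlgebra.ι ℂ 𝔤 y - algebraMap ℂ _ (B f₂ y)) ∈
      classicalW (B f₁) 𝔪₁) ∧
    -- the algebraic isomorphism `Ψ`
    ∃ Ψ : stageW (B f₁) (B f₂) 𝔪₁ 𝔪₀ ≃ₐ[ℂ] classicalW (B f₂) 𝔪₂,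
      (∀ a b, Ψ ((stageWPoisson (B f₁) (B f₂) 𝔪₁ 𝔪₀).bracket a b) =
        (classicalWPoisson (B f₂) 𝔪₂).bracket (Ψ a) (Ψ b)) ∧
      (∀ (X : SymmetricAlgebra ℂ 𝔤) (hX₁ : modI (B f₁) 𝔪₁ X ∈ classicalW (B f₁) 𝔪₁)
        (hX₀ : modI₀ (B f₁) (B f₂) 𝔪₁ 𝔪₀ ⟨modI (B f₁) 𝔪₁ X, hX₁⟩ ∈
          stageW (B f₁) (B f₂) 𝔪₁ 𝔪₀),
        (Ψ ⟨modI₀ (B f₁) (B f₂) 𝔪₁ 𝔪₀ ⟨modI (B f₁) 𝔪₁ X, hX₁⟩, hX₀⟩ :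
          _ ⧸ Ideal.span (shiftedElements (B f₂) 𝔪₂)) = modI (B f₂) 𝔪₂ X) ∧
      -- the natural action of `M₀` on `μ₁⁻¹(0) / M₁` and its moment map `μ₀`
      ∃ (_ : MulAction (unipotentGroup 𝔪₀) (HamRed (B f₁) 𝔪₁))
        (μ₀ : HamRed (B f₁) 𝔪₁ → Dual ℂ 𝔪₀),
        (∀ (g : unipotentGroup 𝔪₀) (ξ : zeroFibre (B f₁) 𝔪₁),
          ∃ h : g • (ξ : Dual ℂ 𝔤) ∈ zeroFibre (B f₁) 𝔪₁,
            g • OrbitSpace.mk (unipotentGroup 𝔪₁) ξ =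
              OrbitSpace.mk (unipotentGroup 𝔪₁) ⟨g • (ξ : Dual ℂ 𝔤), h⟩) ∧
        (∀ ξ : zeroFibre (B f₁) 𝔪₁,
          μ₀ (OrbitSpace.mk (unipotentGroup 𝔪₁) ξ) = momentMap (B f₂) 𝔪₀ ξ) ∧
        -- `μ₀⁻¹(0) / M₀` is a well-defined variety
        HasGeometricQuotient (unipotentGroup 𝔪₀) (μ₀ ⁻¹' {0})
          (restrictFunctions (hamRedFunctions (B f₁) 𝔪₁) (μ₀ ⁻¹' {0})) ∧
        -- the identifications of coordinate rings that define the Poisson structures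
        ∃ (Θ₁ : classicalW (B f₁) 𝔪₁ ≃ₐ[ℂ] hamRedFunctions (B f₁) 𝔪₁)
          (Θ₂ : classicalW (B f₂) 𝔪₂ ≃ₐ[ℂ] hamRedFunctions (B f₂) 𝔪₂)
          (ΘS : classicalW (B f₂) 𝔪₂ ≃ₐ[ℂ] polyFunctions (slodowySlice B e₂ f₂))
          (Θ₀ : stageW (B f₁) (B f₂) 𝔪₁ 𝔪₀ ≃ₐ[ℂ]
            quotientFunctions (unipotentGroup 𝔪₀)
              (restrictFunctions (hamRedFunctions (B f₁) 𝔪₁) (μ₀ ⁻¹' {0}))),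
          (∀ X (hX : modI (B f₁) 𝔪₁ X ∈ classicalW (B f₁) 𝔪₁) (ξ : zeroFibre (B f₁) 𝔪₁),
            (Θ₁ ⟨modI (B f₁) 𝔪₁ X, hX⟩ : _ → ℂ) (OrbitSpace.mk (unipotentGroup 𝔪₁) ξ) =
              evalAt (ξ : Dual ℂ 𝔤) X) ∧
          (∀ X (hX : modI (B f₂) 𝔪₂ X ∈ classicalW (B f₂) 𝔪₂) (ξ : zeroFibre (B f₂) 𝔪₂),
            (Θ₂ ⟨modI (B f₂) 𝔪₂ X, hX⟩ : _ → ℂ) (OrbitSpace.mk (unipotentGroup 𝔪₂) ξ) =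
              evalAt (ξ : Dual ℂ 𝔤) X) ∧
          (∀ X (hX : modI (B f₂) 𝔪₂ X ∈ classicalW (B f₂) 𝔪₂) (ξ : slodowySlice B e₂ f₂),
            (ΘS ⟨modI (B f₂) 𝔪₂ X, hX⟩ : _ → ℂ) ξ = evalAt (ξ : Dual ℂ 𝔤) X) ∧
          (∀ w (hw : modI₀ (B f₁) (B f₂) 𝔪₁ 𝔪₀ w ∈ stageW (B f₁) (B f₂) 𝔪₁ 𝔪₀)
            (p : μ₀ ⁻¹' {0}),
            (Θ₀ ⟨modI₀ (B f₁) (B f₂) 𝔪₁ 𝔪₀ w, hw⟩ : _ → ℂ)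
              (OrbitSpace.mk (unipotentGroup 𝔪₀) p) = (Θ₁ w : HamRed (B f₁) 𝔪₁ → ℂ) (p : HamRed (B f₁) 𝔪₁)) ∧
          -- the inclusion `μ₂⁻¹(0) ⊆ μ₁⁻¹(0)` induces a Poisson isomorphism with comorphism `Ψ`
          (∃ σ : HamRed (B f₂) 𝔪₂ ≃ OrbitSpace (unipotentGroup 𝔪₀) (μ₀ ⁻¹' {0}),
            (∀ (ξ : zeroFibre (B f₂) 𝔪₂),
              ∃ (h₁ : (ξ : Dual ℂ 𝔤) ∈ zeroFibre (B f₁) 𝔪₁)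
                (h₀ : OrbitSpace.mk (unipotentGroup 𝔪₁) ⟨(ξ : Dual ℂ 𝔤), h₁⟩ ∈ μ₀ ⁻¹' {0}),
                σ (OrbitSpace.mk (unipotentGroup 𝔪₂) ξ) =
                  OrbitSpace.mk (unipotentGroup 𝔪₀) ⟨_, h₀⟩) ∧
            IsPoissonIso ((classicalWPoisson (B f₂) 𝔪₂).transport Θ₂)
              ((stageWPoisson (B f₁) (B f₂) 𝔪₁ 𝔪₀).transport Θ₀) σ ∧
            (∀ a p, (Θ₀ a : _ → ℂ) (σ p) = (Θ₂ (Ψ a) : _ → ℂ) p)) ∧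
          -- `μ₀⁻¹(0) / M₀` is isomorphic to the Slodowy slice as a Poisson variety
          (∃ τ : slodowySlice B e₂ f₂ ≃ OrbitSpace (unipotentGroup 𝔪₀) (μ₀ ⁻¹' {0}),
            IsPoissonIso ((classicalWPoisson (B f₂) 𝔪₂).transport ΘS)
              ((stageWPoisson (B f₁) (B f₂) 𝔪₁ 𝔪₀).transport Θ₀) τ) := by
  have : LieRing.IsNilpotent 𝔥 := h𝔥.nilpotent
  obtain ⟨d₁, d₂, y₁, x₁, y₂, x₂, H, hS⟩ := exists_twoStage hB_symm hB_inv hB_nondeg hΓ₁ hΓ₂ hq₁ hq₂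
    hq₁𝔥 hq₂𝔥 h𝔪₁ h𝔪₂ htriple hsup hstable hideal hf₀ h𝔪₀
  rw [hS]
  exact ⟨H.first.hasGeometricQuotient, H.total.hasGeometricQuotient, H.zeroFibre_subset,
    fun ξ h => h.1, H.total.isAffineVariety,
    fun y hy => (modI_mem_classicalW H.first.character).2 (H.generator_mem hy _), H.reduction⟩
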